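/- Let $\mathcal X$ and $\mathcal A$ be separable metrizable spaces with their Borel $\sigma$-algebras (for countable $\mathcal A$ this is the discrete $\sigma$-algebra). At each step $t\ge 1$ a learner observes a context $X_t\in\mathcal X$ of a stochastic process $\mathbb X=(X_t)_{t\ge1}$, selects an action $\hat a_t\in\mathcal A$ and receives a reward $r_t\in[0,1]$. A learning rule $f_\cdot=(f_t)_{t\ge1}$ is a sequence of measurable, possibly randomized functions with $\hat a_t=f_t((X_s)_{s<t},(r_s)_{s<t},X_t)$; its internal randomization is independent of the contexts and of the randomness of the rewards, and may be shared between steps, so that past actions can be recalled. Write $r_t(a)$ for the (random) reward of action $a$ at step $t$ given the history before step $t$. The randomness of the rewards is fresh at every step, and $r_t(a)$ follows a conditional distribution which - depends on $(t,a,X_t)$ for *oblivious* rewards, - depends on $(t,a,X_1,\dots,X_t)$ for *online* rewards, - depends on $(t,a)$ and the whole sequence $\mathbb X$ for *prescient* rewards, - depends on $a$, $\hat a_1,\dots,\hat a_{t-1}$, $X_1,\dots,X_t$ and $r_1,\dots,r_{t-1}$ (and $t$) for *adversarial* rewards. A rule is universally consistent under $\mathbb X$ for one of these four reward models if for all rewards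 in the model and all measurable $\pi:\mathcal X\to\mathcal A$, $$\limsup_{T\to\infty}\frac1T\sum_{t=1}^T \big(r_t(\pi(X_t))-r_t(\hat a_t)\big)\le 0\quad\text{(a.s.)}.$$ It is optimistically universal for the model if it is universally consistent under every process $\mathbb X$ under which some learning rule is universally consistent for that model. A non-atomic probability measure on $\mathcal X$ is one that vanishes on all singletons. Let $\mathcal C_1$ be the class of processes with $\lim_k\mathbb E\big[\limsup_{T}\frac1T\sum_{t\le T}\mathbf 1_{B_k}(X_t)\big]=0$ for all measurable $B_k\downarrow\emptyset$, and $\mathcal C_2$ the class of processes with $|\{k:\exists t\le T,\ X_t\in B_k\}|=o(T)$ a.s. for all sequences $(B_k)$ of disjoint measurable sets. **Theorem.** 1. If $\mathcal A$ is finite with $|\mathcal A|\ge2$, then for each of the four reward models there exists an optimistically universal learning rule if and only if $\mathcal X$ admits no non-atomic probability measure. 2. If $\mathcal A$ is infinite, then for each of the four reward models there exists an optimistically universal learning rule. 3. If $\mathcal A$ is finite with $|\mathcal A|\ge2$ and $\mathcal X$ admits a non-atomic probability measure, then for each of the four reward models no learning rule is universally consistent both under all processes in $\mathcal C_1$ and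 under all deterministic processes in $\mathcal C_2$. -/

import Mathlib

open MeasureTheory ProbabilityTheory Filter Topology

namespace ContextualBandit

universe u v

/-- Rewards take values in `[0, 1]`. -/
abbrev Reward : Type := Set.Icc (0 : ℝ) 1

/-- A (possibly randomized) learning rule. The internal randomness is a seed drawn once, independently
of everything else; the action at step `t` is a measurable function of the seed, of the previous contexts
and received rewards, and of the current context. Steps are numbered from `0`. As the seed is
shared by all steps, the rule can recompute the actions that it selected before. -/
structure LearningRule (X : Type u) (A : Type v) [MeasurableSpace X] [MeasurableSpace A] where
  Seed : Type
  [seedMeasurableSpace : MeasurableSpace Seed]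
  seedLaw : Measure Seed
  [isProbabilityMeasure_seedLaw : IsProbabilityMeasure seedLaw]
  act : (t : ℕ) → Seed × (Fin t → X) × (Fin t → Reward) × X → A
  measurable_act : ∀ t, Measurable (act t)

attribute [instance] LearningRule.seedMeasurableSpace LearningRule.isProbabilityMeasure_seedLaw

/-- A general reward mechanism: for each step `t`, the conditional distribution of the reward given
the sequence of contexts, the actions and rewards of the steps before `t`, and the action selected
at step `t`. The reward models below restrict what it may depend on. -/
structure RewardMechanism (X : Type u) (A : Type v) [MeasurableSpace X] [MeasurableSpace A] where
  dist : (t : ℕ) → Kernel ((ℕ → X) × (Fin t → A) × (Fin t → Reward) × A) Reward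
  isMarkovKernel_dist : ∀ t, IsMarkovKernel (dist t)

/-- The non-stationary reward models. -/
inductive RewardModel where
  | oblivious
  | online
  | prescient
  | adversarial

/-- The mechanism `P` belongs to the given reward model: the reward at step `t` has a conditional
distribution depending only on
* `(a_t, x_t)` (and `t`) for oblivious rewards,
* `(a_t, x_0, …, x_t)` for online rewards,
* `a_t` and the whole sequence `x` for prescient rewards,
* `(a_0, …, a_t)`, `(x_0, …, x_t)` and `(r_0, …, r_{t-1})` for adversarial rewards. -/
def RewardMechanism.InModel {X : Type u} {A : Type v} [MeasurableSpace X] [MeasurableSpace A]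
    (P : RewardMechanism X A) : RewardModel → Prop
  | .oblivious => ∃ Q : ℕ → Kernel (A × X) Reward,
      ∀ t x as rs a, P.dist t (x, as, rs, a) = Q t (a, x t)
  | .online => ∃ Q : (t : ℕ) → Kernel (A × (Fin (t + 1) → X)) Reward,
      ∀ t x as rs a, P.dist t (x, as, rs, a) = Q t (a, fun i => x i)
  | .prescient => ∃ Q : ℕ → Kernel (A × (ℕ → X)) Reward,
      ∀ t x as rs a, P.dist t (x, as, rs, a) = Q t (a, x)
  | .adversarial =>
      ∃ Q : (t : ℕ) → Kernel (((Fin t → A) × A) × (Fin (t + 1) → X) × (Fin t → Reward)) Reward,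
      ∀ t x as rs a, P.dist t (x, as, rs, a) = Q t ((as, a), (fun i => x i), rs)

/-- Random rewards `r_t(a)`, jointly defined for all actions `a`, with the conditional distributions
of `P`. At step `t` fresh noise is drawn, independent of the contexts, of the seed of the learner
and of the noise of the other steps, and `reward t` gives `r_t(a)` from the noise, the contexts, the
history before `t` and the action `a`. How the rewards of different actions at the same step
depend on each other is left free. -/
structure RewardSampler {X : Type u} {A : Type v} [MeasurableSpace X] [MeasurableSpace A]
    (P : RewardMechanism X A) where
  Noise : Type
  [noiseMeasurableSpace : MeasurableSpace Noise]
  noiseLaw : Measure Noise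
  [isProbabilityMeasure_noiseLaw : IsProbabilityMeasure noiseLaw]
  reward : (t : ℕ) → Noise × (ℕ → X) × (Fin t → A) × (Fin t → Reward) × A → Reward
  measurable_reward : ∀ t, Measurable (reward t)
  map_reward : ∀ t h, noiseLaw.map (fun u => reward t (u, h)) = P.dist t h

attribute [instance] RewardSampler.noiseMeasurableSpace RewardSampler.isProbabilityMeasure_noiseLaw

/-- Every reward mechanism is realized by a sampler, so that consistency below is never vacuous. -/
theorem RewardSampler.nonempty {X : Type u} {A : Type v} [MeasurableSpace X] [MeasurableSpace A]
    (P : RewardMechanism X A) : Nonempty (RewardSampler P) := by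
  have h := fun t => by
    haveI := P.isMarkovKernel_dist t
    exact (P.dist t).exists_measurable_map_eq_unitInterval
  choose g hg hmap using h
  exact ⟨{ Noise := unitInterval
           noiseLaw := volume
           reward := fun t p => g t p.2 p.1
           measurable_reward := fun t => (hg t).comp (measurable_snd.prodMk measurable_fst)
           map_reward := fun t h => hmap t h }⟩

section Interaction

variable {X : Type u} {A : Type v} [MeasurableSpace X] [MeasurableSpace A]
  {P : RewardMechanism X A}

/-- The pair (selected action, received reward) at step `t`, for the learning rule `f` with seed `s`,
contexts `x` and noise `u`. -/
def play (f : LearningRule X A) (S : RewardSampler P) (s : f.Seed) (x : ℕ → X) (u : ℕ → S.Noise)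
    (t : ℕ) : A × Reward :=
  let as : Fin t → A := fun i => (play f S s x u i).1
  let rs : Fin t → Reward := fun i => (play f S s x u i).2
  let a : A := f.act t (s, (fun i => x i), rs, x t)
  (a, S.reward t (u t, x, as, rs, a))
termination_by t
decreasing_by all_goals exact i.isLt

/-- The reward `r_t(a)` that action `a` yields (or would have yielded) at step `t`, given the history
generated by `f`. -/
def rewardOf (f : LearningRule X A) (S : RewardSampler P) (s : f.Seed) (x : ℕ → X)
    (u : ℕ → S.Noise) (t : ℕ) (a : A) : Reward :=
  S.reward t (u t, x, (fun i => (play f S s x u i).1), (fun i => (play f S s x u i).2), a)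

/-- The average excess reward of the policy `π` over the rule `f` in the first `T` steps. -/
noncomputable def averageRegret (f : LearningRule X A) (S : RewardSampler P) (π : X → A)
    (s : f.Seed) (x : ℕ → X) (u : ℕ → S.Noise) (T : ℕ) : ℝ :=
  (∑ t ∈ Finset.range T,
    ((rewardOf f S s x u t (π (x t)) : ℝ) - (rewardOf f S s x u t (play f S s x u t).1 : ℝ))) / T

/-- `f` is consistent under the context process with law `μ` and the rewards with conditional
distributions `P`. Contexts, seed of the learner, and reward noise are independent. -/
def Consistent (f : LearningRule X A) (μ : ProbabilityMeasure (ℕ → X)) (P : RewardMechanism X A) :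
    Prop :=
  ∀ (S : RewardSampler P) (π : X → A), Measurable π →
    ∀ᵐ ω ∂((μ : Measure (ℕ → X)).prod
        (f.seedLaw.prod (Measure.infinitePi (fun _ : ℕ => S.noiseLaw)))),
      limsup (fun T : ℕ => averageRegret f S π ω.2.1 ω.1 ω.2.2 T) atTop ≤ 0

/-- `f` is universally consistent under the process `μ` for the reward model `m`. -/
def UniversallyConsistent (m : RewardModel) (f : LearningRule X A)
    (μ : ProbabilityMeasure (ℕ → X)) : Prop :=
  ∀ P : RewardMechanism X A, P.InModel m → Consistent f μ P

variable (X A) in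
/-- The (laws of) context processes for which universal learning is possible in the model `m`. -/
def learnableProcesses (m : RewardModel) : Set (ProbabilityMeasure (ℕ → X)) :=
  {μ | ∃ f : LearningRule X A, UniversallyConsistent m f μ}

/-- `f` is optimistically universal: universally consistent under every learnable process. -/
def OptimisticallyUniversal (m : RewardModel) (f : LearningRule X A) : Prop :=
  ∀ μ ∈ learnableProcesses X A m, UniversallyConsistent m f μ

end Interaction

section Processes

variable (X : Type u) [MeasurableSpace X]

/-- Processes for which the expected limsup frequency of visits is continuous from above at `∅`. -/
def classC1 : Set (ProbabilityMeasure (ℕ → X)) :=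
  {μ | ∀ B : ℕ → Set X, (∀ k, MeasurableSet (B k)) → Antitone B → ⋂ k, B k = ∅ →
    Tendsto (fun k => ∫⁻ x, limsup (fun T : ℕ =>
        (∑ t ∈ Finset.range T, (B k).indicator (fun _ => (1 : ENNReal)) (x t)) / T) atTop
      ∂(μ : Measure (ℕ → X))) atTop (𝓝 0)}

/-- Processes that visit sublinearly many sets of each sequence of disjoint measurable sets. -/
def classC2 : Set (ProbabilityMeasure (ℕ → X)) :=
  {μ | ∀ B : ℕ → Set X, (∀ k, MeasurableSet (B k)) → Pairwise (Function.onFun Disjoint B) →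
    ∀ᵐ x ∂(μ : Measure (ℕ → X)),
      (fun T : ℕ => (({k | ∃ t < T, x t ∈ B k} : Set ℕ).ncard : ℝ)) =o[atTop]
        (fun T : ℕ => (T : ℝ))}

/-- Deterministic processes. -/
def deterministicProcesses : Set (ProbabilityMeasure (ℕ → X)) :=
  {μ | ∃ x : ℕ → X, (μ : Measure (ℕ → X)) = Measure.dirac x}

/-- `X` carries a probability measure that vanishes on every singleton. -/
def AdmitsNonatomicProbability : Prop :=
  ∃ ν : Measure X, IsProbabilityMeasure ν ∧ ∀ x : X, ν {x} = 0

end Processes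

end ContextualBandit

/-!
Two learning rules give the positive results. Three lower bounds show that no other processes are
learnable, and a fourth one gives the impossibility result.

**Upper bounds.** Both rules are instances of `regretMatchingRule`, which follows a sequence of
experts by regret matching, separately for each value of a key of the context. Rewards of experts
that were not followed are replaced by importance-weighted estimates, and the number of experts in
play grows slowly with the number of visits to the key. Blackwell's condition
(`sum_max_mul_stepRegret`) keeps the estimated regrets of a key sublinear in its number of visits
(`keyRegret_le`). The estimation errors have mean zero given the past of the rule's own
randomization, so a strong law for orthogonal increments removes them
(`ae_eventually_regret_le`). The randomization enters after the contexts and the reward noise have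
been fixed, which is why the bound `regretMatchingRule_regret` holds for all reward models alike.
* With the context itself as key and constant experts, the rule learns whenever the number of
  distinct contexts is sublinear and the actions are finitely many
  (`exists_rule_sublinearDistinct`).
* With a single key and a countable family of decision lists as experts, it learns under all of
  `classC1` when the actions are countably many (`exists_rule_classC1`): under such a process every
  measurable policy agrees with some decision list outside a set that is visited rarely.

**Lower bounds.** The oblivious model is contained in the other three
(`UniversallyConsistent.oblivious`), so deterministic rewards chosen by hidden random labels suffice
for all of them. Consistency for each fixed choice of the labels bounds the regret averaged over the
labels (`UniversallyConsistent.ae_eventually_integral_detRegret_le`), while a label that has not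
influenced any reward so far can be resampled without changing the actions
(`detAct_labelReward_update`).
* If all laws on the context space are purely atomic, at each new context the label is a fair coin
  unknown to the rule, so learnable processes meet a sublinear number of distinct contexts
  (`UniversallyConsistent.ae_sublinearDistinct`).
* If the actions are countably infinite and the upper frequencies of some `B k` decreasing to `∅` do
  not vanish, one hides the good action on `B k` minus `B (k + 1)`, along a subsequence, among so
  many candidates that it cannot be found in time; hence learnable processes are in `classC1`
  (`UniversallyConsistent.mem_classC1`).
* If the actions are uncountably many, some action is almost surely never tried, and nothing is
  learnable (`not_universallyConsistent_of_uncountable`).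

**Impossibility.** Let `f` learn under all of `classC1`, and let `ν` be non-atomic. A process that
cycles, in blocks of factorial length, a fixed number `p` of times through independent samples of
`ν` is in `classC1` (`map_blockProcess_mem_classC1`). Suppose a safe action brings `3 / 4`, and
another one brings `0` or `1` according to the hidden label of the context. A first try of the
latter costs `1 / 4` on average, and what it reveals pays at most `1 / 4` in each later cycle. So
small regret against the safe action forces `f` to leave the other action untried at most points
of a late block (`expectedTried_le`, `exists_decisive_extension`), although the policy that knows
the labels has a linear advantage there. One block of each such process is enough for this, so the
stages `p = 1, 2, …` can be spliced into a single deterministic sequence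
(`exists_diagonal_blocks`). It visits few distinct points since `p` tends to infinity, so it is
in `classC2`, and `f` fails on it (`not_universallyConsistent_classC1_classC2`). For finitely many
actions this also rules out an optimistically universal rule, because both classes are learnable by
the rules above.
-/

open MeasureTheory ProbabilityTheory Filter Topology

namespace ContextualBandit

universe u v

/-! ### Resampling one coordinate of an infinite product -/

section Resampling

variable {ι : Type*} [DecidableEq ι] {V : ι → Type*} [∀ i, MeasurableSpace (V i)]
  (μ : ∀ i, Measure (V i)) [∀ i, IsProbabilityMeasure (μ i)]

/-- Replacing one coordinate of a product-distributed family by a fresh independent sample does not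
change the law. -/
theorem measurePreserving_update (i : ι) :
    MeasurePreserving (fun p : (∀ i, V i) × V i => Function.update p.1 i p.2)
      ((Measure.infinitePi μ).prod (μ i)) (Measure.infinitePi μ) := by
  have hm : Measurable (fun p : (∀ i, V i) × V i => Function.update p.1 i p.2) :=
    measurable_update'
  refine ⟨hm, ?_⟩
  refine Measure.eq_infinitePi μ fun s t ht => ?_
  rw [Measure.map_apply hm (MeasurableSet.pi s.countable_toSet fun j _ => ht j)]
  have hpre : (fun p : (∀ i, V i) × V i => Function.update p.1 i p.2) ⁻¹' (Set.pi s t) =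
      (Set.pi (s.erase i : Finset ι) t) ×ˢ (if i ∈ s then t i else Set.univ) := by
    ext ⟨x, z⟩
    simp only [Set.mem_preimage, Set.mem_pi, Finset.mem_coe, Set.mem_prod, Finset.mem_erase]
    constructor
    · intro h
      refine ⟨fun j hj => ?_, ?_⟩
      · simpa [Function.update_of_ne hj.1] using h j hj.2
      · split_ifs with hi
        · simpa using h i hi
        · trivial
    · rintro ⟨h1, h2⟩ j hj
      by_cases hji : j = i
      · subst hji
        simpa [hj] using h2
      · simpa [Function.update_of_ne hji] using h1 j ⟨hji, hj⟩
  rw [hpre, Measure.prod_prod, Measure.infinitePi_pi μ (fun j _ => ht j)]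
  split_ifs with hi
  · rw [Finset.prod_erase_mul _ _ hi]
  · rw [measure_univ, mul_one, Finset.erase_eq_of_notMem hi]

theorem integrable_of_abs_le {α : Type*} [MeasurableSpace α] {m : Measure α} [IsFiniteMeasure m]
    {f : α → ℝ} (hf : Measurable f) {C : ℝ} (hC : ∀ a, |f a| ≤ C) : Integrable f m :=
  Integrable.of_bound hf.aestronglyMeasurable C (ae_of_all _ fun a => by simpa using hC a)

/-- Resampling formula for integrals, with a further independent component `S`. -/
theorem integral_update_prod {S : Type*} [MeasurableSpace S] (σ : Measure S)
    [IsProbabilityMeasure σ] (i : ι) {h : (∀ i, V i) × S → ℝ} (hm : Measurable h) {C : ℝ}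
    (hC : ∀ a, |h a| ≤ C) :
    ∫ ω, (∫ z, h (Function.update ω.1 i z, ω.2) ∂(μ i)) ∂((Measure.infinitePi μ).prod σ)
      = ∫ ω, h ω ∂((Measure.infinitePi μ).prod σ) := by
  have hg : Measurable (fun p : ((∀ i, V i) × S) × V i =>
      (Function.update p.1.1 i p.2, p.1.2)) :=
    ((measurable_update' (a := i)).comp
      ((measurable_fst.comp measurable_fst).prodMk measurable_snd)).prodMk
      (measurable_snd.comp measurable_fst)
  rw [integral_prod _ (integrable_of_abs_le hm hC), ← integral_prod_swap,
    integral_prod (μ := σ) (ν := Measure.infinitePi μ)]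
  rotate_left
  · have : Measurable (fun ω : (∀ i, V i) × S => ∫ z, h (Function.update ω.1 i z, ω.2) ∂(μ i)) :=
      ((hm.comp hg).stronglyMeasurable.integral_prod_right').measurable
    refine integrable_of_abs_le (C := C) (this.comp measurable_swap) fun a => ?_
    simpa using norm_integral_le_of_norm_le_const (μ := μ i)
      (f := fun z => h (Function.update a.2 i z, a.1)) (ae_of_all _ fun z => by simpa using hC _)
  rw [← integral_prod _ (integrable_of_abs_le hm hC), ← integral_prod_swap,
    integral_prod (μ := σ) (ν := Measure.infinitePi μ)]
  rotate_left
  · exact integrable_of_abs_le (C := C) (hm.comp measurable_swap) fun a => hC _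
  refine integral_congr_ae (ae_of_all _ fun s => ?_)
  have hs : Measurable (fun ω : (∀ i, V i) => h (ω, s)) := hm.comp (by fun_prop)
  have := (measurePreserving_update μ i).map_eq
  simp only [Prod.swap]
  conv_rhs => rw [← this]
  rw [integral_map measurable_update'.aemeasurable hs.aestronglyMeasurable]
  rw [integral_prod (fun p : (∀ i, V i) × V i => h (Function.update p.1 i p.2, s))]
  exact integrable_of_abs_le (C := C) (hs.comp measurable_update') fun a => hC _

theorem integral_update (i : ι) {h : (∀ i, V i) → ℝ} (hm : Measurable h) {C : ℝ}
    (hC : ∀ a, |h a| ≤ C) :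
    ∫ ω, (∫ z, h (Function.update ω i z) ∂(μ i)) ∂(Measure.infinitePi μ)
      = ∫ ω, h ω ∂(Measure.infinitePi μ) := by
  have := (measurePreserving_update μ i).map_eq
  conv_rhs => rw [← this]
  rw [integral_map measurable_update'.aemeasurable hm.aestronglyMeasurable]
  rw [integral_prod (fun p : (∀ i, V i) × V i => h (Function.update p.1 i p.2))]
  exact integrable_of_abs_le (C := C) (hm.comp measurable_update') fun a => hC _

end Resampling

/-! ### A strong law for orthogonal increments -/

section StrongLaw

variable {V : Type*} [MeasurableSpace V] (μ : Measure V) [IsProbabilityMeasure μ]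

/-- Increments that depend on the first `t + 1` coordinates and average out over the last of them
are orthogonal. -/
theorem integral_sum_sq_le {d : ℕ → (ℕ → V) → ℝ} (hd : ∀ t, Measurable (d t)) {c : ℕ → ℝ}
    (hc : ∀ t s, |d t s| ≤ c t)
    (hadapt : ∀ t s s', (∀ i ≤ t, s i = s' i) → d t s = d t s')
    (hzero : ∀ t s, ∫ z, d t (Function.update s t z) ∂μ = 0) (T : ℕ) :
    ∫ s, (∑ t ∈ Finset.range T, d t s) ^ 2 ∂(Measure.infinitePi fun _ : ℕ => μ)
      ≤ ∑ t ∈ Finset.range T, c t ^ 2 := by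
  induction T with
  | zero => simp
  | succ T ih =>
    set M : (ℕ → V) → ℝ := fun s => ∑ t ∈ Finset.range T, d t s with hM
    have hMm : Measurable M := Finset.measurable_sum _ fun t _ => hd t
    have hMb : ∀ s, |M s| ≤ ∑ t ∈ Finset.range T, c t := fun s =>
      (Finset.abs_sum_le_sum_abs _ _).trans (Finset.sum_le_sum fun t _ => hc t s)
    have hMu : ∀ s z, M (Function.update s T z) = M s := fun s z =>
      Finset.sum_congr rfl fun t ht => hadapt t _ _ fun i hi => by
        have := Finset.mem_range.1 ht
        rw [Function.update_of_ne (by omega)]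
    have hMdm : Measurable fun s => M s * d T s := hMm.mul (hd T)
    have hMdb : ∀ a, |M a * d T a| ≤ (∑ t ∈ Finset.range T, c t) * c T := fun a => by
      rw [abs_mul]
      exact mul_le_mul (hMb a) (hc T a) (abs_nonneg _) ((abs_nonneg _).trans (hMb a))
    have hcross : ∫ s, M s * d T s ∂(Measure.infinitePi fun _ : ℕ => μ) = 0 := by
      rw [← integral_update (fun _ : ℕ => μ) T hMdm hMdb]
      simp only [hMu, integral_const_mul, hzero, mul_zero, integral_zero]
    have i1 : Integrable (fun s => M s ^ 2) (Measure.infinitePi fun _ : ℕ => μ) :=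
      integrable_of_abs_le (hMm.pow_const 2) (C := (∑ t ∈ Finset.range T, c t) ^ 2) fun a => by
        rw [abs_pow]; exact pow_le_pow_left₀ (abs_nonneg _) (hMb a) 2
    have i2 : Integrable (fun s => d T s ^ 2) (Measure.infinitePi fun _ : ℕ => μ) :=
      integrable_of_abs_le ((hd T).pow_const 2) (C := (c T) ^ 2) fun a => by
        rw [abs_pow]; exact pow_le_pow_left₀ (abs_nonneg _) (hc T a) 2
    have i3 : Integrable (fun s => M s * d T s) (Measure.infinitePi fun _ : ℕ => μ) :=
      integrable_of_abs_le hMdm hMdb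
    have hdT : ∫ s, d T s ^ 2 ∂(Measure.infinitePi fun _ : ℕ => μ) ≤ c T ^ 2 := by
      calc _ ≤ ∫ _, c T ^ 2 ∂(Measure.infinitePi fun _ : ℕ => μ) :=
            integral_mono i2 (integrable_const _) fun s => by
              rw [← sq_abs (d T s)]; exact pow_le_pow_left₀ (abs_nonneg _) (hc T s) 2
        _ = _ := by simp
    calc ∫ s, (∑ t ∈ Finset.range (T + 1), d t s) ^ 2 ∂(Measure.infinitePi fun _ : ℕ => μ)
        = ∫ s, (M s ^ 2 + 2 * (M s * d T s) + d T s ^ 2) ∂(Measure.infinitePi fun _ : ℕ => μ) := by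
          congr 1; ext s; rw [Finset.sum_range_succ]; ring
      _ = ∫ s, M s ^ 2 ∂(Measure.infinitePi fun _ : ℕ => μ)
          + 2 * ∫ s, M s * d T s ∂(Measure.infinitePi fun _ : ℕ => μ)
          + ∫ s, d T s ^ 2 ∂(Measure.infinitePi fun _ : ℕ => μ) := by
          rw [← integral_const_mul, ← integral_add i1 (i3.const_mul 2)]
          exact integral_add (i1.add (i3.const_mul 2)) i2
      _ ≤ _ := by
          rw [hcross, Finset.sum_range_succ]; linarith

/-- If the second moments of `g k` are summable then `g k → 0` almost surely. -/
theorem ae_tendsto_zero_of_summable_integral_sq {α : Type*} [MeasurableSpace α] {m : Measure α}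
    {g : ℕ → α → ℝ} (hg : ∀ k, Measurable (g k)) (hint : ∀ k, Integrable (fun a => g k a ^ 2) m)
    {b : ℕ → ℝ} (hb : Summable b) (hle : ∀ k, ∫ a, g k a ^ 2 ∂m ≤ b k) :
    ∀ᵐ a ∂m, Tendsto (fun k => g k a) atTop (𝓝 0) := by
  have h1 : ∫⁻ a, ∑' k, ENNReal.ofReal (g k a ^ 2) ∂m ≠ ⊤ := by
    rw [lintegral_tsum fun k => ((hg k).pow_const 2).ennreal_ofReal.aemeasurable]
    have hb0 : ∀ k, 0 ≤ b k := fun k => (integral_nonneg fun a => sq_nonneg _).trans (hle k)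
    refine ne_top_of_le_ne_top (b := ∑' k, ENNReal.ofReal (b k)) ?_ ?_
    · rw [← ENNReal.ofReal_tsum_of_nonneg hb0 hb]; exact ENNReal.ofReal_ne_top
    · refine ENNReal.tsum_le_tsum fun k => ?_
      rw [← ofReal_integral_eq_lintegral_ofReal (hint k) (ae_of_all _ fun a => sq_nonneg _)]
      exact ENNReal.ofReal_le_ofReal (hle k)
  have h2 := ae_lt_top (Measurable.tsum
    fun k => ((hg k).pow_const 2).ennreal_ofReal) h1
  filter_upwards [h2] with a ha
  have h3 := ENNReal.tendsto_atTop_zero_of_tsum_ne_top ha.ne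
  have h4 := (ENNReal.tendsto_toReal (a := 0) (by simp)).comp h3
  have h5 : Tendsto (fun k => g k a ^ 2) atTop (𝓝 0) := by
    refine (by simpa using h4 : Tendsto _ atTop (𝓝 (0 : ℝ))).congr fun k => ?_
    simp [ENNReal.toReal_ofReal (sq_nonneg _)]
  have h6 := h5.sqrt
  simp only [Real.sqrt_sq_eq_abs, Real.sqrt_zero] at h6
  exact (tendsto_zero_iff_abs_tendsto_zero _).2 h6

end StrongLaw

/-! ### Bounded sequences and their limsup -/

theorem limsup_le_zero_of_forall_eventually_le {g : ℕ → ℝ} {C : ℝ} (hC : ∀ T, |g T| ≤ C)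
    (h : ∀ ε > 0, ∀ᶠ T in atTop, g T ≤ ε) : limsup g atTop ≤ 0 := by
  refine le_of_forall_pos_le_add fun ε hε => ?_
  rw [zero_add]
  refine limsup_le_of_le ?_ (h ε hε)
  exact isCoboundedUnder_le_of_le atTop (x := -C) fun T => (abs_le.1 (hC T)).1

theorem eventually_le_of_limsup_le_zero {g : ℕ → ℝ} {C : ℝ} (hC : ∀ T, |g T| ≤ C)
    (h : limsup g atTop ≤ 0) {ε : ℝ} (hε : 0 < ε) : ∀ᶠ T in atTop, g T < ε :=
  eventually_lt_of_limsup_lt (h.trans_lt hε)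
    (isBoundedUnder_of ⟨C, fun T => (abs_le.1 (hC T)).2⟩)

/-- Reverse Fatou lemma for uniformly bounded functions. -/
theorem eventually_integral_le_of_ae_limsup_le_zero {α : Type*} [MeasurableSpace α] {m : Measure α}
    [IsProbabilityMeasure m] {g : ℕ → α → ℝ} (hg : ∀ T, Measurable (g T)) {C : ℝ}
    (hC : ∀ T a, |g T a| ≤ C) (h : ∀ᵐ a ∂m, limsup (fun T => g T a) atTop ≤ 0) {ε : ℝ}
    (hε : 0 < ε) : ∀ᶠ T in atTop, ∫ a, g T a ∂m ≤ ε := by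
  have h1 : Tendsto (fun T => ∫ a, max (g T a) 0 ∂m) atTop (𝓝 (∫ _, (0 : ℝ) ∂m)) := by
    refine tendsto_integral_of_dominated_convergence (fun _ => |C|)
      (fun T => ((hg T).max measurable_const).aestronglyMeasurable) (integrable_const _)
      (fun T => ae_of_all _ fun a => ?_) ?_
    · rw [Real.norm_eq_abs, abs_of_nonneg (le_max_right _ _)]
      exact max_le ((le_abs_self _).trans ((hC T a).trans (le_abs_self _))) (abs_nonneg _)
    · filter_upwards [h] with a ha
      rw [Metric.tendsto_atTop]
      intro δ hδ
      obtain ⟨N, hN⟩ := eventually_atTop.1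
        (eventually_le_of_limsup_le_zero (fun T => hC T a) ha hδ)
      refine ⟨N, fun T hT => ?_⟩
      rw [Real.dist_eq, sub_zero, abs_of_nonneg (le_max_right _ _)]
      exact max_lt (hN T hT) hδ
  rw [integral_zero] at h1
  filter_upwards [h1.eventually_lt_const hε] with T hT
  refine le_trans (integral_mono (integrable_of_abs_le (hg T) (hC T)) ?_ fun a => le_max_left _ _)
    hT.le
  exact (integrable_of_abs_le (hg T) (hC T)).sup (integrable_zero _ _ _)

/-! ### The interaction of a rule with a reward mechanism -/

section Interaction

variable {X : Type u} {A : Type v} [MeasurableSpace X] [MeasurableSpace A]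
  {P : RewardMechanism X A}

theorem play_fst (f : LearningRule X A) (S : RewardSampler P) (s : f.Seed) (x : ℕ → X)
    (u : ℕ → S.Noise) (t : ℕ) :
    (play f S s x u t).1 =
      f.act t (s, (fun i : Fin t => x i), (fun i : Fin t => (play f S s x u i).2), x t) := by
  rw [play]

theorem play_snd (f : LearningRule X A) (S : RewardSampler P) (s : f.Seed) (x : ℕ → X)
    (u : ℕ → S.Noise) (t : ℕ) :
    (play f S s x u t).2 = rewardOf f S s x u t (play f S s x u t).1 := by
  rw [play_fst, play, rewardOf]

theorem measurable_play (f : LearningRule X A) (S : RewardSampler P) (t : ℕ) :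
    Measurable fun p : (ℕ → X) × f.Seed × (ℕ → S.Noise) => play f S p.2.1 p.1 p.2.2 t := by
  induction t using Nat.strong_induction_on with
  | _ t ih =>
    have has : Measurable fun p : (ℕ → X) × f.Seed × (ℕ → S.Noise) =>
        fun i : Fin t => (play f S p.2.1 p.1 p.2.2 i).1 :=
      measurable_pi_lambda _ fun i => (ih i i.2).fst
    have hrs : Measurable fun p : (ℕ → X) × f.Seed × (ℕ → S.Noise) =>
        fun i : Fin t => (play f S p.2.1 p.1 p.2.2 i).2 :=
      measurable_pi_lambda _ fun i => (ih i i.2).snd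
    have hxs : Measurable fun p : (ℕ → X) × f.Seed × (ℕ → S.Noise) =>
        fun i : Fin t => p.1 i := by fun_prop
    have ha := (f.measurable_act t).comp ((measurable_fst.comp measurable_snd).prodMk
      (hxs.prodMk (hrs.prodMk (measurable_pi_apply t |>.comp measurable_fst))))
    have hr := (S.measurable_reward t).comp
      ((((measurable_pi_apply t).comp (measurable_snd.comp measurable_snd)).prodMk
        (measurable_fst.prodMk (has.prodMk (hrs.prodMk ha)))))
    convert ha.prodMk hr using 2 with p
    rw [play]
    rfl

theorem measurable_rewardOf (f : LearningRule X A) (S : RewardSampler P) (t : ℕ)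
    {a : (ℕ → X) × f.Seed × (ℕ → S.Noise) → A} (ha : Measurable a) :
    Measurable fun p : (ℕ → X) × f.Seed × (ℕ → S.Noise) =>
      rewardOf f S p.2.1 p.1 p.2.2 t (a p) := by
  have has : Measurable fun p : (ℕ → X) × f.Seed × (ℕ → S.Noise) =>
      fun i : Fin t => (play f S p.2.1 p.1 p.2.2 i).1 :=
    measurable_pi_lambda _ fun i => (measurable_play f S i).fst
  have hrs : Measurable fun p : (ℕ → X) × f.Seed × (ℕ → S.Noise) =>
      fun i : Fin t => (play f S p.2.1 p.1 p.2.2 i).2 :=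
    measurable_pi_lambda _ fun i => (measurable_play f S i).snd
  exact (S.measurable_reward t).comp
      ((((measurable_pi_apply t).comp (measurable_snd.comp measurable_snd)).prodMk
        (measurable_fst.prodMk (has.prodMk (hrs.prodMk ha)))))

theorem measurable_averageRegret (f : LearningRule X A) (S : RewardSampler P) {π : X → A}
    (hπ : Measurable π) (T : ℕ) :
    Measurable fun p : (ℕ → X) × f.Seed × (ℕ → S.Noise) =>
      averageRegret f S π p.2.1 p.1 p.2.2 T := by
  unfold averageRegret
  refine Measurable.div_const (Finset.measurable_sum _ fun t _ => Measurable.sub ?_ ?_) _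
  · exact (measurable_rewardOf f S t
      (hπ.comp ((measurable_pi_apply t).comp measurable_fst))).subtype_val
  · exact (measurable_rewardOf f S t (measurable_play f S t).fst).subtype_val

theorem abs_reward_sub_le (r r' : Reward) : |(r : ℝ) - r'| ≤ 1 := by
  have h1 := r.2; have h2 := r'.2
  rw [abs_le]; constructor <;> linarith [h1.1, h1.2, h2.1, h2.2]

theorem abs_sum_div_le_one {g : ℕ → ℝ} (hg : ∀ t, |g t| ≤ 1) (T : ℕ) :
    |(∑ t ∈ Finset.range T, g t) / T| ≤ 1 := by
  rw [abs_div, Nat.abs_cast]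
  refine div_le_one_of_le₀ ((Finset.abs_sum_le_sum_abs _ _).trans ?_) (Nat.cast_nonneg _)
  calc ∑ t ∈ Finset.range T, |g t| ≤ ∑ t ∈ Finset.range T, (1 : ℝ) :=
        Finset.sum_le_sum fun t _ => hg t
    _ = T := by simp

theorem abs_averageRegret_le (f : LearningRule X A) (S : RewardSampler P) (π : X → A)
    (s : f.Seed) (x : ℕ → X) (u : ℕ → S.Noise) (T : ℕ) :
    |averageRegret f S π s x u T| ≤ 1 :=
  abs_sum_div_le_one (fun _ => abs_reward_sub_le _ _) T

/-- It suffices to prove consistency for fixed contexts and fixed reward noise, the only randomness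
left being the seed of the rule. -/
theorem consistent_of_ae_seed {f : LearningRule X A} {μ : ProbabilityMeasure (ℕ → X)}
    {P : RewardMechanism X A}
    (h : ∀ (S : RewardSampler P) (π : X → A), Measurable π → ∀ᵐ x ∂(μ : Measure (ℕ → X)),
      ∀ u, ∀ᵐ s ∂f.seedLaw, limsup (fun T : ℕ => averageRegret f S π s x u T) atTop ≤ 0) :
    Consistent f μ P := by
  intro S π hπ
  have hmeas : MeasurableSet {ω : (ℕ → X) × f.Seed × (ℕ → S.Noise) |
      limsup (fun T : ℕ => averageRegret f S π ω.2.1 ω.1 ω.2.2 T) atTop ≤ 0} :=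
    measurableSet_le (Measurable.limsup fun T => measurable_averageRegret f S hπ T)
      measurable_const
  rw [Measure.ae_prod_iff_ae_ae hmeas]
  filter_upwards [h S π hπ] with x hx
  have hmx : MeasurableSet {y : f.Seed × (ℕ → S.Noise) |
      limsup (fun T : ℕ => averageRegret f S π y.1 x y.2 T) atTop ≤ 0} :=
    measurable_prodMk_left hmeas
  rw [Measure.ae_prod_iff_ae_ae hmx, Measure.ae_ae_comm hmx]
  exact ae_of_all _ hx

theorem RewardMechanism.InModel.of_oblivious {P : RewardMechanism X A} (m : RewardModel)
    (h : P.InModel .oblivious) : P.InModel m := by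
  obtain ⟨Q, hQ⟩ := h
  cases m with
  | oblivious => exact ⟨Q, hQ⟩
  | online =>
    refine ⟨fun t => (Q t).comap (fun p => (p.1, p.2 (Fin.last t))) (by fun_prop), ?_⟩
    intro t x as rs a
    simp [hQ]
  | prescient =>
    refine ⟨fun t => (Q t).comap (fun p => (p.1, p.2 t)) (by fun_prop), ?_⟩
    intro t x as rs a
    simp [hQ]
  | adversarial =>
    refine ⟨fun t => (Q t).comap (fun p => (p.1.2, p.2.1 (Fin.last t))) (by fun_prop), ?_⟩
    intro t x as rs a
    simp [hQ]

/-- Oblivious rewards are a special case of each of the other models. -/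
theorem UniversallyConsistent.oblivious {m : RewardModel} {f : LearningRule X A}
    {μ : ProbabilityMeasure (ℕ → X)} (h : UniversallyConsistent m f μ) :
    UniversallyConsistent .oblivious f μ :=
  fun P hP => h P (hP.of_oblivious m)

end Interaction

/-! ### Sampling from a weight vector -/

section Sampling

open Classical in
/-- The law on `ℕ` with the given weights, or a Dirac mass if the weights do not sum to `1`. -/
noncomputable def weightLaw (w : ℕ → ℝ) : Measure ℕ :=
  if ∑' i, ENNReal.ofReal (w i) = 1 then Measure.sum fun i => ENNReal.ofReal (w i) • Measure.dirac i
  else Measure.dirac 0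

/-- `weightLaw` as a Markov kernel. -/
noncomputable def weightKernel : Kernel (ℕ → ℝ) ℕ where
  toFun := weightLaw
  measurable' := by
    refine Measurable.ite ?_ ?_ measurable_const
    · refine measurableSet_eq_fun (Measurable.tsum fun i => ?_) measurable_const
      exact (measurable_pi_apply i).ennreal_ofReal
    · refine Measure.measurable_of_measurable_coe _ fun S hS => ?_
      simp only [Measure.sum_apply _ hS, Measure.smul_apply, smul_eq_mul]
      exact Measurable.tsum fun i => (measurable_pi_apply i).ennreal_ofReal.mul_const _

instance : IsMarkovKernel weightKernel where
  isProbabilityMeasure w := by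
    change IsProbabilityMeasure (weightLaw w)
    unfold weightLaw
    split_ifs with h
    · exact ⟨by simpa [Measure.sum_apply _ MeasurableSet.univ] using h⟩
    · infer_instance

/-- A measurable sampler: for uniform `z`, the index `sampleIndex w z` has law `weightLaw w`. -/
noncomputable def sampleIndex : (ℕ → ℝ) → unitInterval → ℕ :=
  Classical.choose weightKernel.exists_measurable_map_eq_unitInterval

theorem measurable_sampleIndex : Measurable (Function.uncurry sampleIndex) :=
  (Classical.choose_spec weightKernel.exists_measurable_map_eq_unitInterval).1

theorem measurable_sampleIndex_comp {α : Type*} [MeasurableSpace α] {w : α → ℕ → ℝ}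
    {z : α → unitInterval} (hw : Measurable w) (hz : Measurable z) :
    Measurable fun a => sampleIndex (w a) (z a) :=
  measurable_sampleIndex.comp (hw.prodMk hz)

theorem integral_sampleIndex {w : ℕ → ℝ} {N : ℕ} (h0 : ∀ i, 0 ≤ w i) (hN : ∀ i, N ≤ i → w i = 0)
    (h1 : ∑ i ∈ Finset.range N, w i = 1) (g : ℕ → ℝ) :
    ∫ z, g (sampleIndex w z) = ∑ i ∈ Finset.range N, w i * g i := by
  have hsamp : Measurable (sampleIndex w) := measurable_sampleIndex.comp measurable_prodMk_left
  have hmap : (volume : Measure unitInterval).map (sampleIndex w) = weightLaw w :=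
    (Classical.choose_spec weightKernel.exists_measurable_map_eq_unitInterval).2 w
  have hsum : ∑' i, ENNReal.ofReal (w i) = 1 := by
    rw [tsum_eq_sum (s := Finset.range N)
      fun i hi => by rw [hN i (by simpa using hi), ENNReal.ofReal_zero],
      ← ENNReal.ofReal_sum_of_nonneg fun i _ => h0 i, h1, ENNReal.ofReal_one]
  have hlaw : weightLaw w = ∑ i ∈ Finset.range N, ENNReal.ofReal (w i) • Measure.dirac i := by
    rw [weightLaw, if_pos hsum]
    ext S hS
    rw [Measure.sum_apply _ hS, Measure.finsetSum_apply]
    exact tsum_eq_sum fun i hi => by simp [hN i (by simpa using hi)]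
  have hint : ∫ z, g (sampleIndex w z) = ∫ i, g i ∂(weightLaw w) := by
    rw [← hmap, integral_map hsamp.aemeasurable (measurable_of_countable g).aestronglyMeasurable]
  rw [hint, hlaw, integral_finsetSum_measure]
  · refine Finset.sum_congr rfl fun i _ => ?_
    rw [integral_smul_measure, integral_dirac, ENNReal.toReal_ofReal (h0 i), smul_eq_mul]
  · intro i _
    exact (integrable_dirac (by simp)).smul_measure ENNReal.ofReal_ne_top

end Sampling

/-! ### One step of regret matching -/

section Step

/-- Number of experts that are considered when a key is met for the `(n + 1)`-st time; it grows to
infinity, but slowly: importance weights are of order `k ^ 2` when `k` experts are in play, and the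
exponent `10` keeps the accumulated squared estimates, at most `k ^ 5` per step, and the variance of
the noise negligible. -/
def activeCount (n : ℕ) : ℕ := Nat.findGreatest (fun k => k ^ 10 ≤ n + 1) (n + 1)

theorem activeCount_pow_le (n : ℕ) : activeCount n ^ 10 ≤ n + 1 :=
  Nat.findGreatest_spec (P := fun k => k ^ 10 ≤ n + 1) (m := 1) (by omega) (by simp)

theorem le_activeCount {k n : ℕ} (h : k ^ 10 ≤ n + 1) : k ≤ activeCount n :=
  Nat.le_findGreatest ((Nat.le_self_pow (by norm_num) k).trans h) h

theorem one_le_activeCount (n : ℕ) : 1 ≤ activeCount n := le_activeCount (by simp)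

theorem activeCount_mono : Monotone activeCount := fun m n h =>
  le_activeCount ((activeCount_pow_le m).trans (by omega))

theorem activeCount_pow_five_le (n : ℕ) : (activeCount n : ℝ) ^ 5 ≤ √((n : ℝ) + 1) := by
  apply Real.le_sqrt_of_sq_le
  rw [← pow_mul]
  exact_mod_cast activeCount_pow_le n

/-- Regret matching: probabilities proportional to the positive parts of the regrets `R`. -/
noncomputable def matchProb (R : ℕ → ℝ) (N i : ℕ) : ℝ :=
  if ∑ j ∈ Finset.range N, max (R j) 0 = 0 then 1 / N
  else max (R i) 0 / ∑ j ∈ Finset.range N, max (R j) 0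

/-- Regret matching mixed with uniform exploration at rate `1 / N`, on the experts below `N`. -/
noncomputable def playProb (R : ℕ → ℝ) (N i : ℕ) : ℝ :=
  if i < N then (1 - 1 / N) * matchProb R N i + 1 / N * (1 / N) else 0

/-- Importance-weighted estimate of the reward of expert `i`, when expert `k` was played and
brought the reward `y`. -/
noncomputable def rewardEstimate (R : ℕ → ℝ) (N k : ℕ) (y : ℝ) (i : ℕ) : ℝ :=
  if k = i then y / playProb R N i else 0

/-- Estimated regret of one step with respect to expert `i`. -/
noncomputable def stepRegret (R : ℕ → ℝ) (N k : ℕ) (y : ℝ) (i : ℕ) : ℝ :=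
  if i < N then rewardEstimate R N k y i -
    ∑ j ∈ Finset.range N, matchProb R N j * rewardEstimate R N k y j
  else 0

variable {R : ℕ → ℝ} {N : ℕ}

theorem matchProb_nonneg (R : ℕ → ℝ) (N i : ℕ) : 0 ≤ matchProb R N i := by
  unfold matchProb
  split_ifs
  · positivity
  · exact div_nonneg (le_max_right _ _) (Finset.sum_nonneg fun j _ => le_max_right _ _)

theorem sum_matchProb (R : ℕ → ℝ) (hN : 1 ≤ N) : ∑ i ∈ Finset.range N, matchProb R N i = 1 := by
  unfold matchProb
  split_ifs with h
  · have : (N : ℝ) ≠ 0 := by positivity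
    simp [this]
  · rw [← Finset.sum_div, div_self h]

theorem playProb_nonneg (R : ℕ → ℝ) (N i : ℕ) : 0 ≤ playProb R N i := by
  unfold playProb
  split_ifs with h
  · have h1 : (1 : ℝ) ≤ N := by exact_mod_cast (by omega : 1 ≤ N)
    have h2 : 0 ≤ 1 - 1 / (N : ℝ) := by rw [sub_nonneg, div_le_one (by linarith)]; exact h1
    have := mul_nonneg h2 (matchProb_nonneg R N i)
    positivity
  · exact le_rfl

theorem inv_sq_le_playProb (R : ℕ → ℝ) {i : ℕ} (hi : i < N) : 1 / (N : ℝ) ^ 2 ≤ playProb R N i := by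
  have h1 : (1 : ℝ) ≤ N := by exact_mod_cast (by omega : 1 ≤ N)
  have h2 : 0 ≤ 1 - 1 / (N : ℝ) := by rw [sub_nonneg, div_le_one (by linarith)]; exact h1
  have := mul_nonneg h2 (matchProb_nonneg R N i)
  rw [playProb, if_pos hi]
  have h3 : 1 / (N : ℝ) * (1 / N) = 1 / (N : ℝ) ^ 2 := by rw [div_mul_div_comm, one_mul, sq]
  linarith

theorem playProb_pos (R : ℕ → ℝ) {i : ℕ} (hi : i < N) : 0 < playProb R N i := by
  have h1 : (1 : ℝ) ≤ N := by exact_mod_cast (by omega : 1 ≤ N)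
  exact lt_of_lt_of_le (by positivity) (inv_sq_le_playProb R hi)

theorem sum_playProb_mul (R : ℕ → ℝ) (N : ℕ) (g : ℕ → ℝ) :
    ∑ i ∈ Finset.range N, playProb R N i * g i =
      (1 - 1 / N) * ∑ i ∈ Finset.range N, matchProb R N i * g i +
        1 / N * ∑ i ∈ Finset.range N, 1 / N * g i := by
  rw [Finset.mul_sum, Finset.mul_sum, ← Finset.sum_add_distrib]
  refine Finset.sum_congr rfl fun i hi => ?_
  rw [playProb, if_pos (Finset.mem_range.1 hi)]
  ring

theorem sum_playProb (R : ℕ → ℝ) (hN : 1 ≤ N) : ∑ i ∈ Finset.range N, playProb R N i = 1 := by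
  have h := sum_playProb_mul R N fun _ => 1
  have h0 : (N : ℝ) ≠ 0 := by positivity
  simp only [mul_one] at h
  rw [h, sum_matchProb R hN, Finset.sum_const, Finset.card_range, nsmul_eq_mul]
  field_simp
  ring

theorem integral_sampleIndex_playProb (R : ℕ → ℝ) (hN : 1 ≤ N) (g : ℕ → ℝ) :
    ∫ z, g (sampleIndex (playProb R N) z) = ∑ i ∈ Finset.range N, playProb R N i * g i :=
  integral_sampleIndex (playProb_nonneg R N) (fun i hi => by simp [playProb, hi.not_gt])
    (sum_playProb R hN) g

theorem rewardEstimate_nonneg (R : ℕ → ℝ) (N k : ℕ) {y : ℝ} (hy : 0 ≤ y) (i : ℕ) :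
    0 ≤ rewardEstimate R N k y i := by
  unfold rewardEstimate
  split_ifs
  · exact div_nonneg hy (playProb_nonneg R N i)
  · exact le_rfl

theorem rewardEstimate_le (R : ℕ → ℝ) (k : ℕ) {y : ℝ} (hy1 : y ≤ 1) {i : ℕ}
    (hi : i < N) : rewardEstimate R N k y i ≤ (N : ℝ) ^ 2 := by
  unfold rewardEstimate
  split_ifs
  · have h1 : (1 : ℝ) ≤ N := by exact_mod_cast (by omega : 1 ≤ N)
    rw [div_le_iff₀ (playProb_pos R hi)]
    have := mul_le_mul_of_nonneg_left (inv_sq_le_playProb R hi) (sq_nonneg (N : ℝ))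
    rw [mul_one_div_cancel (by positivity)] at this
    linarith
  · positivity

theorem abs_stepRegret_le (R : ℕ → ℝ) (k : ℕ) {y : ℝ} (hy : 0 ≤ y) (hy1 : y ≤ 1) (i : ℕ) :
    |stepRegret R N k y i| ≤ (N : ℝ) ^ 2 := by
  unfold stepRegret
  split_ifs with hi
  · have h1 := rewardEstimate_nonneg R N k hy i
    have h2 := rewardEstimate_le R k hy1 hi
    have h3 : 0 ≤ ∑ j ∈ Finset.range N, matchProb R N j * rewardEstimate R N k y j :=
      Finset.sum_nonneg fun j _ =>
        mul_nonneg (matchProb_nonneg R N j) (rewardEstimate_nonneg R N k hy j)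
    have h4 : ∑ j ∈ Finset.range N, matchProb R N j * rewardEstimate R N k y j ≤ (N : ℝ) ^ 2 := by
      calc _ ≤ ∑ j ∈ Finset.range N, matchProb R N j * (N : ℝ) ^ 2 :=
            Finset.sum_le_sum fun j hj => mul_le_mul_of_nonneg_left
              (rewardEstimate_le R k hy1 (Finset.mem_range.1 hj)) (matchProb_nonneg R N j)
        _ = _ := by rw [← Finset.sum_mul, sum_matchProb R (by omega), one_mul]
    rw [abs_le]; constructor <;> linarith
  · simp

/-- Blackwell's condition: the estimated regret of a step is orthogonal to the positive part of the
accumulated regret, whatever expert is played. -/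
theorem sum_max_mul_stepRegret (R : ℕ → ℝ) (k : ℕ) (y : ℝ) {M : ℕ} (hM : N ≤ M) :
    ∑ i ∈ Finset.range M, max (R i) 0 * stepRegret R N k y i = 0 := by
  have h1 : ∑ i ∈ Finset.range M, max (R i) 0 * stepRegret R N k y i =
      ∑ i ∈ Finset.range N, max (R i) 0 * stepRegret R N k y i := by
    symm
    refine Finset.sum_subset (Finset.range_subset_range.2 hM) fun i _ hi => ?_
    simp only [Finset.mem_range] at hi
    simp [stepRegret, hi]
  set P := ∑ j ∈ Finset.range N, max (R j) 0 with hP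
  by_cases h0 : P = 0
  · rw [h1]
    refine Finset.sum_eq_zero fun i hi => ?_
    rw [(Finset.sum_eq_zero_iff_of_nonneg fun j _ => le_max_right _ _).1 h0 i hi, zero_mul]
  · rw [h1]
    have h2 : ∀ i ∈ Finset.range N, max (R i) 0 * stepRegret R N k y i =
        max (R i) 0 * rewardEstimate R N k y i - max (R i) 0 *
          ∑ j ∈ Finset.range N, matchProb R N j * rewardEstimate R N k y j := fun i hi => by
      rw [stepRegret, if_pos (Finset.mem_range.1 hi)]; ring
    rw [Finset.sum_congr rfl h2, Finset.sum_sub_distrib, ← Finset.sum_mul, ← hP, Finset.mul_sum,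
      sub_eq_zero]
    refine Finset.sum_congr rfl fun i hi => ?_
    rw [matchProb, ← hP, if_neg h0]
    field_simp

/-- The squared norm of the positive part of the regrets grows at most by the squared norm of the
step. -/
theorem sum_max_add_stepRegret_sq_le (R : ℕ → ℝ) (k : ℕ) {y : ℝ} (hy : 0 ≤ y) (hy1 : y ≤ 1)
    {M : ℕ} (hM : N ≤ M) :
    ∑ i ∈ Finset.range M, max (R i + stepRegret R N k y i) 0 ^ 2 ≤
      ∑ i ∈ Finset.range M, max (R i) 0 ^ 2 + (N : ℝ) ^ 5 := by
  have h1 : ∀ a b : ℝ, max (a + b) 0 ^ 2 ≤ max a 0 ^ 2 + 2 * (max a 0 * b) + b ^ 2 := by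
    intro a b
    rw [show max a 0 ^ 2 + 2 * (max a 0 * b) + b ^ 2 = (max a 0 + b) ^ 2 by ring]
    rcases le_total (a + b) 0 with h | h
    · rw [max_eq_right h]; simpa using sq_nonneg _
    · rw [max_eq_left h]
      exact pow_le_pow_left₀ h (by linarith [le_max_left a 0]) 2
  have h2 : ∑ i ∈ Finset.range M, stepRegret R N k y i ^ 2 ≤ (N : ℝ) ^ 5 := by
    have : ∑ i ∈ Finset.range M, stepRegret R N k y i ^ 2 =
        ∑ i ∈ Finset.range N, stepRegret R N k y i ^ 2 := by
      symm
      refine Finset.sum_subset (Finset.range_subset_range.2 hM) fun i _ hi => ?_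
      simp only [Finset.mem_range] at hi
      simp [stepRegret, hi]
    rw [this]
    calc _ ≤ ∑ i ∈ Finset.range N, ((N : ℝ) ^ 2) ^ 2 := Finset.sum_le_sum fun i _ => by
          rw [← sq_abs]
          exact pow_le_pow_left₀ (abs_nonneg _) (abs_stepRegret_le R k hy hy1 i) 2
      _ = _ := by rw [Finset.sum_const, Finset.card_range, nsmul_eq_mul]; ring
  calc _ ≤ ∑ i ∈ Finset.range M, (max (R i) 0 ^ 2 + 2 * (max (R i) 0 * stepRegret R N k y i)
        + stepRegret R N k y i ^ 2) := Finset.sum_le_sum fun i _ => h1 _ _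
    _ = ∑ i ∈ Finset.range M, max (R i) 0 ^ 2
        + 2 * ∑ i ∈ Finset.range M, max (R i) 0 * stepRegret R N k y i
        + ∑ i ∈ Finset.range M, stepRegret R N k y i ^ 2 := by
        rw [Finset.sum_add_distrib, Finset.sum_add_distrib, Finset.mul_sum]
    _ ≤ _ := by rw [sum_max_mul_stepRegret R k y hM]; linarith

/-- The estimated regret of a step is unbiased. -/
theorem sum_playProb_mul_stepRegret (R : ℕ → ℝ) {i : ℕ} (hi : i < N) (y : ℕ → ℝ) :
    ∑ k ∈ Finset.range N, playProb R N k * stepRegret R N k (y k) i =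
      y i - ∑ k ∈ Finset.range N, matchProb R N k * y k := by
  have h1 : ∀ k ∈ Finset.range N, playProb R N k * stepRegret R N k (y k) i =
      (if k = i then y i else 0) - matchProb R N k * y k := by
    intro k hk
    have hk' := Finset.mem_range.1 hk
    have hp := (playProb_pos R hk').ne'
    rw [stepRegret, if_pos hi, Finset.sum_eq_single k
      (fun j _ hj => by rw [rewardEstimate, if_neg hj.symm, mul_zero]) (fun h => absurd hk h),
      rewardEstimate, rewardEstimate, if_pos rfl, mul_sub]
    congr 1
    · split_ifs with h
      · subst h; field_simp
      · simp
    · field_simp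
  rw [Finset.sum_congr rfl h1, Finset.sum_sub_distrib, Finset.sum_ite_eq',
    if_pos (Finset.mem_range.2 hi)]

section Measurability

variable {α : Type*} [MeasurableSpace α] {Rf : α → ℕ → ℝ}

theorem measurable_matchProb (hR : ∀ i, Measurable fun a => Rf a i) (N i : ℕ) :
    Measurable fun a => matchProb (Rf a) N i := by
  unfold matchProb
  have h : Measurable fun a => ∑ j ∈ Finset.range N, max (Rf a j) 0 :=
    Finset.measurable_sum _ fun j _ => (hR j).max measurable_const
  exact Measurable.ite (measurableSet_eq_fun h measurable_const) measurable_const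
    (((hR i).max measurable_const).div h)

theorem measurable_playProb (hR : ∀ i, Measurable fun a => Rf a i) (N i : ℕ) :
    Measurable fun a => playProb (Rf a) N i := by
  unfold playProb
  split_ifs
  · exact ((measurable_matchProb hR N i).const_mul _).add_const _
  · exact measurable_const

theorem measurable_stepRegret (hR : ∀ i, Measurable fun a => Rf a i) (N : ℕ) {k : α → ℕ}
    (hk : Measurable k) {y : α → ℝ} (hy : Measurable y) (i : ℕ) :
    Measurable fun a => stepRegret (Rf a) N (k a) (y a) i := by
  have he : ∀ j, Measurable fun a => rewardEstimate (Rf a) N (k a) (y a) j := fun j =>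
    Measurable.ite (measurableSet_eq_fun hk measurable_const)
      (hy.div (measurable_playProb hR N j)) measurable_const
  unfold stepRegret
  split_ifs
  · exact (he i).sub (Finset.measurable_sum _ fun j _ => (measurable_matchProb hR N j).mul (he j))
  · exact measurable_const

end Measurability

end Step

/-! ### Regret matching run separately for each key -/

section Recursion

variable {Y : Type*}

open Classical in
/-- Number of steps before `T` whose key is `z`. -/
noncomputable def keyCount (κ : ℕ → Y) (z : Y) (T : ℕ) : ℕ :=
  ((Finset.range T).filter fun j => κ j = z).card

/-- Number of experts that are active at step `t`. -/
noncomputable def activeAt (κ : ℕ → Y) (t : ℕ) : ℕ := activeCount (keyCount κ (κ t) t)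

open Classical in
/-- Estimated regrets of step `t` for keys `κ`, seed `s` and rewards `y t k` of the experts `k`. -/
noncomputable def stepEst (κ : ℕ → Y) (s : ℕ → unitInterval) (y : ℕ → ℕ → ℝ) (t : ℕ) : ℕ → ℝ :=
  let R : ℕ → ℝ := fun i => ∑ j : Fin t, if κ j = κ t then stepEst κ s y j i else 0
  let k := sampleIndex (playProb R (activeAt κ t)) (s t)
  stepRegret R (activeAt κ t) k (y t k)
termination_by t
decreasing_by exact j.isLt

open Classical in
/-- Estimated regrets accumulated before `T` at the steps with key `z`. -/
noncomputable def keyRegret (κ : ℕ → Y) (s : ℕ → unitInterval) (y : ℕ → ℕ → ℝ) (z : Y) (T : ℕ) :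
    ℕ → ℝ :=
  fun i => ∑ j ∈ Finset.range T, if κ j = z then stepEst κ s y j i else 0

/-- The expert that is followed at step `t`. -/
noncomputable def arm (κ : ℕ → Y) (s : ℕ → unitInterval) (y : ℕ → ℕ → ℝ) (t : ℕ) : ℕ :=
  sampleIndex (playProb (keyRegret κ s y (κ t) t) (activeAt κ t)) (s t)

variable {κ κ' : ℕ → Y} {s s' : ℕ → unitInterval} {y y' : ℕ → ℕ → ℝ}

open Classical in
theorem stepEst_eq (κ : ℕ → Y) (s : ℕ → unitInterval) (y : ℕ → ℕ → ℝ) (t : ℕ) :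
    stepEst κ s y t = stepRegret (keyRegret κ s y (κ t) t) (activeAt κ t) (arm κ s y t)
      (y t (arm κ s y t)) := by
  have h : keyRegret κ s y (κ t) t =
      fun i => ∑ j : Fin t, if κ j = κ t then stepEst κ s y j i else 0 := by
    funext i
    rw [keyRegret, Finset.sum_range]
  rw [stepEst]
  simp only [arm, h]

theorem one_le_activeAt (κ : ℕ → Y) (t : ℕ) : 1 ≤ activeAt κ t := one_le_activeCount _

theorem activeAt_congr {t : ℕ} (hκ : ∀ j ≤ t, κ j = κ' j) : activeAt κ t = activeAt κ' t := by
  unfold activeAt keyCount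
  congr 2
  ext j
  simp only [Finset.mem_filter, Finset.mem_range]
  refine and_congr_right fun hj => ?_
  rw [hκ j hj.le, hκ t le_rfl]

theorem keyRegret_congr {t : ℕ} (hκ : ∀ j ≤ t, κ j = κ' j) (hs : ∀ j < t, s j = s' j)
    (hy : ∀ j < t, y j (arm κ s y j) = y' j (arm κ s y j)) :
    keyRegret κ s y (κ t) t = keyRegret κ' s' y' (κ' t) t := by
  induction t using Nat.strong_induction_on with
  | _ t ih =>
    unfold keyRegret
    funext i
    refine Finset.sum_congr rfl fun j hj => ?_
    have hj := Finset.mem_range.1 hj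
    rw [hκ j hj.le, hκ t le_rfl]
    have h1 := ih j hj (fun l hl => hκ l (hl.trans hj.le)) (fun l hl => hs l (hl.trans hj))
      (fun l hl => hy l (hl.trans hj))
    have h2 : activeAt κ j = activeAt κ' j := activeAt_congr fun l hl => hκ l (hl.trans hj.le)
    have h3 : arm κ s y j = arm κ' s' y' j := by unfold arm; rw [h1, h2, hs j hj]
    rw [stepEst_eq, stepEst_eq, h1, h2, hy j hj, h3]

theorem arm_congr {t : ℕ} (hκ : ∀ j ≤ t, κ j = κ' j) (hs : ∀ j ≤ t, s j = s' j)
    (hy : ∀ j < t, y j (arm κ s y j) = y' j (arm κ s y j)) :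
    arm κ s y t = arm κ' s' y' t := by
  unfold arm
  rw [keyRegret_congr hκ (fun j hj => hs j hj.le) hy, activeAt_congr hκ, hs t le_rfl]

/-- The potential bound: after `n` visits to a key, the squared positive parts of its accumulated
regrets sum up to at most `n ^ (3 / 2)`. -/
theorem sum_max_keyRegret_sq_le (h0 : ∀ t k, 0 ≤ y t k) (h1 : ∀ t k, y t k ≤ 1) (z : Y) (T : ℕ)
    {M : ℕ} (hM : ∀ j < T, activeAt κ j ≤ M) :
    ∑ i ∈ Finset.range M, max (keyRegret κ s y z T i) 0 ^ 2 ≤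
      keyCount κ z T * √(keyCount κ z T) := by
  classical
  induction T with
  | zero => simp [keyRegret, keyCount]
  | succ T ih =>
    have ih := ih fun j hj => hM j (hj.trans (Nat.lt_succ_self T))
    by_cases hz : κ T = z
    · have e1 : keyCount κ z (T + 1) = keyCount κ z T + 1 := by
        unfold keyCount
        rw [Finset.range_add_one, Finset.filter_insert, if_pos hz, Finset.card_insert_of_notMem]
        simp
      have e2 : ∀ i, keyRegret κ s y z (T + 1) i = keyRegret κ s y z T i + stepRegret
          (keyRegret κ s y z T) (activeAt κ T) (arm κ s y T) (y T (arm κ s y T)) i := fun i => by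
        rw [keyRegret, Finset.sum_range_succ, if_pos hz, stepEst_eq, hz]
        rfl
      simp only [e2]
      refine (sum_max_add_stepRegret_sq_le _ _ (h0 _ _) (h1 _ _)
        (hM T (Nat.lt_succ_self T))).trans ?_
      have h3 : (activeAt κ T : ℝ) ^ 5 ≤ √((keyCount κ z T : ℝ) + 1) := by
        have := activeCount_pow_five_le (keyCount κ (κ T) T)
        rw [activeAt, hz]
        rwa [hz] at this
      have h4 : √(keyCount κ z T : ℝ) ≤ √((keyCount κ z T : ℝ) + 1) :=
        Real.sqrt_le_sqrt (by linarith)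
      rw [e1]
      push_cast
      have h5 := mul_le_mul_of_nonneg_left h4 (Nat.cast_nonneg (α := ℝ) (keyCount κ z T))
      linarith
    · have e1 : keyCount κ z (T + 1) = keyCount κ z T := by
        unfold keyCount
        rw [Finset.range_add_one, Finset.filter_insert, if_neg hz]
      have e2 : keyRegret κ s y z (T + 1) = keyRegret κ s y z T := by
        funext i
        rw [keyRegret, Finset.sum_range_succ, if_neg hz, add_zero]
        rfl
      rw [e1, e2]
      exact ih

/-- The accumulated estimated regret of a key is sublinear in its number of visits, uniformly over
the experts and the keys. -/
theorem keyRegret_le (h0 : ∀ t k, 0 ≤ y t k) (h1 : ∀ t k, y t k ≤ 1) (z : Y) (T i : ℕ) {ε : ℝ}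
    (hε : 0 < ε) : keyRegret κ s y z T i ≤ ε * keyCount κ z T + (ε ^ 3)⁻¹ := by
  -- in the potential bound `M` may be arbitrarily large, so expert `i` need not be in play yet
  obtain ⟨M, hM1, hM2⟩ : ∃ M, (∀ j < T, activeAt κ j ≤ M) ∧ i < M := by
    refine ⟨max ((Finset.range T).sup (activeAt κ)) (i + 1), fun j hj => ?_, by simp⟩
    exact le_max_of_le_left (Finset.le_sup (f := activeAt κ) (Finset.mem_range.2 hj))
  have h2 := sum_max_keyRegret_sq_le (κ := κ) (s := s) h0 h1 z T hM1
  have h3 : max (keyRegret κ s y z T i) 0 ^ 2 ≤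
      ∑ i ∈ Finset.range M, max (keyRegret κ s y z T i) 0 ^ 2 :=
    Finset.single_le_sum (f := fun i => max (keyRegret κ s y z T i) 0 ^ 2)
      (fun j _ => sq_nonneg _) (Finset.mem_range.2 hM2)
  set n : ℝ := (keyCount κ z T : ℝ) with hn
  have hn0 : 0 ≤ n := Nat.cast_nonneg _
  set G := max (keyRegret κ s y z T i) 0 with hG
  refine (le_max_left (keyRegret κ s y z T i) 0).trans ?_
  rw [← hG]
  have hG2 : G ^ 2 ≤ n * √n := h3.trans h2
  by_contra! hlt
  have hinv : 0 < (ε ^ 3)⁻¹ := by positivity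
  set r := √n with hr
  have hr0 : 0 ≤ r := Real.sqrt_nonneg _
  have hrn : n = r ^ 2 := (Real.sq_sqrt hn0).symm
  rw [hrn] at hG2 hlt
  have h5 : (ε * r ^ 2 + (ε ^ 3)⁻¹) ^ 2 < G ^ 2 :=
    pow_lt_pow_left₀ hlt (by positivity) (by norm_num)
  -- `r ^ 3 ≤ (ε * r ^ 2) ^ 2` if `1 ≤ ε ^ 2 * r`, and `r ^ 3 ≤ ((ε ^ 3)⁻¹) ^ 2` otherwise
  rcases le_total 1 (ε ^ 2 * r) with h | h
  · have : r ^ 3 * 1 ≤ r ^ 3 * (ε ^ 2 * r) := mul_le_mul_of_nonneg_left h (by positivity)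
    have h6 : (ε * r ^ 2) ^ 2 ≤ (ε * r ^ 2 + (ε ^ 3)⁻¹) ^ 2 :=
      pow_le_pow_left₀ (by positivity) (by linarith) 2
    nlinarith
  · have h6 : ((ε ^ 3)⁻¹) ^ 2 ≤ (ε * r ^ 2 + (ε ^ 3)⁻¹) ^ 2 :=
      pow_le_pow_left₀ (by positivity) (by nlinarith [mul_nonneg hε.le (sq_nonneg r)]) 2
    have h7 : r ≤ (ε ^ 2)⁻¹ := by
      rw [← one_div, le_div_iff₀ (by positivity)]; linarith
    have h8 : r ^ 3 ≤ ((ε ^ 2)⁻¹) ^ 3 := pow_le_pow_left₀ hr0 h7 3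
    have h9 : ((ε ^ 2)⁻¹) ^ 3 = ((ε ^ 3)⁻¹) ^ 2 := by
      rw [inv_pow, inv_pow, ← pow_mul, ← pow_mul]
    nlinarith

open Classical in
/-- At most `m` steps per key come before the key has been met `m` times. -/
theorem card_keyCount_lt_le (κ : ℕ → Y) (m T : ℕ) :
    ((Finset.range T).filter fun t => keyCount κ (κ t) t < m).card ≤
      m * ((Finset.range T).image κ).card := by
  refine (Finset.card_le_mul_card_image_of_maps_to (t := (Finset.range T).image κ) (f := κ)
    (fun t ht => Finset.mem_image_of_mem _ (Finset.mem_filter.1 ht).1) m fun z _ => ?_)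
  rw [← Finset.card_range m]
  refine Finset.card_le_card_of_injOn (fun t => keyCount κ z t) ?_ ?_
  · intro t ht
    simp only [Finset.coe_filter, Finset.mem_filter, Finset.mem_range, Set.mem_ofPred_eq] at ht
    rw [ht.2] at ht
    simpa using ht.1.2
  · have key : ∀ a b : ℕ, κ a = z → a < b → keyCount κ z a < keyCount κ z b := by
      intro a b ha hab
      refine Finset.card_lt_card ?_
      rw [Finset.ssubset_iff_of_subset]
      · exact ⟨a, by simp [ha, hab], by simp⟩
      · intro j hj
        simp only [Finset.mem_filter, Finset.mem_range] at hj ⊢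
        exact ⟨hj.1.trans hab, hj.2⟩
    intro a ha b hb hab
    simp only [Finset.coe_filter, Finset.mem_filter, Finset.mem_range, Set.mem_ofPred_eq] at ha hb
    by_contra hne
    rcases lt_or_gt_of_ne hne with h | h
    · exact absurd hab (key a b ha.2 h).ne
    · exact absurd hab (key b a hb.2 h).ne'

theorem activeAt_le (κ : ℕ → Y) (t : ℕ) : activeAt κ t ≤ activeCount t := by
  classical
  refine activeCount_mono ?_
  exact (Finset.card_filter_le _ _).trans (by simp)

end Recursion

/-! ### The regret of regret matching -/

section Regret

variable {Y : Type*} (κ : ℕ → Y) (ρ : ℕ → (ℕ → unitInterval) → ℕ → ℝ) (c : Y → ℕ)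

open Classical in
/-- The centred part of the regret of step `t`: the error of the regret estimate for the comparator
plus the deviation of the received reward from its mean. -/
noncomputable def stepNoise (t : ℕ) (s : ℕ → unitInterval) : ℝ :=
  (if c (κ t) < activeAt κ t then
    ρ t s (c (κ t)) - ∑ j ∈ Finset.range (activeAt κ t),
      matchProb (keyRegret κ s (fun t => ρ t s) (κ t) t) (activeAt κ t) j * ρ t s j
      - stepEst κ s (fun t => ρ t s) t (c (κ t)) else 0)
  + (∑ j ∈ Finset.range (activeAt κ t),
      playProb (keyRegret κ s (fun t => ρ t s) (κ t) t) (activeAt κ t) j * ρ t s j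
      - ρ t s (arm κ s (fun t => ρ t s) t))

variable {κ ρ c}

theorem sum_matchProb_mul_mem {R : ℕ → ℝ} {N : ℕ} (hN : 1 ≤ N) {y : ℕ → ℝ} (h0 : ∀ k, 0 ≤ y k)
    (h1 : ∀ k, y k ≤ 1) : 0 ≤ ∑ j ∈ Finset.range N, matchProb R N j * y j ∧
      ∑ j ∈ Finset.range N, matchProb R N j * y j ≤ 1 := by
  refine ⟨Finset.sum_nonneg fun j _ => mul_nonneg (matchProb_nonneg R N j) (h0 j), ?_⟩
  rw [← sum_matchProb R hN]
  exact Finset.sum_le_sum fun j _ => mul_le_of_le_one_right (matchProb_nonneg R N j) (h1 j)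

theorem sum_playProb_mul_mem {R : ℕ → ℝ} {N : ℕ} (hN : 1 ≤ N) {y : ℕ → ℝ} (h0 : ∀ k, 0 ≤ y k)
    (h1 : ∀ k, y k ≤ 1) : 0 ≤ ∑ j ∈ Finset.range N, playProb R N j * y j ∧
      ∑ j ∈ Finset.range N, playProb R N j * y j ≤ 1 := by
  refine ⟨Finset.sum_nonneg fun j _ => mul_nonneg (playProb_nonneg R N j) (h0 j), ?_⟩
  rw [← sum_playProb R hN]
  exact Finset.sum_le_sum fun j _ => mul_le_of_le_one_right (playProb_nonneg R N j) (h1 j)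

/-- Exploration costs at most its rate. -/
theorem sum_matchProb_sub_sum_playProb_le {R : ℕ → ℝ} {N : ℕ} (hN : 1 ≤ N) {y : ℕ → ℝ}
    (h0 : ∀ k, 0 ≤ y k) (h1 : ∀ k, y k ≤ 1) :
    ∑ j ∈ Finset.range N, matchProb R N j * y j ≤
      ∑ j ∈ Finset.range N, playProb R N j * y j + 1 / N := by
  rw [sum_playProb_mul]
  have h2 : 0 ≤ ∑ i ∈ Finset.range N, 1 / (N : ℝ) * y i :=
    Finset.sum_nonneg fun j _ => mul_nonneg (by positivity) (h0 j)
  have h3 : 0 ≤ 1 / (N : ℝ) := by positivity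
  have h4 := mul_nonneg h3 h2
  have h5 := mul_le_mul_of_nonneg_left (sum_matchProb_mul_mem (R := R) hN h0 h1).2 h3
  linarith

theorem abs_stepNoise_le (h0 : ∀ t s k, 0 ≤ ρ t s k) (h1 : ∀ t s k, ρ t s k ≤ 1) (t : ℕ)
    (s : ℕ → unitInterval) : |stepNoise κ ρ c t s| ≤ 3 * (activeCount t : ℝ) ^ 2 := by
  have hN : (1 : ℝ) ≤ activeAt κ t := by exact_mod_cast one_le_activeAt κ t
  have hN' : (activeAt κ t : ℝ) ≤ activeCount t := by exact_mod_cast activeAt_le κ t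
  have hsq : (activeAt κ t : ℝ) ^ 2 ≤ (activeCount t : ℝ) ^ 2 :=
    pow_le_pow_left₀ (by linarith) hN' 2
  have hone : (1 : ℝ) ≤ (activeAt κ t : ℝ) ^ 2 := one_le_pow₀ hN
  have hp := sum_playProb_mul_mem (R := keyRegret κ s (fun t => ρ t s) (κ t) t)
    (one_le_activeAt κ t) (h0 t s) (h1 t s)
  have hq := sum_matchProb_mul_mem (R := keyRegret κ s (fun t => ρ t s) (κ t) t)
    (one_le_activeAt κ t) (h0 t s) (h1 t s)
  have ha0 := h0 t s (arm κ s (fun t => ρ t s) t)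
  have ha1 := h1 t s (arm κ s (fun t => ρ t s) t)
  have hc0 := h0 t s (c (κ t))
  have hc1 := h1 t s (c (κ t))
  have hs := abs_le.1 (abs_stepRegret_le (N := activeAt κ t)
    (keyRegret κ s (fun t => ρ t s) (κ t) t) (arm κ s (fun t => ρ t s) t) ha0 ha1 (c (κ t)))
  unfold stepNoise
  rw [stepEst_eq]
  rw [abs_le]
  split_ifs <;> constructor <;> linarith [hp.1, hp.2, hq.1, hq.2, hs.1, hs.2]

/-- The regret of a step, in terms of the estimated regret, the centred noise and the cost of
exploration. -/
theorem sub_le_stepEst_add_stepNoise (h0 : ∀ t s k, 0 ≤ ρ t s k) (h1 : ∀ t s k, ρ t s k ≤ 1) (t : ℕ)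
    (s : ℕ → unitInterval) :
    ρ t s (c (κ t)) - ρ t s (arm κ s (fun t => ρ t s) t) ≤
      stepEst κ s (fun t => ρ t s) t (c (κ t)) + stepNoise κ ρ c t s +
        (1 / activeAt κ t + if c (κ t) < activeAt κ t then 0 else 1) := by
  have hp := sum_playProb_mul_mem (R := keyRegret κ s (fun t => ρ t s) (κ t) t)
    (one_le_activeAt κ t) (h0 t s) (h1 t s)
  have hq := sum_matchProb_sub_sum_playProb_le (R := keyRegret κ s (fun t => ρ t s) (κ t) t)
    (one_le_activeAt κ t) (h0 t s) (h1 t s)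
  have hc1 := h1 t s (c (κ t))
  have hN : 0 ≤ 1 / (activeAt κ t : ℝ) := by positivity
  unfold stepNoise
  split_ifs with h
  · linarith
  · rw [stepEst_eq, stepRegret, if_neg h]
    linarith [hp.1]

open Classical in
/-- The cumulative regret against the comparator `c`, up to the noise: the loss is small except
for a bounded number of steps per key, in which the expert of the comparator may not be in play
yet. -/
theorem sum_sub_le (h0 : ∀ t s k, 0 ≤ ρ t s k) (h1 : ∀ t s k, ρ t s k ≤ 1) {ε : ℝ} (hε : 0 < ε)
    {m : ℕ} (hm : ∀ n z, m ≤ n → c z < activeCount n ∧ 1 / (activeCount n : ℝ) ≤ ε)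
    (T : ℕ) (s : ℕ → unitInterval) :
    ∑ t ∈ Finset.range T, (ρ t s (c (κ t)) - ρ t s (arm κ s (fun t => ρ t s) t)) ≤
      ∑ t ∈ Finset.range T, stepNoise κ ρ c t s + 2 * ε * T +
        ((ε ^ 3)⁻¹ + 2 * m) * ((Finset.range T).image κ).card := by
  have hest : ∑ t ∈ Finset.range T, stepEst κ s (fun t => ρ t s) t (c (κ t)) ≤
      ε * T + (ε ^ 3)⁻¹ * ((Finset.range T).image κ).card := by
    rw [← Finset.sum_fiberwise_of_maps_to (g := κ) (t := (Finset.range T).image κ)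
      fun t ht => Finset.mem_image_of_mem _ ht]
    have h2 : ∀ z ∈ (Finset.range T).image κ,
        ∑ t ∈ Finset.range T with κ t = z, stepEst κ s (fun t => ρ t s) t (c (κ t)) ≤
          ε * keyCount κ z T + (ε ^ 3)⁻¹ := fun z _ => by
      refine le_trans (le_of_eq ?_)
        (keyRegret_le (s := s) (fun t => h0 t s) (fun t => h1 t s) z T (c z) hε)
      rw [keyRegret, Finset.sum_filter]
      refine Finset.sum_congr rfl fun t _ => ?_
      split_ifs with h
      · rw [h]
      · rfl
    refine (Finset.sum_le_sum h2).trans ?_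
    rw [Finset.sum_add_distrib, ← Finset.mul_sum, Finset.sum_const, nsmul_eq_mul,
      mul_comm _ (ε ^ 3)⁻¹]
    have h3 : ∑ z ∈ (Finset.range T).image κ, (keyCount κ z T : ℝ) = T := by
      have := Finset.card_eq_sum_card_fiberwise (f := κ) (s := Finset.range T)
        (t := (Finset.range T).image κ) fun t ht => Finset.mem_image_of_mem _ ht
      rw [Finset.card_range] at this
      conv_rhs => rw [this]
      push_cast
      rfl
    rw [h3]
  have hexp : ∑ t ∈ Finset.range T, (1 / (activeAt κ t : ℝ) +
      if c (κ t) < activeAt κ t then 0 else 1) ≤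
        ε * T + 2 * m * ((Finset.range T).image κ).card := by
    have h2 : ∀ t ∈ Finset.range T, (1 / (activeAt κ t : ℝ) +
        if c (κ t) < activeAt κ t then 0 else 1) ≤
        ε + if keyCount κ (κ t) t < m then 2 else 0 := by
      intro t _
      have hN : (1 : ℝ) ≤ activeAt κ t := by exact_mod_cast one_le_activeAt κ t
      have h3 : 1 / (activeAt κ t : ℝ) ≤ 1 := by rw [div_le_one (by linarith)]; exact hN
      by_cases h : keyCount κ (κ t) t < m
      · rw [if_pos h]
        split_ifs <;> linarith
      · rw [if_neg h]
        obtain ⟨h4, h5⟩ := hm _ (κ t) (not_lt.1 h)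
        rw [if_pos (show c (κ t) < activeAt κ t from h4)]
        rw [add_zero, add_zero]
        exact h5
    refine (Finset.sum_le_sum h2).trans ?_
    rw [Finset.sum_add_distrib, Finset.sum_const, Finset.card_range, nsmul_eq_mul,
      ← Finset.sum_filter, Finset.sum_const, nsmul_eq_mul]
    have h4 : (((Finset.range T).filter fun t => keyCount κ (κ t) t < m).card : ℝ) ≤
        m * ((Finset.range T).image κ).card := by exact_mod_cast card_keyCount_lt_le κ m T
    linarith
  calc _ ≤ ∑ t ∈ Finset.range T, (stepEst κ s (fun t => ρ t s) t (c (κ t)) + stepNoise κ ρ c t s +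
        (1 / activeAt κ t + if c (κ t) < activeAt κ t then 0 else 1)) :=
        Finset.sum_le_sum fun t _ => sub_le_stepEst_add_stepNoise h0 h1 t s
    _ ≤ _ := by
        rw [Finset.sum_add_distrib, Finset.sum_add_distrib]
        linarith

/-- After some number of visits to a key, the same for all keys, the expert of the comparator is in
play and exploration is rare. -/
theorem exists_activeCount_bound {I : ℕ} (hc : ∀ z, c z < I) {ε : ℝ} (hε : 0 < ε) :
    ∃ m : ℕ, ∀ n z, m ≤ n → c z < activeCount n ∧ 1 / (activeCount n : ℝ) ≤ ε := by
  obtain ⟨K, hK⟩ := exists_nat_gt (1 / ε)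
  refine ⟨(max I K) ^ 10, fun n z hn => ?_⟩
  have h1 : max I K ≤ activeCount n := le_activeCount (by omega)
  refine ⟨(hc z).trans_le ((le_max_left _ _).trans h1), ?_⟩
  have h2 : (K : ℝ) ≤ activeCount n := by exact_mod_cast (le_max_right _ _).trans h1
  rw [one_div]
  refine inv_le_of_inv_le₀ hε ?_
  rw [← one_div]
  linarith

end Regret

section Measurability

variable {Y : Type*} {α : Type*} [MeasurableSpace α] {κ : α → ℕ → Y} {s : α → ℕ → unitInterval}
  {y : α → ℕ → ℕ → ℝ}

theorem measurable_activeAt (hκ : ∀ i j, MeasurableSet {a | κ a i = κ a j}) (t : ℕ) :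
    Measurable fun a => activeAt (κ a) t := by
  classical
  unfold activeAt keyCount
  refine (measurable_of_countable activeCount).comp ?_
  simp only [Finset.card_filter]
  exact Finset.measurable_sum _ fun j _ =>
    Measurable.ite (hκ j t) measurable_const measurable_const

theorem measurable_apply_nat {β : Type*} [MeasurableSpace β] {F : α → ℕ → β}
    (hF : ∀ n, Measurable fun a => F a n) {N : α → ℕ} (hN : Measurable N) :
    Measurable fun a => F a (N a) :=
  (measurable_from_prod_countable_left (f := fun p : α × ℕ => F p.1 p.2) hF).comp
    (measurable_id.prodMk hN)

theorem measurable_arm_of_keyRegret (hκ : ∀ i j, MeasurableSet {a | κ a i = κ a j})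
    (hs : ∀ t, Measurable fun a => s a t) (t : ℕ)
    (hR : ∀ i, Measurable fun a => keyRegret (κ a) (s a) (y a) (κ a t) t i) :
    Measurable fun a => arm (κ a) (s a) (y a) t := by
  have hp : Measurable fun a =>
      playProb (keyRegret (κ a) (s a) (y a) (κ a t) t) (activeAt (κ a) t) :=
    measurable_pi_lambda _ fun i => measurable_apply_nat
      (F := fun a n => playProb (keyRegret (κ a) (s a) (y a) (κ a t) t) n i)
      (fun n => measurable_playProb hR n i) (measurable_activeAt hκ t)
  unfold arm
  exact measurable_sampleIndex_comp hp (hs t)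

theorem measurable_stepEst_of_keyRegret (hκ : ∀ i j, MeasurableSet {a | κ a i = κ a j})
    (hs : ∀ t, Measurable fun a => s a t) (hy : ∀ t k, Measurable fun a => y a t k) (t : ℕ)
    (hR : ∀ i, Measurable fun a => keyRegret (κ a) (s a) (y a) (κ a t) t i) (i : ℕ) :
    Measurable fun a => stepEst (κ a) (s a) (y a) t i := by
  have h2 := measurable_arm_of_keyRegret hκ hs t hR
  have h3 : Measurable fun a => y a t (arm (κ a) (s a) (y a) t) :=
    measurable_apply_nat (F := fun a k => y a t k) (hy t) h2
  simp only [stepEst_eq]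
  exact measurable_apply_nat
    (F := fun a n => stepRegret (keyRegret (κ a) (s a) (y a) (κ a t) t) n (arm (κ a) (s a) (y a) t)
      (y a t (arm (κ a) (s a) (y a) t)) i)
    (fun n => measurable_stepRegret hR n h2 h3 i) (measurable_activeAt hκ t)

theorem measurable_stepEst (hκ : ∀ i j, MeasurableSet {a | κ a i = κ a j})
    (hs : ∀ t, Measurable fun a => s a t) (hy : ∀ t k, Measurable fun a => y a t k) (t : ℕ) :
    (∀ i, Measurable fun a => stepEst (κ a) (s a) (y a) t i) ∧
      (∀ i, Measurable fun a => keyRegret (κ a) (s a) (y a) (κ a t) t i) ∧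
      Measurable fun a => arm (κ a) (s a) (y a) t := by
  classical
  induction t using Nat.strong_induction_on with
  | _ t ih =>
    have h1 : ∀ i, Measurable fun a => keyRegret (κ a) (s a) (y a) (κ a t) t i := fun i =>
      Finset.measurable_sum _ fun j hj => Measurable.ite (hκ j t)
        ((ih j (Finset.mem_range.1 hj)).1 i) measurable_const
    exact ⟨measurable_stepEst_of_keyRegret hκ hs hy t h1, h1,
      measurable_arm_of_keyRegret hκ hs t h1⟩

end Measurability

section AlmostSure

variable {Y : Type*} {κ : ℕ → Y} {ρ : ℕ → (ℕ → unitInterval) → ℕ → ℝ} {c : Y → ℕ}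

theorem measurable_stepNoise (hρ : ∀ t k, Measurable fun s => ρ t s k) (t : ℕ) :
    Measurable (stepNoise κ ρ c t) := by
  obtain ⟨h1, h2, h3⟩ := measurable_stepEst (κ := fun _ : ℕ → unitInterval => κ) (s := fun s => s)
    (y := fun s t => ρ t s) (fun i j => MeasurableSet.const _) (fun t => measurable_pi_apply t) hρ t
  unfold stepNoise
  refine Measurable.add ?_ ?_
  · split_ifs
    · refine ((hρ t _).sub (Finset.measurable_sum _ fun j _ => ?_)).sub (h1 _)
      exact (measurable_matchProb h2 _ j).mul (hρ t j)
    · exact measurable_const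
  · refine (Finset.measurable_sum _ fun j _ => ?_).sub (measurable_apply_nat (hρ t) h3)
    exact (measurable_playProb h2 _ j).mul (hρ t j)

/-- The noise of step `t` averages out over the `t`-th coordinate of the seed. -/
theorem integral_stepNoise_update
    (hadapt : ∀ t s s', (∀ i < t, s i = s' i) → ρ t s = ρ t s') (t : ℕ) (s : ℕ → unitInterval) :
    ∫ z, stepNoise κ ρ c t (Function.update s t z) = 0 := by
  have hup : ∀ z, ∀ i < t, Function.update s t z i = s i := fun z i hi => by
    rw [Function.update_of_ne (by omega)]
  have hρ : ∀ z, ∀ j ≤ t, ρ j (Function.update s t z) = ρ j s := fun z j hj =>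
    hadapt _ _ _ fun i hi => hup z i (by omega)
  have hR : ∀ z,
      keyRegret κ (Function.update s t z) (fun j => ρ j (Function.update s t z)) (κ t) t =
      keyRegret κ s (fun j => ρ j s) (κ t) t := fun z =>
    keyRegret_congr (fun _ _ => rfl) (hup z) fun j hj => by rw [hρ z j hj.le]
  set R := keyRegret κ s (fun j => ρ j s) (κ t) t with hRdef
  have harm : ∀ z, arm κ (Function.update s t z) (fun j => ρ j (Function.update s t z)) t =
      sampleIndex (playProb R (activeAt κ t)) z := fun z => by
    rw [arm, hR, Function.update_self]
  have hN := one_le_activeAt κ t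
  set N := activeAt κ t with hNdef
  have hfun : ∀ z, stepNoise κ ρ c t (Function.update s t z) =
      (fun k => (if c (κ t) < N then ρ t s (c (κ t)) -
        ∑ j ∈ Finset.range N, matchProb R N j * ρ t s j
        - stepRegret R N k (ρ t s k) (c (κ t)) else 0) +
        (∑ j ∈ Finset.range N, playProb R N j * ρ t s j - ρ t s k))
        (sampleIndex (playProb R N) z) := fun z => by
    simp only [stepNoise, stepEst_eq, hR, harm, hρ z t le_rfl, ← hNdef]
  simp only [hfun]
  rw [integral_sampleIndex_playProb R hN (fun k => (if c (κ t) < N then ρ t s (c (κ t)) -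
        ∑ j ∈ Finset.range N, matchProb R N j * ρ t s j
        - stepRegret R N k (ρ t s k) (c (κ t)) else 0) +
        (∑ j ∈ Finset.range N, playProb R N j * ρ t s j - ρ t s k))]
  have hp := sum_playProb R hN
  split_ifs with hc
  · have h3 := sum_playProb_mul_stepRegret R hc (ρ t s)
    simp only [mul_add, mul_sub, Finset.sum_add_distrib, Finset.sum_sub_distrib, ← Finset.sum_mul,
      hp, h3]
    ring
  · simp only [zero_add, mul_sub, Finset.sum_sub_distrib, ← Finset.sum_mul, hp]
    ring

theorem stepNoise_congr (hadapt : ∀ t s s', (∀ i < t, s i = s' i) → ρ t s = ρ t s') (t : ℕ)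
    (s s' : ℕ → unitInterval) (h : ∀ i ≤ t, s i = s' i) :
    stepNoise κ ρ c t s = stepNoise κ ρ c t s' := by
  have hρ : ∀ j ≤ t, ρ j s = ρ j s' := fun j hj => hadapt _ _ _ fun i hi => h i (by omega)
  have hR : keyRegret κ s (fun j => ρ j s) (κ t) t = keyRegret κ s' (fun j => ρ j s') (κ t) t :=
    keyRegret_congr (fun _ _ => rfl) (fun j hj => h j hj.le) fun j hj => by rw [hρ j hj.le]
  have harm : arm κ s (fun j => ρ j s) t = arm κ s' (fun j => ρ j s') t :=
    arm_congr (fun _ _ => rfl) h fun j hj => by rw [hρ j hj.le]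
  simp only [stepNoise, stepEst_eq, hR, harm, hρ t le_rfl]

/-- Along fourth powers the averaged noise vanishes almost surely. -/
theorem ae_tendsto_stepNoise (hρ : ∀ t k, Measurable fun s => ρ t s k)
    (h0 : ∀ t s k, 0 ≤ ρ t s k) (h1 : ∀ t s k, ρ t s k ≤ 1)
    (hadapt : ∀ t s s', (∀ i < t, s i = s' i) → ρ t s = ρ t s') :
    ∀ᵐ s ∂(Measure.infinitePi fun _ : ℕ => (volume : Measure unitInterval)),
      Tendsto (fun k : ℕ => (∑ t ∈ Finset.range (k ^ 4), stepNoise κ ρ c t s) / (k ^ 4 : ℕ)) atTop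
        (𝓝 0) := by
  have hm : ∀ T, Measurable fun s => ∑ t ∈ Finset.range T, stepNoise κ ρ c t s := fun T =>
    Finset.measurable_sum _ fun t _ => measurable_stepNoise hρ t
  -- the noise of step `t < k ^ 4` has variance at most `18 * k ^ 2`, so that the average over the
  -- first `k ^ 4` steps has variance at most `18 / k ^ 2`, which is summable
  refine ae_tendsto_zero_of_summable_integral_sq (b := fun k : ℕ => 18 * (1 / (k : ℝ) ^ 2))
    (fun k => (hm _).div_const _) (fun k => ?_)
    ((Real.summable_one_div_nat_pow.2 (by norm_num)).mul_left 18) fun k => ?_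
  · refine integrable_of_abs_le (((hm _).div_const _).pow_const 2)
      (C := (∑ t ∈ Finset.range (k ^ 4), 3 * (activeCount t : ℝ) ^ 2) ^ 2 / ((k ^ 4 : ℕ) : ℝ) ^ 2)
      fun s => ?_
    rw [abs_pow, abs_div, div_pow, Nat.abs_cast]
    gcongr
    exact (Finset.abs_sum_le_sum_abs _ _).trans
      (Finset.sum_le_sum fun t _ => abs_stepNoise_le h0 h1 t s)
  · rcases Nat.eq_zero_or_pos k with rfl | hk
    · simp
    have hk1 : (1 : ℝ) ≤ k := by exact_mod_cast hk
    simp only [div_pow]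
    rw [integral_div, div_le_iff₀ (by positivity)]
    refine (integral_sum_sq_le (volume : Measure unitInterval)
      (fun t => measurable_stepNoise (κ := κ) (c := c) hρ t)
      (c := fun t => 3 * (activeCount t : ℝ) ^ 2) (fun t s => abs_stepNoise_le h0 h1 t s)
      (stepNoise_congr hadapt) (integral_stepNoise_update hadapt) (k ^ 4)).trans ?_
    have h2 : ∀ t ∈ Finset.range (k ^ 4), (3 * (activeCount t : ℝ) ^ 2) ^ 2 ≤ 18 * (k : ℝ) ^ 2 := by
      intro t ht
      have h3 : (1 : ℝ) ≤ activeCount t := by exact_mod_cast one_le_activeCount t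
      have h4 : (activeCount t : ℝ) ^ 4 ≤ (activeCount t : ℝ) ^ 5 :=
        pow_le_pow_right₀ h3 (by norm_num)
      have h5 : √((t : ℝ) + 1) ≤ (k : ℝ) ^ 2 := by
        rw [Real.sqrt_le_left (by positivity), ← pow_mul]
        exact_mod_cast Finset.mem_range.1 ht
      have h6 := activeCount_pow_five_le t
      have h7 : (3 * (activeCount t : ℝ) ^ 2) ^ 2 = 9 * (activeCount t : ℝ) ^ 4 := by ring
      rw [h7]
      nlinarith [sq_nonneg (k : ℝ)]
    refine (Finset.sum_le_sum h2).trans (le_of_eq ?_)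
    rw [Finset.sum_const, Finset.card_range, nsmul_eq_mul]
    push_cast
    field_simp

/-- A sequence with increments at most `1` that is asymptotically at most `ε T` along the fourth
powers is so along all times. -/
theorem eventually_le_of_fourth_powers {g : ℕ → ℝ} (hg : ∀ T, g (T + 1) ≤ g T + 1)
    (h : ∀ ε > 0, ∀ᶠ k : ℕ in atTop, g (k ^ 4) ≤ ε * (k ^ 4 : ℕ)) {ε : ℝ} (hε : 0 < ε) :
    ∀ᶠ T : ℕ in atTop, g T ≤ ε * T := by
  have hinc : ∀ a b : ℕ, g (a + b) ≤ g a + b := by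
    intro a b
    induction b with
    | zero => simp
    | succ b ih => rw [← add_assoc]; push_cast; linarith [hg (a + b)]
  -- consecutive fourth powers differ by at most `15 * k ^ 3`, which is below `ε / 2 * k ^ 4` as
  -- soon as `30 / ε ≤ k`
  obtain ⟨K, hK⟩ := exists_nat_gt (30 / ε)
  have hk : Tendsto (fun T : ℕ => Nat.sqrt (Nat.sqrt T)) atTop atTop := by
    have : Tendsto Nat.sqrt atTop atTop :=
      tendsto_atTop_atTop.2 fun b => ⟨b * b, fun a ha => Nat.le_sqrt.2 ha⟩
    exact this.comp this
  filter_upwards [hk.eventually (h (ε / 2) (by positivity)), hk.eventually_ge_atTop (K + 1)]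
    with T h1 h2
  set k := Nat.sqrt (Nat.sqrt T) with hkdef
  have h3 : k ^ 4 ≤ T := by
    have h4 : k * k ≤ Nat.sqrt T := Nat.sqrt_le _
    have h5 : Nat.sqrt T * Nat.sqrt T ≤ T := Nat.sqrt_le _
    calc k ^ 4 = (k * k) * (k * k) := by ring
      _ ≤ _ := (Nat.mul_le_mul h4 h4).trans h5
  have h4 : T < (k + 1) ^ 4 := by
    have h4 : Nat.sqrt T < (k + 1) * (k + 1) := Nat.lt_succ_sqrt _
    have h5 : T < (Nat.sqrt T + 1) * (Nat.sqrt T + 1) := Nat.lt_succ_sqrt _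
    calc T < (Nat.sqrt T + 1) * (Nat.sqrt T + 1) := h5
      _ ≤ ((k + 1) * (k + 1)) * ((k + 1) * (k + 1)) := Nat.mul_le_mul h4 h4
      _ = _ := by ring
  have h5 := hinc (k ^ 4) (T - k ^ 4)
  rw [Nat.add_sub_cancel' h3, Nat.cast_sub h3] at h5
  have h6 : (T : ℝ) ≤ ((k : ℝ) + 1) ^ 4 := by exact_mod_cast h4.le
  have h7 : ((k ^ 4 : ℕ) : ℝ) ≤ T := by exact_mod_cast h3
  push_cast at h1 h5 h7
  have hk1 : (1 : ℝ) ≤ k := by exact_mod_cast (by omega : 1 ≤ k)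
  have hkK : 30 / ε ≤ k := hK.le.trans (by exact_mod_cast (by omega : K ≤ k))
  have h8 : 30 ≤ ε * k := by rw [div_le_iff₀ hε] at hkK; linarith
  have h9 : ((k : ℝ) + 1) ^ 4 - (k : ℝ) ^ 4 ≤ 15 * (k : ℝ) ^ 3 := by nlinarith [sq_nonneg (k : ℝ)]
  have h10 : 15 * (k : ℝ) ^ 3 ≤ ε / 2 * (k : ℝ) ^ 4 := by
    have := mul_le_mul_of_nonneg_right h8 (by positivity : 0 ≤ (k : ℝ) ^ 3)
    nlinarith
  nlinarith

open Classical in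
/-- Regret matching competes with every comparator that depends on the key only, as soon as the
number of distinct keys is sublinear. -/
theorem ae_eventually_regret_le (hρ : ∀ t k, Measurable fun s => ρ t s k)
    (h0 : ∀ t s k, 0 ≤ ρ t s k) (h1 : ∀ t s k, ρ t s k ≤ 1)
    (hadapt : ∀ t s s', (∀ i < t, s i = s' i) → ρ t s = ρ t s') {I : ℕ} (hc : ∀ z, c z < I)
    (hD : ∀ ε > 0, ∀ᶠ T : ℕ in atTop, (((Finset.range T).image κ).card : ℝ) ≤ ε * T) :
    ∀ᵐ s ∂(Measure.infinitePi fun _ : ℕ => (volume : Measure unitInterval)), ∀ ε > 0,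
      ∀ᶠ T : ℕ in atTop, ∑ t ∈ Finset.range T,
        (ρ t s (c (κ t)) - ρ t s (arm κ s (fun t => ρ t s) t)) ≤ ε * T := by
  filter_upwards [ae_tendsto_stepNoise (κ := κ) (c := c) hρ h0 h1 hadapt] with s hs ε hε
  refine eventually_le_of_fourth_powers (fun T => ?_) (fun ε hε => ?_) hε
  · rw [Finset.sum_range_succ]
    linarith [h0 T s (arm κ s (fun t => ρ t s) T), h1 T s (c (κ T))]
  · obtain ⟨m, hm⟩ := exists_activeCount_bound hc (show 0 < ε / 6 by positivity)
    have hpow : Tendsto (fun k : ℕ => k ^ 4) atTop atTop := tendsto_pow_atTop (by norm_num)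
    set B : ℝ := ((ε / 6) ^ 3)⁻¹ + 2 * m with hB
    have hB0 : 0 < B := by positivity
    filter_upwards [hpow.eventually (hD (ε / 3 / B) (by positivity)),
      hs.eventually_lt_const (show (0 : ℝ) < ε / 3 by positivity), eventually_gt_atTop 0]
      with k hk1 hk2 hk3
    have hk4 : (0 : ℝ) < ((k ^ 4 : ℕ) : ℝ) := by positivity
    rw [div_lt_iff₀ hk4] at hk2
    have h2 := sum_sub_le (κ := κ) h0 h1 (by positivity) hm (k ^ 4) s
    have h3 := mul_le_mul_of_nonneg_left hk1 hB0.le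
    rw [div_mul_eq_mul_div, mul_div_cancel₀ _ hB0.ne'] at h3
    linarith

end AlmostSure

-- the recursion is not to be unfolded from here on; its properties are in the lemmas above
attribute [irreducible] arm

/-! ### The learning rule -/

section Rule

variable {X : Type u} {A : Type v} {Y : Type*}

/-- The action of `regretMatchingRule` at step `t`. The sequences of past contexts and rewards are
extended arbitrarily to all times, since `arm` only looks at the past. -/
noncomputable def ruleAct (E : ℕ → X → A) (K : X → Y) (t : ℕ) (s : ℕ → unitInterval)
    (xs : Fin t → X) (rs : Fin t → Reward) (x : X) : A :=
  E (arm (fun i => K (if h : i < t then xs ⟨i, h⟩ else x)) s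
    (fun i _ => if h : i < t then (rs ⟨i, h⟩ : ℝ) else 0) t) x

/-- Hypothetical rewards `y` of the experts matter only where they were received. -/
theorem ruleAct_eq {E : ℕ → X → A} {K : X → Y} (s : ℕ → unitInterval) (x : ℕ → X) (r : ℕ → Reward)
    (t : ℕ) {y : ℕ → ℕ → ℝ} (hy : ∀ j < t, y j (arm (fun i => K (x i)) s y j) = r j) :
    ruleAct E K t s (fun i : Fin t => x i) (fun i : Fin t => r i) (x t) =
      E (arm (fun i => K (x i)) s y t) (x t) := by
  unfold ruleAct
  congr 1
  refine (arm_congr (fun j hj => ?_) (fun j _ => rfl) fun j hj => ?_).symm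
  · rcases hj.lt_or_eq with h | h
    · simp [h]
    · simp [h]
  · simp [hy j hj, hj]

theorem ruleAct_congr {E : ℕ → X → A} {K : X → Y} {t : ℕ} {s s' : ℕ → unitInterval}
    (h : ∀ i ≤ t, s i = s' i) (xs : Fin t → X) (rs : Fin t → Reward) (x : X) :
    ruleAct E K t s xs rs x = ruleAct E K t s' xs rs x := by
  unfold ruleAct
  congr 1
  exact arm_congr (fun j _ => rfl) h fun j _ => rfl

variable [MeasurableSpace X] [MeasurableSpace A] {P : RewardMechanism X A}

theorem measurable_ruleAct {E : ℕ → X → A} (hE : ∀ i, Measurable (E i)) {K : X → Y}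
    (hK : MeasurableSet {p : X × X | K p.1 = K p.2}) (t : ℕ) :
    Measurable fun p : (ℕ → unitInterval) × (Fin t → X) × (Fin t → Reward) × X =>
      ruleAct E K t p.1 p.2.1 p.2.2.1 p.2.2.2 := by
  have hx : ∀ i : ℕ, Measurable fun p : (ℕ → unitInterval) × (Fin t → X) × (Fin t → Reward) × X =>
      if h : i < t then p.2.1 ⟨i, h⟩ else p.2.2.2 := by
    intro i
    split_ifs <;> fun_prop
  have harm := (measurable_stepEst
    (κ := fun p : (ℕ → unitInterval) × (Fin t → X) × (Fin t → Reward) × X =>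
      fun i => K (if h : i < t then p.2.1 ⟨i, h⟩ else p.2.2.2))
    (s := fun p => p.1) (y := fun p i _ => if h : i < t then (p.2.2.1 ⟨i, h⟩ : ℝ) else 0)
    (fun i j => ((hx i).prodMk (hx j)) hK) (fun i => by fun_prop)
    (fun i _ => by split_ifs <;> fun_prop) t).2.2
  have hx' : Measurable fun p : (ℕ → unitInterval) × (Fin t → X) × (Fin t → Reward) × X =>
    p.2.2.2 := by fun_prop
  unfold ruleAct
  exact measurable_apply_nat
    (F := fun (p : (ℕ → unitInterval) × (Fin t → X) × (Fin t → Reward) × X) i => E i p.2.2.2)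
    (fun i => (hE i).comp hx') harm

/-- The learning rule that follows the experts `E` by regret matching, separately for each value of
the key `K` of the context. -/
noncomputable def regretMatchingRule (E : ℕ → X → A) (hE : ∀ i, Measurable (E i)) (K : X → Y)
    (hK : MeasurableSet {p : X × X | K p.1 = K p.2}) : LearningRule X A where
  Seed := ℕ → unitInterval
  seedLaw := Measure.infinitePi fun _ => volume
  act t p := ruleAct E K t p.1 p.2.1 p.2.2.1 p.2.2.2
  measurable_act t := measurable_ruleAct hE hK t

variable {E : ℕ → X → A} {hE : ∀ i, Measurable (E i)} {K : X → Y}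
    {hK : MeasurableSet {p : X × X | K p.1 = K p.2}}

theorem regretMatchingRule_play_fst (S : RewardSampler P)
    (s : (regretMatchingRule E hE K hK).Seed) (x : ℕ → X) (u : ℕ → S.Noise) (t : ℕ) :
    (play (regretMatchingRule E hE K hK) S s x u t).1 = E (arm (fun i => K (x i)) s
      (fun t k =>
        (rewardOf (regretMatchingRule E hE K hK) S s x u t (E k (x t)) : ℝ)) t) (x t) := by
  induction t using Nat.strong_induction_on with
  | _ t ih =>
    rw [play_fst]
    refine ruleAct_eq s x (fun i => (play (regretMatchingRule E hE K hK) S s x u i).2) t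
      fun j hj => ?_
    rw [play_snd, ih j hj]

/-- What happens up to time `t` depends on the seeds up to time `t` only. -/
theorem regretMatchingRule_play_congr (S : RewardSampler P)
    (s s' : (regretMatchingRule E hE K hK).Seed) (x : ℕ → X) (u : ℕ → S.Noise) (t : ℕ)
    (h : ∀ i ≤ t, s i = s' i) :
    play (regretMatchingRule E hE K hK) S s x u t =
      play (regretMatchingRule E hE K hK) S s' x u t := by
  induction t using Nat.strong_induction_on with
  | _ t ih =>
    have ih' : ∀ j : Fin t, play (regretMatchingRule E hE K hK) S s x u j =
        play (regretMatchingRule E hE K hK) S s' x u j := fun j =>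
      ih j j.2 fun i hi => h i (hi.trans j.2.le)
    have h1 : (play (regretMatchingRule E hE K hK) S s x u t).1 =
        (play (regretMatchingRule E hE K hK) S s' x u t).1 := by
      rw [play_fst, play_fst]
      simp only [ih']
      exact ruleAct_congr h _ _ _
    refine Prod.ext h1 ?_
    rw [play_snd, play_snd, h1, rewardOf, rewardOf]
    simp only [ih']

open Classical in
/-- The rule competes, under every reward mechanism, with every comparator that chooses its expert
through the key, along every sequence of contexts with a sublinear number of distinct keys. -/
theorem regretMatchingRule_regret (S : RewardSampler P) (x : ℕ → X) (u : ℕ → S.Noise) {c : Y → ℕ}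
    {I : ℕ} (hc : ∀ z, c z < I) (hD : ∀ ε > 0, ∀ᶠ T : ℕ in atTop,
      (((Finset.range T).image fun t => K (x t)).card : ℝ) ≤ ε * T) :
    ∀ᵐ s ∂(regretMatchingRule E hE K hK).seedLaw, ∀ ε > 0, ∀ᶠ T : ℕ in atTop,
      ∑ t ∈ Finset.range T,
        ((rewardOf (regretMatchingRule E hE K hK) S s x u t (E (c (K (x t))) (x t)) : ℝ) -
          rewardOf (regretMatchingRule E hE K hK) S s x u t
            (play (regretMatchingRule E hE K hK) S s x u t).1) ≤ ε * T := by
  have h := ae_eventually_regret_le (κ := fun t => K (x t)) (c := c)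
    (ρ := fun t s k => (rewardOf (regretMatchingRule E hE K hK) S s x u t (E k (x t)) : ℝ))
    (fun t k => ((measurable_rewardOf (regretMatchingRule E hE K hK) S t
      (measurable_const (a := E k (x t)))).comp
        (measurable_const.prodMk (measurable_id.prodMk measurable_const)) :
        Measurable fun s =>
          rewardOf (regretMatchingRule E hE K hK) S s x u t (E k (x t))).subtype_val)
    (fun t s k => (rewardOf (regretMatchingRule E hE K hK) S s x u t (E k (x t))).2.1)
    (fun t s k => (rewardOf (regretMatchingRule E hE K hK) S s x u t (E k (x t))).2.2)
    (fun t s s' hs => ?_) hc hD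
  · refine Eventually.mono h fun s hs => ?_
    simpa only [regretMatchingRule_play_fst] using hs
  · funext k
    have : ∀ i : Fin t, play (regretMatchingRule E hE K hK) S s x u i =
        play (regretMatchingRule E hE K hK) S s' x u i := fun i =>
      regretMatchingRule_play_congr S s s' x u i fun j hj => hs j (hj.trans_lt i.2)
    simp only [rewardOf, this]

end Rule

/-! ### Learning when few distinct contexts are met -/

section FewContexts

variable {X : Type u} {A : Type v} [MeasurableSpace X] [MeasurableSpace A]
  {P : RewardMechanism X A}

theorem limsup_averageRegret_le_zero {f : LearningRule X A} {S : RewardSampler P} {π : X → A}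
    {s : f.Seed} {x : ℕ → X} {u : ℕ → S.Noise}
    (h : ∀ ε > 0, ∀ᶠ T : ℕ in atTop, ∑ t ∈ Finset.range T,
      ((rewardOf f S s x u t (π (x t)) : ℝ) - (rewardOf f S s x u t (play f S s x u t).1 : ℝ))
        ≤ ε * T) :
    limsup (fun T : ℕ => averageRegret f S π s x u T) atTop ≤ 0 := by
  refine limsup_le_zero_of_forall_eventually_le (abs_averageRegret_le f S π s x u) fun ε hε => ?_
  filter_upwards [h ε hε, eventually_gt_atTop 0] with T hT hT0
  rw [averageRegret, div_le_iff₀ (by exact_mod_cast hT0)]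
  exact hT

open Classical in
/-- The sequence visits a sublinear number of distinct points. -/
def SublinearDistinct {X : Type*} (x : ℕ → X) : Prop :=
  ∀ ε > 0, ∀ᶠ T : ℕ in atTop, (((Finset.range T).image x).card : ℝ) ≤ ε * T

/-- For finitely many actions, one rule learns under all processes that visit a sublinear number of
distinct contexts: play a separate bandit for each context. -/
theorem exists_rule_sublinearDistinct [Finite A] [Nonempty A]
    (hdiag : MeasurableSet {p : X × X | p.1 = p.2}) :
    ∃ f : LearningRule X A, ∀ μ : ProbabilityMeasure (ℕ → X),
      (∀ᵐ x ∂(μ : Measure (ℕ → X)), SublinearDistinct x) → ∀ m, UniversallyConsistent m f μ := by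
  classical
  obtain ⟨n, ⟨e⟩⟩ := Finite.exists_equiv_fin A
  let E : ℕ → X → A := fun i _ => if h : i < n then e.symm ⟨i, h⟩ else Classical.arbitrary A
  refine ⟨regretMatchingRule E (fun i => measurable_const) id hdiag, fun μ hμ m P _ =>
    consistent_of_ae_seed fun S π _ => ?_⟩
  filter_upwards [hμ] with x hx u
  have h := regretMatchingRule_regret (E := E) (hE := fun i => measurable_const) (K := id)
    (hK := hdiag) S x u (c := fun z => (e (π z) : ℕ)) (I := n) (fun z => (e (π z)).2) hx
  refine Eventually.mono h fun s hs => limsup_averageRegret_le_zero ?_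
  have hE : ∀ z, E (e (π z)) z = π z := fun z => by simp [E]
  simpa only [id, hE] using hs

end FewContexts

/-! ### Processes in `classC1` -/

section ClassC1

variable {X : Type u}

/-- Upper asymptotic frequency of the visits to `B`. -/
noncomputable def upperFreq (B : Set X) (x : ℕ → X) : ENNReal :=
  limsup (fun T : ℕ => (∑ t ∈ Finset.range T, B.indicator (fun _ => (1 : ENNReal)) (x t)) / T) atTop

theorem upperFreq_mono {B C : Set X} (h : B ⊆ C) (x : ℕ → X) : upperFreq B x ≤ upperFreq C x := by
  refine limsup_le_limsup (Eventually.of_forall fun T => ?_)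
  refine ENNReal.div_le_div_right (Finset.sum_le_sum fun t _ => ?_) _
  exact Set.indicator_le_indicator_of_subset h (fun _ => zero_le) _

theorem upperFreq_le_one (B : Set X) (x : ℕ → X) : upperFreq B x ≤ 1 := by
  refine limsup_le_of_le (h := Eventually.of_forall fun T => ?_)
  refine ENNReal.div_le_of_le_mul ?_
  calc ∑ t ∈ Finset.range T, B.indicator (fun _ => (1 : ENNReal)) (x t)
      ≤ ∑ t ∈ Finset.range T, (1 : ENNReal) := Finset.sum_le_sum fun t _ =>
        Set.indicator_le_self' (fun _ _ => zero_le) _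
    _ = 1 * T := by simp

theorem upperFreq_empty (x : ℕ → X) : upperFreq ∅ x = 0 := by
  simp [upperFreq]

theorem upperFreq_union_le (B C : Set X) (x : ℕ → X) :
    upperFreq (B ∪ C) x ≤ upperFreq B x + upperFreq C x := by
  refine ENNReal.le_of_forall_pos_le_add fun ε hε _ => ?_
  have hε2 : (0 : ENNReal) < (ε : ENNReal) / 2 :=
    ENNReal.div_pos (by exact_mod_cast hε.ne') (by simp)
  have hlt : ∀ D : Set X, upperFreq D x < upperFreq D x + (ε : ENNReal) / 2 := fun D =>
    ENNReal.lt_add_right (ne_top_of_le_ne_top ENNReal.one_ne_top (upperFreq_le_one D x)) hε2.ne'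
  refine limsup_le_of_le (h := ?_)
  filter_upwards [eventually_lt_of_limsup_lt (hlt B), eventually_lt_of_limsup_lt (hlt C)]
    with T h1 h2
  calc _ ≤ (∑ t ∈ Finset.range T, B.indicator (fun _ => (1 : ENNReal)) (x t)) / T +
        (∑ t ∈ Finset.range T, C.indicator (fun _ => (1 : ENNReal)) (x t)) / T := by
        rw [ENNReal.div_add_div_same, ← Finset.sum_add_distrib]
        refine ENNReal.div_le_div_right (Finset.sum_le_sum fun t _ => ?_) _
        by_cases hB : x t ∈ B <;> by_cases hC : x t ∈ C <;> simp [hB, hC]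
    _ ≤ (upperFreq B x + (ε : ENNReal) / 2) + (upperFreq C x + (ε : ENNReal) / 2) :=
        add_le_add h1.le h2.le
    _ = _ := by
        rw [add_add_add_comm, ENNReal.add_halves]

/-- An upper frequency below `ε` bounds the number of visits to `B` eventually. -/
theorem eventually_card_le_of_upperFreq_lt {B : Set X} {x : ℕ → X} {ε : ℝ}
    (h : upperFreq B x < ENNReal.ofReal ε) :
    ∀ᶠ T : ℕ in atTop, ∑ t ∈ Finset.range T, B.indicator (fun _ => (1 : ℝ)) (x t) ≤ ε * T := by
  have hε : 0 < ε := ENNReal.ofReal_pos.1 (bot_le.trans_lt h)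
  filter_upwards [eventually_lt_of_limsup_lt h, eventually_gt_atTop 0] with T hT hT0
  have h1 : ∑ t ∈ Finset.range T, B.indicator (fun _ => (1 : ENNReal)) (x t) =
      ENNReal.ofReal (∑ t ∈ Finset.range T, B.indicator (fun _ => (1 : ℝ)) (x t)) := by
    rw [ENNReal.ofReal_sum_of_nonneg fun t _ => Set.indicator_nonneg (fun _ _ => zero_le_one) _]
    refine Finset.sum_congr rfl fun t _ => ?_
    by_cases hx : x t ∈ B <;> simp [hx]
  rw [h1, ENNReal.div_lt_iff (Or.inl (by simp; omega)) (Or.inl (by simp)),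
    ← ENNReal.ofReal_natCast, ← ENNReal.ofReal_mul hε.le] at hT
  exact (ENNReal.ofReal_le_ofReal_iff (by positivity)).1 hT.le

variable [MeasurableSpace X]

theorem measurable_upperFreq {B : Set X} (hB : MeasurableSet B) : Measurable (upperFreq B) :=
  Measurable.limsup fun _ => (Finset.measurable_sum _ fun t _ =>
    (measurable_const.indicator hB).comp (measurable_pi_apply t)).div_const _

variable (μ : ProbabilityMeasure (ℕ → X))

/-- Expected upper asymptotic frequency of the visits to `B`. -/
noncomputable def expFreq (B : Set X) : ENNReal := ∫⁻ x, upperFreq B x ∂(μ : Measure (ℕ → X))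

variable {μ}

theorem expFreq_mono {B C : Set X} (h : B ⊆ C) : expFreq μ B ≤ expFreq μ C :=
  lintegral_mono fun x => upperFreq_mono h x

theorem expFreq_union_le {B C : Set X} (hB : MeasurableSet B) :
    expFreq μ (B ∪ C) ≤ expFreq μ B + expFreq μ C := by
  unfold expFreq
  rw [← lintegral_add_left (measurable_upperFreq hB)]
  exact lintegral_mono fun x => upperFreq_union_le B C x

/-- Under a process in `classC1`, each measurable set agrees with some element of a countable
algebra generating the `σ`-algebra, up to a set that is visited rarely. -/
theorem exists_approx_of_mem_classC1 (hμ : μ ∈ classC1 X) (𝒜 : Set (Set X))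
    (h𝒜 : ‹MeasurableSpace X› = MeasurableSpace.generateFrom 𝒜) {B : Set X} (hB : MeasurableSet B)
    {ε : ENNReal} (hε : 0 < ε) :
    ∃ G ∈ generateSetAlgebra 𝒜, expFreq μ (symmDiff B G) ≤ ε := by
  have halg : ∀ G ∈ generateSetAlgebra 𝒜, MeasurableSet G := fun G hG => by
    have h := MeasurableSpace.measurableSet_generateFrom hG
    rw [generateFrom_generateSetAlgebra_eq] at h
    rw [h𝒜]
    exact h
  have hSA := isSetAlgebra_generateSetAlgebra (𝒜 := 𝒜)
  -- the sets that can be approximated form a `σ`-algebra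
  suffices H : MeasurableSet B ∧ ∀ ε : ENNReal, 0 < ε →
      ∃ G ∈ generateSetAlgebra 𝒜, expFreq μ (symmDiff B G) ≤ ε from H.2 ε hε
  have hB' : MeasurableSet[MeasurableSpace.generateFrom 𝒜] B := h𝒜 ▸ hB
  clear hB hε ε
  induction B, hB' using MeasurableSpace.generateFrom_induction with
  | hC t ht _ =>
    refine ⟨halg t (self_subset_generateSetAlgebra ht), fun ε hε =>
      ⟨t, self_subset_generateSetAlgebra ht, ?_⟩⟩
    simp [expFreq, upperFreq_empty]
  | empty =>
    refine ⟨MeasurableSet.empty, fun ε hε => ⟨∅, hSA.empty_mem, ?_⟩⟩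
    simp [expFreq, upperFreq_empty]
  | compl t _ ih =>
    refine ⟨ih.1.compl, fun ε hε => ?_⟩
    obtain ⟨G, hG, h⟩ := ih.2 ε hε
    refine ⟨Gᶜ, hSA.compl_mem hG, ?_⟩
    rwa [compl_symmDiff_compl]
  | iUnion f _ ih =>
    refine ⟨MeasurableSet.iUnion fun n => (ih n).1, fun ε hε => ?_⟩
    -- all but finitely many of the sets `f i` may be dropped, since under a process in `classC1`
    -- the remainder of the union is visited rarely
    have htail := hμ (fun n => (⋃ i, f i) \ ⋃ i ∈ Finset.range n, f i)
      (fun n => (MeasurableSet.iUnion fun n => (ih n).1).diff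
        (Finset.measurableSet_biUnion _ fun i _ => (ih i).1))
      (fun m n h => Set.sdiff_subset_sdiff_right (Set.biUnion_subset_biUnion_left
        (fun i hi => Finset.range_mono h hi)))
      (by
        ext y
        simp only [Set.mem_iInter, Set.mem_sdiff, Set.mem_iUnion, Set.mem_empty_iff_false,
          iff_false, not_forall]
        by_cases hy : ∃ i, y ∈ f i
        · obtain ⟨i, hi⟩ := hy
          exact ⟨i + 1, fun h => h.2 ⟨i, by simp, hi⟩⟩
        · exact ⟨0, fun h => hy h.1⟩)
    have hε2 : 0 < ε / 2 := ENNReal.div_pos hε.ne' (by simp)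
    obtain ⟨n, hn⟩ := (htail.eventually (ge_mem_nhds hε2)).exists
    -- each of the first `n` sets is approximated up to `ε / 2 / (n + 1)`
    have hfin : ∀ m : ℕ, ∃ G ∈ generateSetAlgebra 𝒜,
        expFreq μ (symmDiff (⋃ i ∈ Finset.range m, f i) G) ≤ m * (ε / 2 / (n + 1)) := by
      intro m
      induction m with
      | zero => exact ⟨∅, hSA.empty_mem, by simp [expFreq, upperFreq_empty]⟩
      | succ m ihm =>
        obtain ⟨G, hG, h⟩ := ihm
        obtain ⟨G', hG', h'⟩ := (ih m).2 (ε / 2 / (n + 1)) (ENNReal.div_pos hε2.ne'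
          (by simp))
        refine ⟨G ∪ G', hSA.union_mem hG hG', ?_⟩
        have hsub : symmDiff (⋃ i ∈ Finset.range (m + 1), f i) (G ∪ G') ⊆
            symmDiff (⋃ i ∈ Finset.range m, f i) G ∪ symmDiff (f m) G' := by
          rw [Finset.range_add_one, Finset.set_biUnion_insert, Set.union_comm (f m)]
          intro y
          simp only [Set.mem_symmDiff, Set.mem_union]
          tauto
        refine (expFreq_mono hsub).trans ((expFreq_union_le ?_).trans ?_)
        · exact (Finset.measurableSet_biUnion _ fun i _ => (ih i).1).symmDiff (halg G hG)
        · push_cast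
          rw [add_mul, one_mul]
          exact add_le_add h h'
    obtain ⟨G, hG, h⟩ := hfin n
    refine ⟨G, hG, ?_⟩
    have hsub : symmDiff (⋃ i, f i) G ⊆ ((⋃ i, f i) \ ⋃ i ∈ Finset.range n, f i) ∪
        symmDiff (⋃ i ∈ Finset.range n, f i) G := by
      intro y
      have : y ∈ (⋃ i ∈ Finset.range n, f i) → y ∈ ⋃ i, f i := fun hy => by
        simp only [Set.mem_iUnion] at hy ⊢
        obtain ⟨i, _, hi⟩ := hy
        exact ⟨i, hi⟩
      simp only [Set.mem_symmDiff, Set.mem_union, Set.mem_sdiff]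
      tauto
    refine (expFreq_mono hsub).trans ((expFreq_union_le ?_).trans ?_)
    · exact (MeasurableSet.iUnion fun n => (ih n).1).diff
        (Finset.measurableSet_biUnion _ fun i _ => (ih i).1)
    · have h3 : (n : ENNReal) * (ε / 2 / (n + 1)) ≤ ε / 2 := by
        rw [← mul_div_assoc]
        refine ENNReal.div_le_of_le_mul ?_
        rw [mul_comm]
        gcongr
        exact le_self_add
      calc _ ≤ ε / 2 + ε / 2 := add_le_add hn (h.trans h3)
        _ = ε := ENNReal.add_halves ε

/-- The policy given by a decision list: the entry `(i, j)` prescribes action `a j` on `G i`. -/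
noncomputable def decisionList {A : Type v} (G : ℕ → Set X) (a : ℕ → A) : List (ℕ × ℕ) → X → A
  | [], _ => a 0
  | (i, j) :: l, x => by
      classical exact if x ∈ G i then a j else decisionList G a l x

theorem measurable_decisionList {A : Type v} [MeasurableSpace A] {G : ℕ → Set X}
    (hG : ∀ i, MeasurableSet (G i)) (a : ℕ → A) (l : List (ℕ × ℕ)) :
    Measurable (decisionList G a l) := by
  classical
  induction l with
  | nil => exact measurable_const
  | cons p l ih => exact Measurable.ite (hG p.1) measurable_const ih

/-- Decision lists are dense among all measurable policies, uniformly over `classC1`. -/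
theorem exists_decisionList_approx {A : Type v} [MeasurableSpace A] [MeasurableSingletonClass A]
    {a : ℕ → A} (ha : Function.Surjective a) {𝒜 : Set (Set X)}
    (h𝒜 : ‹MeasurableSpace X› = MeasurableSpace.generateFrom 𝒜) {G : ℕ → Set X}
    (hG : generateSetAlgebra 𝒜 = Set.range G) (hμ : μ ∈ classC1 X) {π : X → A} (hπ : Measurable π)
    {ε : ENNReal} (hε : 0 < ε) :
    ∃ l, expFreq μ {x | π x ≠ decisionList G a l x} ≤ ε := by
  have hGm : ∀ i, MeasurableSet (G i) := fun i => by
    have h := MeasurableSpace.measurableSet_generateFrom (hG ▸ Set.mem_range_self i :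
      G i ∈ generateSetAlgebra 𝒜)
    rw [generateFrom_generateSetAlgebra_eq] at h
    rw [h𝒜]
    exact h
  have hfib : ∀ j, MeasurableSet {x | π x = a j} := fun j => hπ (measurableSet_singleton (a j))
  have hfin : ∀ n, MeasurableSet {x | ∀ j < n, π x ≠ a j} := fun n => by
    have : {x | ∀ j < n, π x ≠ a j} = ⋂ j ∈ Finset.range n, {x | π x = a j}ᶜ := by
      ext x; simp
    rw [this]
    exact Finset.measurableSet_biInter _ fun j _ => (hfib j).compl
  -- all but finitely many actions of `π` are rare
  have htail := hμ (fun n => {x | ∀ j < n, π x ≠ a j}) hfin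
    (fun m n h x hx j hj => hx j (hj.trans_le h)) (by
      ext x
      simp only [Set.mem_iInter, Set.mem_ofPred_eq, Set.mem_empty_iff_false, iff_false, not_forall]
      obtain ⟨j, hj⟩ := ha (π x)
      exact ⟨j + 1, j, by omega, fun h => h hj.symm⟩)
  have hε2 : 0 < ε / 2 := ENNReal.div_pos hε.ne' (by simp)
  obtain ⟨n, hn⟩ := (htail.eventually (ge_mem_nhds hε2)).exists
  -- the list is built one action at a time, with an entry for a set close to `{x | π x = a m}`
  have key : ∀ m : ℕ, ∃ l, expFreq μ {x | π x ≠ decisionList G a l x ∧ ∃ j < m, π x = a j} ≤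
      m * (ε / 2 / (n + 1)) := by
    intro m
    induction m with
    | zero => exact ⟨[], by simp [expFreq, upperFreq_empty]⟩
    | succ m ihm =>
      obtain ⟨l, hl⟩ := ihm
      obtain ⟨g, hg, hg'⟩ := exists_approx_of_mem_classC1 hμ 𝒜 h𝒜 (hfib m)
        (show 0 < ε / 2 / (n + 1) from ENNReal.div_pos hε2.ne' (by simp))
      rw [hG] at hg
      obtain ⟨i, rfl⟩ := hg
      refine ⟨(i, m) :: l, ?_⟩
      have hsub : {x | π x ≠ decisionList G a ((i, m) :: l) x ∧ ∃ j < m + 1, π x = a j} ⊆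
          symmDiff {x | π x = a m} (G i) ∪
            {x | π x ≠ decisionList G a l x ∧ ∃ j < m, π x = a j} := by
        rintro x ⟨h1, j, hj, h2⟩
        rw [decisionList] at h1
        rw [Set.mem_union, Set.mem_symmDiff]
        by_cases hx : x ∈ G i
        · rw [if_pos hx] at h1
          exact Or.inl (Or.inr ⟨hx, h1⟩)
        · rw [if_neg hx] at h1
          by_cases hm : π x = a m
          · exact Or.inl (Or.inl ⟨hm, hx⟩)
          · refine Or.inr ⟨h1, j, lt_of_le_of_ne (by omega) ?_, h2⟩
            rintro rfl
            exact hm h2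
      refine (expFreq_mono hsub).trans ((expFreq_union_le ((hfib m).symmDiff (hGm i))).trans ?_)
      push_cast
      rw [add_mul, one_mul, add_comm]
      exact add_le_add hl hg'
  obtain ⟨l, hl⟩ := key n
  refine ⟨l, ?_⟩
  have hsub : {x | π x ≠ decisionList G a l x} ⊆ {x | ∀ j < n, π x ≠ a j} ∪
      {x | π x ≠ decisionList G a l x ∧ ∃ j < n, π x = a j} := by
    intro x hx
    by_cases h : ∃ j < n, π x = a j
    · exact Or.inr ⟨hx, h⟩
    · exact Or.inl fun j hj h' => h ⟨j, hj, h'⟩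
  refine (expFreq_mono hsub).trans ((expFreq_union_le (hfin n)).trans ?_)
  have h3 : (n : ENNReal) * (ε / 2 / (n + 1)) ≤ ε / 2 := by
    rw [← mul_div_assoc]
    refine ENNReal.div_le_of_le_mul ?_
    rw [mul_comm]
    gcongr
    exact le_self_add
  calc _ ≤ ε / 2 + ε / 2 := add_le_add hn (hl.trans h3)
    _ = ε := ENNReal.add_halves ε

/-- For countably many actions, one rule learns under all processes in `classC1`, whatever the
rewards: follow a dense sequence of policies by regret matching. -/
theorem exists_rule_classC1 {A : Type v} [MeasurableSpace A] [MeasurableSingletonClass A]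
    [Countable A] [Nonempty A] [MeasurableSpace.CountablyGenerated X] :
    ∃ f : LearningRule X A, ∀ μ ∈ classC1 X, ∀ m, UniversallyConsistent m f μ := by
  obtain ⟨a, ha⟩ := exists_surjective_nat A
  have h𝒜 : ‹MeasurableSpace X› = MeasurableSpace.generateFrom
      (MeasurableSpace.countableGeneratingSet X) :=
    MeasurableSpace.generateFrom_countableGeneratingSet.symm
  obtain ⟨G, hG⟩ := (countable_generateSetAlgebra
    (MeasurableSpace.countable_countableGeneratingSet (α := X))).exists_eq_range
    ⟨∅, isSetAlgebra_generateSetAlgebra.empty_mem⟩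
  have hGm : ∀ i, MeasurableSet (G i) := fun i => by
    have h := MeasurableSpace.measurableSet_generateFrom (hG ▸ Set.mem_range_self i :
      G i ∈ generateSetAlgebra (MeasurableSpace.countableGeneratingSet X))
    rw [generateFrom_generateSetAlgebra_eq] at h
    rw [h𝒜]
    exact h
  obtain ⟨d, hd⟩ := exists_surjective_nat (List (ℕ × ℕ))
  let E : ℕ → X → A := fun i => decisionList G a (d i)
  have hE : ∀ i, Measurable (E i) := fun i => measurable_decisionList hGm a _
  have hK : MeasurableSet {p : X × X | (fun _ : X => ()) p.1 = (fun _ : X => ()) p.2} :=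
    MeasurableSet.const _
  refine ⟨regretMatchingRule E hE (fun _ => ()) hK, fun μ hμ m P _ =>
    consistent_of_ae_seed fun S π hπ => ?_⟩
  have hmeas : ∀ i, MeasurableSet {x | π x ≠ E i x} := fun i => by
    have : {x | π x ≠ E i x} = ⋃ j, ({x | π x = a j} ∩ {x | E i x = a j}ᶜ) := by
      ext x
      simp only [Set.mem_ofPred_eq, Set.mem_iUnion, Set.mem_inter_iff, Set.mem_compl_iff]
      constructor
      · intro h
        obtain ⟨j, hj⟩ := ha (π x)
        exact ⟨j, hj.symm, fun h' => h (hj.symm.trans h'.symm)⟩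
      · rintro ⟨j, h1, h2⟩ h3
        exact h2 (h3.symm.trans h1)
    rw [this]
    exact MeasurableSet.iUnion fun j => (hπ (measurableSet_singleton _)).inter
      (hE i (measurableSet_singleton _)).compl
  -- the infimum over the experts has expectation zero, though it need not be attained
  have hinf : ∀ᵐ x ∂(μ : Measure (ℕ → X)), ⨅ i, upperFreq {x | π x ≠ E i x} x = 0 := by
    have h0 : ∫⁻ x, ⨅ i, upperFreq {x | π x ≠ E i x} x ∂(μ : Measure (ℕ → X)) = 0 := by
      refine le_antisymm (le_of_forall_pos_le_add fun ε hε => ?_) zero_le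
      obtain ⟨l, hl⟩ := exists_decisionList_approx ha h𝒜 hG hμ hπ hε
      obtain ⟨i, rfl⟩ := hd l
      rw [zero_add]
      exact (lintegral_mono fun x => iInf_le _ i).trans hl
    exact (lintegral_eq_zero_iff (Measurable.iInf fun i => measurable_upperFreq (hmeas i))).1 h0
  filter_upwards [hinf] with x hx u
  have hall : ∀ᵐ s ∂(regretMatchingRule E hE (fun _ => ()) hK).seedLaw, ∀ i : ℕ, ∀ ε > 0,
      ∀ᶠ T : ℕ in atTop, ∑ t ∈ Finset.range T,
        ((rewardOf (regretMatchingRule E hE (fun _ => ()) hK) S s x u t (E i (x t)) : ℝ) -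
          rewardOf (regretMatchingRule E hE (fun _ => ()) hK) S s x u t
            (play (regretMatchingRule E hE (fun _ => ()) hK) S s x u t).1) ≤ ε * T := by
    refine ae_all_iff.2 fun i => ?_
    refine regretMatchingRule_regret S x u (c := fun _ => i) (I := i + 1) (fun _ => by omega) ?_
    intro ε hε
    obtain ⟨N, hN⟩ := exists_nat_gt (1 / ε)
    filter_upwards [eventually_ge_atTop N] with T hT
    have h2 : 1 / ε ≤ T := hN.le.trans (by exact_mod_cast hT)
    rw [div_le_iff₀ hε] at h2
    exact le_trans (b := 1) (by exact_mod_cast Finset.card_le_one.2 fun _ _ _ _ => rfl)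
      (by linarith)
  refine Eventually.mono hall fun s hs => limsup_averageRegret_le_zero fun ε hε => ?_
  have hlt : ⨅ i, upperFreq {x | π x ≠ E i x} x < ENNReal.ofReal (ε / 2) := by
    rw [hx]; exact ENNReal.ofReal_pos.2 (by positivity)
  obtain ⟨i, hi⟩ := iInf_lt_iff.1 hlt
  filter_upwards [eventually_card_le_of_upperFreq_lt hi, hs i (ε / 2) (by positivity)]
    with T h1 h2
  -- at the rare times when `π` and the expert `i` disagree, the difference costs at most `1`
  calc _ ≤ ∑ t ∈ Finset.range T,
        (((rewardOf (regretMatchingRule E hE (fun _ => ()) hK) S s x u t (E i (x t)) : ℝ) -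
          rewardOf (regretMatchingRule E hE (fun _ => ()) hK) S s x u t
            (play (regretMatchingRule E hE (fun _ => ()) hK) S s x u t).1) +
        {x | π x ≠ E i x}.indicator (fun _ => (1 : ℝ)) (x t)) := by
        refine Finset.sum_le_sum fun t _ => ?_
        by_cases h : π (x t) = E i (x t)
        · rw [h]
          have : 0 ≤ {x | π x ≠ E i x}.indicator (fun _ => (1 : ℝ)) (x t) :=
            Set.indicator_nonneg (fun _ _ => zero_le_one) _
          linarith
        · rw [Set.indicator_of_mem (show x t ∈ {x | π x ≠ E i x} from h)]
          have := (abs_le.1 (abs_reward_sub_le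
            (rewardOf (regretMatchingRule E hE (fun _ => ()) hK) S s x u t (π (x t)))
            (rewardOf (regretMatchingRule E hE (fun _ => ()) hK) S s x u t (E i (x t))))).2
          linarith
    _ ≤ _ := by rw [Finset.sum_add_distrib]; linarith

end ClassC1

/-! ### Deterministic rewards -/

section Deterministic

variable {X : Type u} {A : Type v} [MeasurableSpace X] [MeasurableSpace A]

/-- The mechanism under which action `a` in context `x` brings the reward `ρ t (a, x)` at time
`t`. -/
noncomputable def deterministicMechanism (ρ : ℕ → A × X → Reward) (hρ : ∀ t, Measurable (ρ t)) :
    RewardMechanism X A where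
  dist t := Kernel.deterministic (fun h => ρ t (h.2.2.2, h.1 t)) ((hρ t).comp (by fun_prop))
  isMarkovKernel_dist t := inferInstance

theorem deterministicMechanism_inModel (ρ : ℕ → A × X → Reward) (hρ : ∀ t, Measurable (ρ t)) :
    (deterministicMechanism ρ hρ).InModel .oblivious :=
  ⟨fun t => Kernel.deterministic (ρ t) (hρ t), fun t x as rs a => by
    simp [deterministicMechanism, Kernel.deterministic_apply]⟩

/-- The sampler of `deterministicMechanism` that uses no noise. -/
noncomputable def deterministicSampler (ρ : ℕ → A × X → Reward) (hρ : ∀ t, Measurable (ρ t)) :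
    RewardSampler (deterministicMechanism ρ hρ) where
  Noise := Unit
  noiseLaw := Measure.dirac ()
  reward t p := ρ t (p.2.2.2.2, p.2.1 t)
  measurable_reward t := (hρ t).comp (by fun_prop)
  map_reward t h := by
    refine (Measure.map_dirac' (measurable_of_countable _) ()).trans ?_
    simp [deterministicMechanism, Kernel.deterministic_apply]

/-- The rewards received by `f` with seed `s` in contexts `x` under the deterministic rewards
`ρ`. -/
noncomputable def detReward (f : LearningRule X A) (ρ : ℕ → A × X → Reward) (s : f.Seed)
    (x : ℕ → X) (t : ℕ) : Reward :=
  ρ t (f.act t (s, (fun i => x i), (fun i : Fin t => detReward f ρ s x i), x t), x t)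
termination_by t
decreasing_by exact i.isLt

/-- The actions selected by `f` under the deterministic rewards `ρ`. -/
noncomputable def detAct (f : LearningRule X A) (ρ : ℕ → A × X → Reward) (s : f.Seed)
    (x : ℕ → X) (t : ℕ) : A :=
  f.act t (s, (fun i => x i), (fun i : Fin t => detReward f ρ s x i), x t)

/-- The cumulative regret of `f` against the policy `π` under the deterministic rewards `ρ`. -/
noncomputable def detRegret (f : LearningRule X A) (ρ : ℕ → A × X → Reward) (π : X → A) (s : f.Seed)
    (x : ℕ → X) (T : ℕ) : ℝ :=
  ∑ t ∈ Finset.range T, ((ρ t (π (x t), x t) : ℝ) - ρ t (detAct f ρ s x t, x t))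

theorem detReward_eq (f : LearningRule X A) (ρ : ℕ → A × X → Reward) (s : f.Seed) (x : ℕ → X)
    (t : ℕ) : detReward f ρ s x t = ρ t (detAct f ρ s x t, x t) := by
  rw [detReward, detAct]

/-- The actions are determined by the rewards seen along the way. -/
theorem detAct_congr {f : LearningRule X A} {ρ ρ' : ℕ → A × X → Reward} {s : f.Seed} {x : ℕ → X}
    {t : ℕ}
    (h : ∀ j < t, ρ j (detAct f ρ s x j, x j) = ρ' j (detAct f ρ s x j, x j)) :
    detAct f ρ s x t = detAct f ρ' s x t := by
  induction t using Nat.strong_induction_on with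
  | _ t ih =>
    unfold detAct
    congr
    funext j
    rw [detReward_eq, detReward_eq, h j j.2, ih j j.2 fun i hi => h i (hi.trans j.2)]

/-- Contexts after time `t` do not matter. -/
theorem detAct_congr_context {f : LearningRule X A} {ρ : ℕ → A × X → Reward} {s : f.Seed}
    {x x' : ℕ → X} {t : ℕ} (h : ∀ j ≤ t, x j = x' j) :
    detAct f ρ s x t = detAct f ρ s x' t := by
  induction t using Nat.strong_induction_on with
  | _ t ih =>
    have h1 : (fun i : Fin t => x i) = fun i : Fin t => x' i := by
      funext i; exact h i i.2.le
    have h2 : (fun i : Fin t => detReward f ρ s x i) = fun i : Fin t => detReward f ρ s x' i := by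
      funext j
      rw [detReward_eq, detReward_eq, h j j.2.le, ih j j.2 fun i hi => h i (hi.trans j.2.le)]
    unfold detAct
    rw [h1, h2, h t le_rfl]

theorem play_deterministicSampler (f : LearningRule X A) (ρ : ℕ → A × X → Reward)
    (hρ : ∀ t, Measurable (ρ t)) (s : f.Seed) (x : ℕ → X)
    (u : ℕ → (deterministicSampler ρ hρ).Noise) (t : ℕ) :
    play f (deterministicSampler ρ hρ) s x u t = (detAct f ρ s x t, detReward f ρ s x t) := by
  induction t using Nat.strong_induction_on with
  | _ t ih =>
    have h1 : (play f (deterministicSampler ρ hρ) s x u t).1 = detAct f ρ s x t := by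
      rw [play_fst, detAct]
      congr
      funext i
      rw [ih i i.2]
    refine Prod.ext h1 ?_
    rw [play_snd, h1, detReward_eq]
    rfl

theorem averageRegret_deterministicSampler (f : LearningRule X A) (ρ : ℕ → A × X → Reward)
    (hρ : ∀ t, Measurable (ρ t)) (π : X → A) (s : f.Seed) (x : ℕ → X)
    (u : ℕ → (deterministicSampler ρ hρ).Noise) (T : ℕ) :
    averageRegret f (deterministicSampler ρ hρ) π s x u T = detRegret f ρ π s x T / T := by
  unfold averageRegret detRegret
  congr 1
  refine Finset.sum_congr rfl fun t _ => ?_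
  rw [play_deterministicSampler]
  rfl

theorem abs_detRegret_div_le (f : LearningRule X A) (ρ : ℕ → A × X → Reward) (π : X → A)
    (s : f.Seed) (x : ℕ → X) (T : ℕ) : |detRegret f ρ π s x T / T| ≤ 1 :=
  abs_sum_div_le_one (fun _ => abs_reward_sub_le _ _) T

/-- Consistency for the oblivious model, specialised to deterministic rewards. -/
theorem UniversallyConsistent.ae_limsup_detRegret {f : LearningRule X A}
    {μ : ProbabilityMeasure (ℕ → X)} (h : UniversallyConsistent .oblivious f μ)
    {ρ : ℕ → A × X → Reward} (hρ : ∀ t, Measurable (ρ t)) {π : X → A} (hπ : Measurable π) :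
    ∀ᵐ x ∂(μ : Measure (ℕ → X)), ∀ᵐ s ∂f.seedLaw,
      limsup (fun T : ℕ => detRegret f ρ π s x T / T) atTop ≤ 0 := by
  have h1 := h _ (deterministicMechanism_inModel ρ hρ) (deterministicSampler ρ hρ) π hπ
  have h2 := Measure.ae_ae_of_ae_prod h1
  filter_upwards [h2] with x hx
  have h3 := Measure.ae_ae_of_ae_prod hx
  filter_upwards [h3] with s hs
  obtain ⟨u, hu⟩ := hs.exists
  simpa only [averageRegret_deterministicSampler] using hu

section Parametric

variable {Θ : Type*} [MeasurableSpace Θ] {f : LearningRule X A}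
  {ρ : Θ → ℕ → A × X → Reward}

theorem measurable_detAct (hρ : ∀ t, Measurable fun p : Θ × A × X => ρ p.1 t p.2) (t : ℕ) :
    Measurable fun p : (ℕ → X) × Θ × f.Seed => detAct f (ρ p.2.1) p.2.2 p.1 t := by
  induction t using Nat.strong_induction_on with
  | _ t ih =>
    unfold detAct
    refine (f.measurable_act t).comp ?_
    refine (measurable_snd.comp measurable_snd).prodMk (Measurable.prodMk (by fun_prop)
      (Measurable.prodMk (measurable_pi_lambda _ fun j => ?_) (by fun_prop)))
    simp only [detReward_eq]
    exact (hρ j).comp ((measurable_fst.comp measurable_snd).prodMk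
      ((ih j j.2).prodMk (by fun_prop)))

theorem measurable_detRegret (hρ : ∀ t, Measurable fun p : Θ × A × X => ρ p.1 t p.2)
    {π : Θ → X → A} (hπ : Measurable fun p : Θ × X => π p.1 p.2) (T : ℕ) :
    Measurable fun p : (ℕ → X) × Θ × f.Seed => detRegret f (ρ p.2.1) (π p.2.1) p.2.2 p.1 T := by
  unfold detRegret
  have hθ : Measurable fun p : (ℕ → X) × Θ × f.Seed => p.2.1 := measurable_fst.comp measurable_snd
  have hx : ∀ t : ℕ, Measurable fun p : (ℕ → X) × Θ × f.Seed => p.1 t := fun t => by fun_prop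
  refine Finset.measurable_sum _ fun t _ => Measurable.sub ?_ ?_
  · exact ((hρ t).comp (hθ.prodMk ((hπ.comp (hθ.prodMk (hx t))).prodMk (hx t)))).subtype_val
  · exact ((hρ t).comp (hθ.prodMk ((measurable_detAct hρ t).prodMk (hx t)))).subtype_val

/-- If `f` is universally consistent under `μ` then, for almost every sequence of contexts, its
regret averaged over a random choice of the rewards is asymptotically nonpositive. -/
theorem UniversallyConsistent.ae_eventually_integral_detRegret_le {τ : Measure Θ}
    [IsProbabilityMeasure τ] {μ : ProbabilityMeasure (ℕ → X)}
    (h : UniversallyConsistent .oblivious f μ)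
    (hρ : ∀ t, Measurable fun p : Θ × A × X => ρ p.1 t p.2) {π : Θ → X → A}
    (hπ : Measurable fun p : Θ × X => π p.1 p.2) :
    ∀ᵐ x ∂(μ : Measure (ℕ → X)), ∀ ε > 0, ∀ᶠ T : ℕ in atTop,
      ∫ ω, detRegret f (ρ ω.1) (π ω.1) ω.2 x T ∂(τ.prod f.seedLaw) ≤ ε * T := by
  have hM : MeasurableSet {p : (ℕ → X) × Θ × f.Seed |
      limsup (fun T : ℕ => detRegret f (ρ p.2.1) (π p.2.1) p.2.2 p.1 T / T) atTop ≤ 0} :=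
    measurableSet_le (Measurable.limsup fun T => (measurable_detRegret hρ hπ T).div_const _)
      measurable_const
  have hM' : MeasurableSet {q : (ℕ → X) × Θ | ∀ᵐ s ∂f.seedLaw,
      limsup (fun T : ℕ => detRegret f (ρ q.2) (π q.2) s q.1 T / T) atTop ≤ 0} := by
    have h2 : MeasurableSet {p : ((ℕ → X) × Θ) × f.Seed |
        limsup (fun T : ℕ => detRegret f (ρ p.1.2) (π p.1.2) p.2 p.1.1 T / T) atTop ≤ 0} :=
      hM.preimage (f := fun p : ((ℕ → X) × Θ) × f.Seed => (p.1.1, p.1.2, p.2)) (by fun_prop)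
    exact measurableSet_eq_fun (measurable_measure_prodMk_left h2.compl) measurable_const
  have h1 : ∀ᵐ x ∂(μ : Measure (ℕ → X)), ∀ᵐ θ ∂τ, ∀ᵐ s ∂f.seedLaw,
      limsup (fun T : ℕ => detRegret f (ρ θ) (π θ) s x T / T) atTop ≤ 0 := by
    rw [Measure.ae_ae_comm hM']
    exact ae_of_all _ fun θ => h.ae_limsup_detRegret
      (fun t => (hρ t).comp (measurable_const.prodMk measurable_id))
      (hπ.comp (measurable_const.prodMk measurable_id))
  filter_upwards [h1] with x hx ε hε
  have h2 : ∀ᵐ ω ∂(τ.prod f.seedLaw),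
      limsup (fun T : ℕ => detRegret f (ρ ω.1) (π ω.1) ω.2 x T / T) atTop ≤ 0 :=
    (Measure.ae_prod_iff_ae_ae (measurable_prodMk_left hM)).2 hx
  have h3 := eventually_integral_le_of_ae_limsup_le_zero
    (fun T => ((measurable_detRegret hρ hπ T).comp measurable_prodMk_left).div_const _)
    (fun T ω => abs_detRegret_div_le f (ρ ω.1) (π ω.1) ω.2 x T) h2 hε
  filter_upwards [h3, eventually_gt_atTop 0] with T hT hT0
  rw [integral_div, div_le_iff₀ (by exact_mod_cast hT0)] at hT
  exact hT

end Parametric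

end Deterministic

/-! ### Uncountably many actions -/

section Uncountable

variable {X : Type u} {A : Type v} [MeasurableSpace X] [MeasurableSpace A]

/-- With uncountably many actions nothing can be learned: some action `b` is almost surely never
tried by a rule that receives no reward, and the rewards may be carried by `b` alone. -/
theorem not_universallyConsistent_of_uncountable [MeasurableSingletonClass A] [Uncountable A]
    (f : LearningRule X A) (μ : ProbabilityMeasure (ℕ → X)) :
    ¬ UniversallyConsistent .oblivious f μ := by
  classical
  intro h
  have hact : ∀ t, Measurable fun p : (ℕ → X) × f.Seed =>
      detAct f (fun _ _ => (0 : Reward)) p.2 p.1 t := fun t =>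
    (measurable_detAct (Θ := Unit) (f := f) (ρ := fun _ _ _ => (0 : Reward))
      (fun t => measurable_const) t).comp
      (measurable_fst.prodMk ((measurable_const (a := ())).prodMk measurable_snd))
  have hcount : (⋃ t, {a | 0 < ((μ : Measure (ℕ → X)).prod f.seedLaw)
      {p | detAct f (fun _ _ => (0 : Reward)) p.2 p.1 t = a}}).Countable :=
    Set.countable_iUnion fun t => Measure.countable_meas_level_set_pos (hact t)
  obtain ⟨b, hb⟩ : ∃ b : A, b ∉ ⋃ t, {a | 0 < ((μ : Measure (ℕ → X)).prod f.seedLaw)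
      {p | detAct f (fun _ _ => (0 : Reward)) p.2 p.1 t = a}} := by
    by_contra! hall
    exact Set.not_countable_univ (hcount.mono fun a _ => hall a)
  simp only [Set.mem_iUnion, Set.mem_ofPred_eq, not_exists, not_lt, nonpos_iff_eq_zero] at hb
  have hne : ∀ᵐ p ∂((μ : Measure (ℕ → X)).prod f.seedLaw), ∀ t,
      detAct f (fun _ _ => (0 : Reward)) p.2 p.1 t ≠ b := by
    rw [ae_all_iff]
    intro t
    rw [ae_iff]
    simpa using hb t
  let ρ : ℕ → A × X → Reward := fun _ p => if p.1 = b then 1 else 0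
  have hρ : ∀ t, Measurable (ρ t) := fun t =>
    Measurable.ite (measurable_fst (measurableSet_singleton b)) measurable_const measurable_const
  have h1 := h.ae_limsup_detRegret hρ (measurable_const (a := b))
  obtain ⟨x, hx1, hx2⟩ := (h1.and (Measure.ae_ae_of_ae_prod hne)).exists
  obtain ⟨s, hs1, hs2⟩ := (hx1.and hx2).exists
  have hplay : ∀ t, detAct f (fun _ _ => (0 : Reward)) s x t = detAct f ρ s x t := fun t =>
    detAct_congr fun j _ => by simp [ρ, hs2 j]
  have hreg : ∀ T : ℕ, detRegret f ρ (fun _ => b) s x T = T := by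
    intro T
    unfold detRegret
    have h3 : ∀ t ∈ Finset.range T,
        ((ρ t (b, x t) : ℝ) - ρ t (detAct f ρ s x t, x t)) = 1 := by
      intro t _
      have h4 : detAct f ρ s x t ≠ b := by rw [← hplay]; exact hs2 t
      simp [ρ, h4]
    rw [Finset.sum_congr rfl h3]
    simp
  obtain ⟨T, hT1, hT2⟩ := ((eventually_le_of_limsup_le_zero
    (abs_detRegret_div_le f ρ (fun _ => b) s x) hs1 one_half_pos).and
      (eventually_gt_atTop 0)).exists
  have hT0 : (T : ℝ) ≠ 0 := by exact_mod_cast (by omega : T ≠ 0)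
  rw [hreg, div_self hT0] at hT1
  norm_num at hT1

end Uncountable

/-! ### Rewards determined by random labels -/

section Labels

variable {X : Type u} {A : Type v} [MeasurableSpace X] [MeasurableSpace A]
  {ι V : Type*}

/-- Rewards that depend on the context through the label `θ (g t x)` of its group `g t x` only. -/
def labelReward (w : ℕ → V → A → Reward) (g : ℕ → X → ι) (θ : ι → V) (t : ℕ) (p : A × X) : Reward :=
  w t (θ (g t p.2)) p.1

theorem measurable_label [MeasurableSpace V] [Countable ι] [MeasurableSpace ι]
    [MeasurableSingletonClass ι] {g : X → ι} (hg : Measurable g) :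
    Measurable fun p : (ι → V) × X => p.1 (g p.2) :=
  (measurable_from_prod_countable_left (f := fun p : (ι → V) × ι => p.1 p.2)
    fun i => measurable_pi_apply i).comp (measurable_fst.prodMk (hg.comp measurable_snd))

theorem measurable_labelReward [MeasurableSpace V] [Countable ι] [MeasurableSpace ι]
    [MeasurableSingletonClass ι] [Countable V] [MeasurableSingletonClass V] {w : ℕ → V → A → Reward}
    (hw : ∀ t v, Measurable (w t v)) {g : ℕ → X → ι} (hg : ∀ t, Measurable (g t)) (t : ℕ) :
    Measurable fun p : (ι → V) × A × X => labelReward w g p.1 t p.2 := by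
  have h1 : Measurable fun p : (ι → V) × A × X => p.1 (g t p.2.2) :=
    (measurable_label (hg t)).comp (measurable_fst.prodMk (measurable_snd.comp measurable_snd))
  exact (measurable_from_prod_countable_left (f := fun q : A × V => w t q.2 q.1) (hw t)).comp
    ((measurable_fst.comp measurable_snd).prodMk h1)

/-- Changing a label whose value has not been revealed does not change the action. -/
theorem detAct_labelReward_update [DecidableEq ι] (f : LearningRule X A) {w : ℕ → V → A → Reward}
    {g : ℕ → X → ι} {θ : ι → V} {i : ι} {v : V} {s : f.Seed} {x : ℕ → X} {t : ℕ}
    (h : ∀ j < t, g j (x j) = i → w j (θ i) (detAct f (labelReward w g θ) s x j) =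
      w j v (detAct f (labelReward w g θ) s x j)) :
    detAct f (labelReward w g (Function.update θ i v)) s x t =
      detAct f (labelReward w g θ) s x t := by
  refine (detAct_congr fun j hj => ?_).symm
  unfold labelReward
  by_cases hi : g j (x j) = i
  · simp only [hi, Function.update_self]
    exact h j hj hi
  · rw [Function.update_of_ne hi]

/-- The law of a fair coin. -/
noncomputable def fairCoin : Measure Bool := (PMF.uniformOfFintype Bool).toMeasure

instance : IsProbabilityMeasure fairCoin := by unfold fairCoin; infer_instance

theorem integral_fairCoin (h : Bool → ℝ) : ∫ z, h z ∂fairCoin = (h true + h false) / 2 := by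
  rw [fairCoin, PMF.integral_eq_sum]
  simp
  ring

end Labels

/-! ### Learnable processes visit few distinct atoms -/

section Atomic

variable {X : Type u} {A : Type v} [MeasurableSpace X] [MeasurableSpace A]

/-- If there is no non-atomic probability measure then every probability measure is carried by its
countably many atoms: conditioning on their complement would give a non-atomic one. -/
theorem ae_mem_countable_of_not_admits [MeasurableSingletonClass X]
    (hX : ¬ AdmitsNonatomicProbability X) (ν : Measure X) [IsProbabilityMeasure ν] :
    ∃ D : Set X, D.Countable ∧ ∀ᵐ y ∂ν, y ∈ D := by
  set D : Set X := {y | 0 < ν {z | id z = y}} with hD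
  have hDc : D.Countable := Measure.countable_meas_level_set_pos measurable_id
  refine ⟨D, hDc, ?_⟩
  by_contra hne
  have hpos : ν Dᶜ ≠ 0 := fun h => hne (by rw [ae_iff]; exact h)
  refine hX ⟨ProbabilityTheory.cond ν Dᶜ, cond_isProbabilityMeasure hpos, fun y => ?_⟩
  rw [cond_apply hDc.measurableSet.compl]
  by_cases hy : y ∈ D
  · have : Dᶜ ∩ {y} = ∅ := by
      ext z; simp only [Set.mem_inter_iff, Set.mem_compl_iff, Set.mem_singleton_iff,
        Set.mem_empty_iff_false, iff_false, not_and]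
      rintro h1 rfl; exact h1 hy
    rw [this, measure_empty, mul_zero]
  · have : ν (Dᶜ ∩ {y}) = 0 := by
      refine measure_mono_null Set.inter_subset_right ?_
      simpa [hD] using hy
    rw [this, mul_zero]

theorem exists_measurable_injOn_of_countable [MeasurableSingletonClass X] {D : Set X}
    (hD : D.Countable) : ∃ g : X → ℕ, Measurable g ∧ Set.InjOn g D := by
  classical
  obtain ⟨e, he⟩ := Set.countable_iff_exists_injOn.1 hD
  have hfib : ∀ n, MeasurableSet {y | y ∈ D ∧ e y = n} := fun n =>
    (hD.mono fun y hy => hy.1).measurableSet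
  refine ⟨fun y => if y ∈ D then e y + 1 else 0, ?_, ?_⟩
  · refine measurable_to_countable' fun n => ?_
    cases n with
    | zero =>
      convert hD.measurableSet.compl using 1
      ext y; by_cases hy : y ∈ D <;> simp [hy]
    | succ n =>
      convert hfib n using 1
      ext y; by_cases hy : y ∈ D <;> simp [hy]
  · intro y hy z hz hyz
    simp only [hy, hz, if_true] at hyz
    exact he hy hz (by omega)

open Classical in
/-- If the contexts have only atoms then universal learning forces a sublinear number of distinct
contexts: at the first visit of a point its random label is unknown. -/
theorem UniversallyConsistent.ae_sublinearDistinct [MeasurableSingletonClass X]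
    [MeasurableSingletonClass A] (hX : ¬ AdmitsNonatomicProbability X) {a₀ a₁ : A} (ha : a₀ ≠ a₁)
    {f : LearningRule X A} {μ : ProbabilityMeasure (ℕ → X)}
    (h : UniversallyConsistent .oblivious f μ) :
    ∀ᵐ x ∂(μ : Measure (ℕ → X)), SublinearDistinct x := by
  have hD : ∀ t, ∃ D : Set X, D.Countable ∧ ∀ᵐ x ∂(μ : Measure (ℕ → X)), x t ∈ D := fun t => by
    have hm := (measurable_pi_apply (X := fun _ : ℕ => X) t).aemeasurable
      (μ := (μ : Measure (ℕ → X)))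
    have := Measure.isProbabilityMeasure_map hm
    obtain ⟨D, hD, hae⟩ := ae_mem_countable_of_not_admits hX
      ((μ : Measure (ℕ → X)).map fun x => x t)
    exact ⟨D, hD, ae_of_ae_map hm hae⟩
  choose D hDc hDae using hD
  obtain ⟨g, hg, hginj⟩ := exists_measurable_injOn_of_countable (Set.countable_iUnion hDc)
  let lab : Bool → A := fun b => if b then a₁ else a₀
  let w : ℕ → Bool → A → Reward := fun _ v a => if a = lab v then 1 else 0
  have hw : ∀ t v, Measurable (w t v) := fun t v =>
    Measurable.ite (measurableSet_singleton (lab v)) measurable_const measurable_const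
  have hρ := measurable_labelReward (X := X) (A := A) (ι := ℕ) hw (g := fun _ => g) fun _ => hg
  have hπ : Measurable fun p : (ℕ → Bool) × X => lab (p.1 (g p.2)) :=
    (measurable_of_countable lab).comp (measurable_label hg)
  filter_upwards [h.ae_eventually_integral_detRegret_le
    (τ := Measure.infinitePi fun _ : ℕ => fairCoin) (π := fun θ y => lab (θ (g y))) hρ hπ,
    ae_all_iff.2 hDae] with x hx hxD ε hε
  filter_upwards [hx (ε / 2) (by positivity)] with T hT
  have hinj : ∀ i j, g (x i) = g (x j) → x i = x j := fun i j hij =>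
    hginj (Set.mem_iUnion.2 ⟨i, hxD i⟩) (Set.mem_iUnion.2 ⟨j, hxD j⟩) hij
  set Q := (Measure.infinitePi fun _ : ℕ => fairCoin).prod f.seedLaw with hQ
  set ρ : (ℕ → Bool) → ℕ → A × X → Reward := fun θ => labelReward w (fun _ => g) θ with hρdef
  -- the times of the first visits
  let F := (Finset.range T).filter fun t => ∀ j < t, x j ≠ x t
  let loss : ℕ → (ℕ → Bool) × f.Seed → ℝ := fun t ω =>
    1 - (ρ ω.1 t (detAct f (ρ ω.1) ω.2 x t, x t) : ℝ)
  have hlossm : ∀ t, Measurable (loss t) := fun t => by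
    refine measurable_const.sub (Measurable.subtype_val ?_)
    exact (hρ t).comp (measurable_fst.prodMk
      (((measurable_detAct hρ t).comp (measurable_const.prodMk measurable_id)).prodMk
        measurable_const))
  have hloss0 : ∀ t ω, 0 ≤ loss t ω := fun t ω =>
    sub_nonneg.2 (Subtype.prop (ρ ω.1 t (detAct f (ρ ω.1) ω.2 x t, x t))).2
  have hlossb : ∀ t ω, |loss t ω| ≤ 1 := fun t ω => by
    rw [abs_of_nonneg (hloss0 t ω)]
    exact sub_le_self _ (Subtype.prop (ρ ω.1 t (detAct f (ρ ω.1) ω.2 x t, x t))).1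
  have hreg : ∀ ω : (ℕ → Bool) × f.Seed, ∑ t ∈ F, loss t ω ≤
      detRegret f (ρ ω.1) (fun y => lab (ω.1 (g y))) ω.2 x T := by
    intro ω
    refine (Finset.sum_le_sum_of_subset_of_nonneg (Finset.filter_subset _ _)
      fun t _ _ => hloss0 t ω).trans (le_of_eq ?_)
    refine Finset.sum_congr rfl fun t _ => ?_
    simp [loss, hρdef, labelReward, w]
  -- resampling the label of a new context leaves the action unchanged, so that the action is wrong
  -- with probability at least one half
  have hhalf : ∀ t ∈ F, 1 / 2 ≤ ∫ ω, loss t ω ∂Q := by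
    intro t ht
    have hfirst := (Finset.mem_filter.1 ht).2
    rw [hQ, ← integral_update_prod (fun _ : ℕ => fairCoin) f.seedLaw (g (x t)) (hlossm t)
      (hlossb t)]
    have hge : ∀ ω : (ℕ → Bool) × f.Seed, 1 / 2 ≤
        ∫ z, loss t (Function.update ω.1 (g (x t)) z, ω.2) ∂fairCoin := by
      intro ω
      have hact : ∀ z, detAct f (ρ (Function.update ω.1 (g (x t)) z)) ω.2 x t =
          detAct f (ρ ω.1) ω.2 x t := fun z =>
        detAct_labelReward_update f fun j hj hji => absurd (hinj j t hji) (hfirst j hj)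
      have hval : ∀ z, loss t (Function.update ω.1 (g (x t)) z, ω.2) =
          if detAct f (ρ ω.1) ω.2 x t = lab z then 0 else 1 := fun z => by
        simp only [loss, hact]
        simp only [hρdef, labelReward, w, Function.update_self]
        split_ifs <;> simp
      simp only [hval]
      rw [integral_fairCoin]
      by_cases h0 : detAct f (ρ ω.1) ω.2 x t = a₀
      · simp [lab, h0, ha]
      · simp only [lab, Bool.false_eq_true, if_false, if_true, h0]
        split_ifs <;> norm_num
    have hm : Measurable fun ω : (ℕ → Bool) × f.Seed =>
        ∫ z, loss t (Function.update ω.1 (g (x t)) z, ω.2) ∂fairCoin := by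
      simp only [integral_fairCoin]
      refine Measurable.div_const (Measurable.add ?_ ?_) _
      · exact (hlossm t).comp (((measurable_update_left).comp measurable_fst).prodMk measurable_snd)
      · exact (hlossm t).comp (((measurable_update_left).comp measurable_fst).prodMk measurable_snd)
    calc (1 / 2 : ℝ) = ∫ _, (1 / 2 : ℝ) ∂Q := by simp
      _ ≤ _ := integral_mono (integrable_const _) (integrable_of_abs_le hm (C := 1) fun ω => by
          rw [integral_fairCoin, abs_le]
          have h1 := abs_le.1 (hlossb t (Function.update ω.1 (g (x t)) true, ω.2))
          have h2 := abs_le.1 (hlossb t (Function.update ω.1 (g (x t)) false, ω.2))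
          constructor <;> linarith [h1.1, h1.2, h2.1, h2.2]) hge
  have hcard : ((Finset.range T).image x).card ≤ F.card := by
    refine (Finset.card_le_card fun y hy => ?_).trans (Finset.card_image_le (s := F) (f := x))
    obtain ⟨t, ht, rfl⟩ := Finset.mem_image.1 hy
    have hex : ∃ j, x j = x t := ⟨t, rfl⟩
    have hle : Nat.find hex ≤ t := Nat.find_min' hex rfl
    refine Finset.mem_image.2 ⟨Nat.find hex, ?_, Nat.find_spec hex⟩
    refine Finset.mem_filter.2 ⟨Finset.mem_range.2 (hle.trans_lt (Finset.mem_range.1 ht)), ?_⟩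
    intro j hj
    rw [Nat.find_spec hex]
    exact Nat.find_min hex hj
  have hregm : Measurable fun ω : (ℕ → Bool) × f.Seed =>
      detRegret f (ρ ω.1) (fun y => lab (ω.1 (g y))) ω.2 x T :=
    (measurable_detRegret hρ (π := fun θ y => lab (θ (g y))) hπ T).comp
      (measurable_const.prodMk measurable_id)
  have hlow : (F.card : ℝ) * (1 / 2) ≤
      ∫ ω, detRegret f (ρ ω.1) (fun y => lab (ω.1 (g y))) ω.2 x T ∂Q := by
    calc (F.card : ℝ) * (1 / 2) = ∑ t ∈ F, (1 / 2 : ℝ) := by simp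
      _ ≤ ∑ t ∈ F, ∫ ω, loss t ω ∂Q := Finset.sum_le_sum hhalf
      _ = ∫ ω, ∑ t ∈ F, loss t ω ∂Q :=
          (integral_finsetSum _ fun t _ => integrable_of_abs_le (hlossm t) (hlossb t)).symm
      _ ≤ _ := by
          refine integral_mono (integrable_finsetSum _ fun t _ =>
            integrable_of_abs_le (hlossm t) (hlossb t)) ?_ hreg
          refine integrable_of_abs_le hregm (C := T) fun ω => ?_
          refine (Finset.abs_sum_le_sum_abs _ _).trans ((Finset.sum_le_sum
            fun t _ => abs_reward_sub_le _ _).trans (by simp))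
  have hcard' : (((Finset.range T).image x).card : ℝ) ≤ F.card := by exact_mod_cast hcard
  linarith

end Atomic

/-! ### Infinitely many actions: learnable processes are in `classC1` -/

section InfiniteActions

/-- The uniform law on `{1, …, N + 1}`. -/
noncomputable def uniformLaw (N : ℕ) : Measure ℕ :=
  ((N + 1 : ℕ) : ENNReal)⁻¹ • ∑ z ∈ Finset.Icc 1 (N + 1), Measure.dirac z

instance (N : ℕ) : IsProbabilityMeasure (uniformLaw N) := by
  constructor
  simp only [uniformLaw, Measure.smul_apply, Measure.finsetSum_apply, measure_univ,
    Finset.sum_const, Nat.card_Icc, smul_eq_mul, nsmul_eq_mul, mul_one, add_tsub_cancel_right]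
  exact ENNReal.inv_mul_cancel (by simp) (by simp)

theorem integral_uniformLaw (N : ℕ) (h : ℕ → ℝ) :
    ∫ z, h z ∂(uniformLaw N) = (∑ z ∈ Finset.Icc 1 (N + 1), h z) / (N + 1 : ℕ) := by
  rw [uniformLaw, integral_smul_measure, integral_finsetSum_measure
    fun i _ => integrable_dirac (by simp)]
  simp only [integral_dirac, ENNReal.toReal_inv, ENNReal.toReal_natCast, smul_eq_mul]
  rw [inv_mul_eq_div]

variable {X : Type u} {A : Type v} [MeasurableSpace X] [MeasurableSpace A]

theorem exists_measure_le_of_antitone {α : Type*} [MeasurableSpace α] (m : Measure α)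
    [IsFiniteMeasure m] {C : ℕ → Set α} (hC : ∀ n, MeasurableSet (C n)) (hanti : Antitone C)
    (hempty : ⋂ n, C n = ∅) {ε : ENNReal} (hε : 0 < ε) : ∃ n, m (C n) ≤ ε := by
  have h := tendsto_measure_iInter_atTop (μ := m) (fun n => (hC n).nullMeasurableSet) hanti
    ⟨0, measure_ne_top _ _⟩
  rw [hempty, measure_empty] at h
  exact (h.eventually (ge_mem_nhds hε)).exists

/-- Number of steps before `T` with context in `B`, divided by `T`. -/
noncomputable def freq (B : Set X) (x : ℕ → X) (T : ℕ) : ENNReal :=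
  (∑ t ∈ Finset.range T, B.indicator (fun _ => (1 : ENNReal)) (x t)) / T

theorem measurable_freq {B : Set X} (hB : MeasurableSet B) (T : ℕ) :
    Measurable fun x => freq B x T :=
  (Finset.measurable_sum _ fun t _ =>
    (measurable_const.indicator hB).comp (measurable_pi_apply t)).div_const _

/-- Separation of scales: if the upper frequencies of `B k` do not vanish as `B k` decreases to `∅`,
then along a subsequence the visits to `B (k p)` before some time `τ p` have a frequency that is
bounded below, while `B (k (p + 1))` has not been visited by then. -/
theorem exists_scales (μ : ProbabilityMeasure (ℕ → X)) {B : ℕ → Set X}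
    (hB : ∀ k, MeasurableSet (B k)) (hanti : Antitone B) (hempty : ⋂ k, B k = ∅) :
    ∃ k τ : ℕ → ℕ, StrictMono k ∧ ∀ᵐ x ∂(μ : Measure (ℕ → X)), ∀ᶠ p in atTop,
      (0 < ⨅ i, upperFreq (B i) x →
        ∃ T, p ≤ T ∧ T ≤ τ p ∧ (⨅ i, upperFreq (B i) x) / 2 < freq (B (k p)) x T) ∧
      ∀ t < τ p, x t ∉ B (k (p + 1)) := by
  set F : (ℕ → X) → ENNReal := fun x => ⨅ i, upperFreq (B i) x with hF
  have hFm : Measurable F := Measurable.iInf fun i => measurable_upperFreq (hB i)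
  have hF1 : ∀ x, F x ≤ 1 := fun x => (iInf_le _ 0).trans (upperFreq_le_one _ _)
  have hpow : ∀ p : ℕ, (0 : ENNReal) < (2⁻¹) ^ p := fun p => ENNReal.pow_pos (by simp) p
  -- a frequency above half of the limit is reached within a bounded time, except on an event of
  -- small probability
  have hT : ∀ p k : ℕ, ∃ T', (μ : Measure (ℕ → X)) {x | 0 < F x ∧
      ∀ T, p ≤ T → T ≤ T' → freq (B k) x T ≤ F x / 2} ≤ 2⁻¹ ^ p := by
    intro p k
    refine exists_measure_le_of_antitone _ (C := fun T' => {x | 0 < F x ∧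
      ∀ T, p ≤ T → T ≤ T' → freq (B k) x T ≤ F x / 2}) (fun T' => ?_) (fun a b hab x hx =>
      ⟨hx.1, fun T h1 h2 => hx.2 T h1 (h2.trans hab)⟩) ?_ (hpow p)
    · have : {x | 0 < F x ∧ ∀ T, p ≤ T → T ≤ T' → freq (B k) x T ≤ F x / 2} =
          {x | 0 < F x} ∩ ⋂ T ∈ Finset.Icc p T', {x | freq (B k) x T ≤ F x / 2} := by
        ext x; simp
      rw [this]
      exact (measurableSet_lt measurable_const hFm).inter
        (Finset.measurableSet_biInter _ fun T _ =>
          measurableSet_le (measurable_freq (hB k) T) (hFm.div_const _))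
    · ext x
      simp only [Set.mem_iInter, Set.mem_ofPred_eq, Set.mem_empty_iff_false, iff_false]
      intro hx
      have hpos := (hx 0).1
      have h1 : F x / 2 < upperFreq (B k) x :=
        (ENNReal.half_lt_self hpos.ne' (ne_top_of_le_ne_top ENNReal.one_ne_top (hF1 x))).trans_le
          (iInf_le _ k)
      have h2 : ∃ᶠ T in atTop, F x / 2 < freq (B k) x T := frequently_lt_of_lt_limsup (h := h1)
      obtain ⟨T, hT1, hT2⟩ := (frequently_atTop.1 h2) p
      exact absurd ((hx T).2 T hT1 le_rfl) (not_le.2 hT2)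
  -- sets far down the sequence are unlikely to be visited before a given time
  have hK : ∀ T' p : ℕ, ∃ k, (μ : Measure (ℕ → X)) {x | ∃ t < T', x t ∈ B k} ≤ 2⁻¹ ^ p := by
    intro T' p
    refine exists_measure_le_of_antitone _ (fun k => ?_) (fun a b hab x hx => ?_) ?_ (hpow p)
    · have : {x : ℕ → X | ∃ t < T', x t ∈ B k} = ⋃ t ∈ Finset.range T', {x | x t ∈ B k} := by
        ext x; simp
      exact this ▸ Finset.measurableSet_biUnion _ fun t _ => measurable_pi_apply t (hB k)
    · obtain ⟨t, ht, h⟩ := hx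
      exact ⟨t, ht, hanti hab h⟩
    · ext x
      simp only [Set.mem_iInter, Set.mem_ofPred_eq, Set.mem_empty_iff_false, iff_false]
      intro hx
      have hev : ∀ t, ∃ k, x t ∉ B k := fun t => by
        by_contra! hall
        have : x t ∈ ⋂ k, B k := Set.mem_iInter.2 hall
        rw [hempty] at this
        exact this
      choose κ hκ using hev
      obtain ⟨t, ht, h⟩ := hx ((Finset.range T').sup κ)
      exact hκ t (hanti (Finset.le_sup (f := κ) (Finset.mem_range.2 ht)) h)
  choose Tf hTf using hT
  choose Kf hKf using hK
  -- choose the times and the sets alternately; the exceptional events are summable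
  let k : ℕ → ℕ := fun p => Nat.rec 0 (fun p kp => max (kp + 1) (Kf (Tf p kp) p)) p
  have hk : ∀ p, k (p + 1) = max (k p + 1) (Kf (Tf p (k p)) p) := fun p => rfl
  refine ⟨k, fun p => Tf p (k p), strictMono_nat_of_lt_succ fun p => ?_, ?_⟩
  · rw [hk]; exact lt_of_lt_of_le (Nat.lt_succ_self _) (le_max_left _ _)
  have hsum : ∑' p : ℕ, (2⁻¹ : ENNReal) ^ p ≠ ⊤ := by
    rw [ENNReal.tsum_geometric]; simp
  have h1 := ae_eventually_notMem (μ := (μ : Measure (ℕ → X))) (s := fun p => {x | 0 < F x ∧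
      ∀ T, p ≤ T → T ≤ Tf p (k p) → freq (B (k p)) x T ≤ F x / 2})
    (ne_top_of_le_ne_top hsum (ENNReal.tsum_le_tsum fun p => hTf p (k p)))
  have h2 := ae_eventually_notMem (μ := (μ : Measure (ℕ → X)))
    (s := fun p => {x | ∃ t < Tf p (k p), x t ∈ B (k (p + 1))})
    (ne_top_of_le_ne_top hsum (ENNReal.tsum_le_tsum fun p => by
      refine (measure_mono ?_).trans (hKf (Tf p (k p)) p)
      rintro x ⟨t, ht, h⟩
      exact ⟨t, ht, hanti (by rw [hk]; exact le_max_right _ _) h⟩))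
  filter_upwards [h1, h2] with x hx1 hx2
  filter_upwards [hx1, hx2] with p hp1 hp2
  refine ⟨fun hpos => ?_, fun t ht h => hp2 ⟨t, ht, h⟩⟩
  by_contra! hcon
  exact hp1 ⟨hpos, hcon⟩

variable {f : LearningRule X A}

/-- Finding a label that is uniform on `{1, …, N + 1}` takes time of order `N`. The label `v` makes
`e v` the only rewarded action; the label `0`, of probability zero, stands for no reward at all. -/
theorem le_integral_detRegret_of_hidden_label [MeasurableSingletonClass A] [Countable A]
    {e : ℕ → A} (he : Function.Injective e) {g : X → ℕ} (hg : Measurable g) (N : ℕ → ℕ) (x : ℕ → X)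
    (p T : ℕ) {w : ℕ → ℕ → A → Reward}
    (hw : ∀ t v a, (w t v a : ℝ) = open Classical in if v ≠ 0 ∧ a = e v then 1 else 0) :
    ((∑ t ∈ Finset.range T, {y | g y = p}.indicator (fun _ => (1 : ℝ)) (x t)) *
        (1 - T / (N p + 1 : ℕ)) : ℝ) ≤
      ∫ ω, detRegret f (labelReward w (fun _ => g) ω.1) (fun y => e (ω.1 (g y))) ω.2 x T
        ∂((Measure.infinitePi fun p => uniformLaw (N p)).prod f.seedLaw) := by
  classical
  have hw' : ∀ t v a, w t v a = if v ≠ 0 ∧ a = e v then 1 else 0 := fun t v a => by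
    apply Subtype.ext
    rw [hw]
    split_ifs <;> simp
  have hwm : ∀ t v, Measurable (w t v) := fun t v => measurable_of_countable _
  have hρ := measurable_labelReward (X := X) (A := A) (ι := ℕ) hwm (g := fun _ => g) fun _ => hg
  have hπ : Measurable fun p : (ℕ → ℕ) × X => e (p.1 (g p.2)) :=
    (measurable_of_countable e).comp (measurable_label hg)
  set Q := (Measure.infinitePi fun p => uniformLaw (N p)).prod f.seedLaw with hQ
  set ρ : (ℕ → ℕ) → ℕ → A × X → Reward := fun θ => labelReward w (fun _ => g) θ with hρdef
  set m : ℝ := ∑ t ∈ Finset.range T, {y | g y = p}.indicator (fun _ => (1 : ℝ)) (x t) with hm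
  have hm0 : 0 ≤ m := Finset.sum_nonneg fun t _ => Set.indicator_nonneg (fun _ _ => zero_le_one) _
  -- the actions of the rule when the label of the group `p` is replaced by `0`
  let act : ℕ → (ℕ → ℕ) × f.Seed → A := fun t ω =>
    detAct f (ρ (Function.update ω.1 p 0)) ω.2 x t
  have hactm : ∀ t, Measurable (act t) := fun t =>
    (measurable_detAct (f := f) hρ t).comp (measurable_const.prodMk
      ((measurable_update_left.comp measurable_fst).prodMk measurable_snd))
  -- unless `hit` occurs, the replacement goes unnoticed; since `act` does not depend on the label `ω.1 p`,
  -- each of the `T` actions hits it with probability at most `1 / (N p + 1)`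
  let hit : (ℕ → ℕ) × f.Seed → Prop := fun ω => ω.1 p = 0 ∨ ∃ t < T, act t ω = e (ω.1 p)
  have hhit : MeasurableSet {ω | hit ω} := by
    have hp : Measurable fun ω : (ℕ → ℕ) × f.Seed => ω.1 p :=
      (measurable_pi_apply p).comp measurable_fst
    have : {ω : (ℕ → ℕ) × f.Seed | hit ω} = {ω | ω.1 p = 0} ∪
        ⋃ t ∈ Finset.range T, {ω | act t ω = e (ω.1 p)} := by ext ω; simp [hit]
    rw [this]
    exact (hp (measurableSet_singleton 0)).union (Finset.measurableSet_biUnion _ fun t _ =>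
      measurableSet_preimage ((hactm t).prodMk ((measurable_of_countable e).comp hp))
        (Set.to_countable (Set.diagonal A)).measurableSet)
  let ind : (ℕ → ℕ) × f.Seed → ℝ := fun ω => if hit ω then 1 else 0
  have hindm : Measurable ind := Measurable.ite hhit measurable_const measurable_const
  have hindb : ∀ ω, |ind ω| ≤ 1 := fun ω => by
    by_cases h : hit ω <;> simp [ind, h]
  have hindint : ∫ ω, ind ω ∂Q ≤ T / (N p + 1 : ℕ) := by
    rw [hQ, ← integral_update_prod (fun p => uniformLaw (N p)) f.seedLaw p hindm hindb]
    have hle : ∀ ω : (ℕ → ℕ) × f.Seed,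
        ∫ z, ind (Function.update ω.1 p z, ω.2) ∂(uniformLaw (N p)) ≤ T / (N p + 1 : ℕ) := by
      intro ω
      rw [integral_uniformLaw]
      refine div_le_div_of_nonneg_right ?_ (Nat.cast_nonneg _)
      have hval : ∀ z ∈ Finset.Icc 1 (N p + 1), ind (Function.update ω.1 p z, ω.2) ≤
          ∑ t ∈ Finset.range T, if act t ω = e z then (1 : ℝ) else 0 := by
        intro z hz
        have hz0 : z ≠ 0 := by have := (Finset.mem_Icc.1 hz).1; omega
        by_cases h : hit (Function.update ω.1 p z, ω.2)
        · have h' := h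
          simp only [hit, act, Function.update_self, Function.update_idem, hz0, false_or] at h'
          obtain ⟨t, ht, hact⟩ := h'
          simp only [ind, h, if_true]
          refine le_trans (le_of_eq ?_) (Finset.single_le_sum
            (f := fun t => if act t ω = e z then (1 : ℝ) else 0)
            (fun _ _ => by split_ifs <;> norm_num) (Finset.mem_range.2 ht))
          rw [if_pos]
          exact hact
        · simp only [ind, h, if_false]
          exact Finset.sum_nonneg fun _ _ => by split_ifs <;> norm_num
      refine (Finset.sum_le_sum hval).trans ?_
      rw [Finset.sum_comm]
      calc _ ≤ ∑ t ∈ Finset.range T, (1 : ℝ) := Finset.sum_le_sum fun t _ => by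
            by_cases hz : ∃ z ∈ Finset.Icc 1 (N p + 1), act t ω = e z
            · obtain ⟨z, hz, h⟩ := hz
              rw [Finset.sum_eq_single z (fun z' _ hne => if_neg fun h' =>
                hne (he (h'.symm.trans h))) (fun h' => absurd hz h')]
              split_ifs; norm_num
            · refine le_trans (le_of_eq (Finset.sum_eq_zero fun z hz' => if_neg fun h =>
                hz ⟨z, hz', h⟩)) zero_le_one
        _ = T := by simp
    have hmz : Measurable fun ω : (ℕ → ℕ) × f.Seed =>
        ∫ z, ind (Function.update ω.1 p z, ω.2) ∂(uniformLaw (N p)) := by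
      simp only [integral_uniformLaw]
      exact (Finset.measurable_sum _ fun z _ => hindm.comp
        ((measurable_update_left.comp measurable_fst).prodMk measurable_snd)).div_const _
    have hnn : ∀ ω : (ℕ → ℕ) × f.Seed,
        0 ≤ ∫ z, ind (Function.update ω.1 p z, ω.2) ∂(uniformLaw (N p)) := fun ω =>
      integral_nonneg fun z => by simp only [ind]; split_ifs <;> norm_num
    calc _ ≤ ∫ _, (T / (N p + 1 : ℕ) : ℝ) ∂((Measure.infinitePi fun p => uniformLaw (N p)).prod
          f.seedLaw) := integral_mono (integrable_of_abs_le hmz fun ω => by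
            rw [abs_of_nonneg (hnn ω)]; exact hle ω) (integrable_const _) hle
      _ = _ := by simp
  have hpoint : ∀ ω, m * (1 - ind ω) ≤
      detRegret f (ρ ω.1) (fun y => e (ω.1 (g y))) ω.2 x T := by
    intro ω
    have hterm : ∀ t, 0 ≤ ((ρ ω.1 t (e (ω.1 (g (x t))), x t) : ℝ) -
        ρ ω.1 t (detAct f (ρ ω.1) ω.2 x t, x t)) := by
      intro t
      simp only [hρdef, labelReward, hw]
      by_cases h0 : ω.1 (g (x t)) = 0
      · simp [h0]
      · simp only [h0, ne_eq, not_false_eq_true, true_and, if_true]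
        split_ifs <;> norm_num
    by_cases h : hit ω
    · simp only [ind, h, if_true, sub_self, mul_zero]
      exact Finset.sum_nonneg fun t _ => hterm t
    · simp only [ind, h, if_false, sub_zero, mul_one]
      simp only [hit, not_or, not_exists, not_and] at h
      have hact : ∀ t < T, detAct f (ρ ω.1) ω.2 x t = act t ω := by
        intro t
        induction t using Nat.strong_induction_on with
        | _ t ih =>
          intro ht
          refine (detAct_labelReward_update f fun j hj _ => ?_).symm
          have h1 : detAct f (labelReward w (fun _ => g) ω.1) ω.2 x j ≠ e (ω.1 p) := by
            rw [ih j hj (hj.trans ht)]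
            exact h.2 j (hj.trans ht)
          rw [hw', hw', if_neg (fun h' => h1 h'.2), if_neg (fun h' => h'.1 rfl)]
      refine Finset.sum_le_sum fun t ht => ?_
      by_cases hgt : g (x t) = p
      · rw [Set.indicator_of_mem (show x t ∈ {y | g y = p} from hgt)]
        have h1 := h.2 t (Finset.mem_range.1 ht)
        rw [← hact t (Finset.mem_range.1 ht)] at h1
        simp only [hρdef, labelReward, hw, hgt] at h1 ⊢
        rw [if_pos ⟨h.1, trivial⟩, if_neg (fun h' => h1 h'.2)]
        norm_num
      · rw [Set.indicator_of_notMem (show x t ∉ {y | g y = p} from hgt)]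
        exact hterm t
  have hregm : Measurable fun ω : (ℕ → ℕ) × f.Seed =>
      detRegret f (ρ ω.1) (fun y => e (ω.1 (g y))) ω.2 x T :=
    (measurable_detRegret hρ (π := fun θ y => e (θ (g y))) hπ T).comp
      (measurable_const.prodMk measurable_id)
  have hint : Integrable ind Q := integrable_of_abs_le hindm hindb
  calc m * (1 - T / (N p + 1 : ℕ)) ≤ m * (1 - ∫ ω, ind ω ∂Q) := by gcongr
    _ = ∫ ω, m * (1 - ind ω) ∂Q := by
        rw [integral_const_mul, integral_sub (integrable_const _) hint]; simp
    _ ≤ _ := integral_mono (((integrable_const _).sub hint).const_mul _)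
        (integrable_of_abs_le hregm (C := T) fun ω => (Finset.abs_sum_le_sum_abs _ _).trans
          ((Finset.sum_le_sum fun t _ => abs_reward_sub_le _ _).trans (by simp))) hpoint

/-- With infinitely many actions, learnable processes belong to `classC1`. -/
theorem UniversallyConsistent.mem_classC1 [MeasurableSingletonClass A] [Countable A] [Infinite A]
    {μ : ProbabilityMeasure (ℕ → X)} (h : UniversallyConsistent .oblivious f μ) :
    μ ∈ classC1 X := by
  classical
  intro B hB hanti hempty
  obtain ⟨k, τ, hk, hscale⟩ := exists_scales μ hB hanti hempty
  have hex : ∀ y : X, ∃ q, y ∉ B (k (q + 1)) := fun y => by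
    by_contra! hall
    have : y ∈ ⋂ k, B k := Set.mem_iInter.2 fun i =>
      hanti ((Nat.le_succ i).trans (hk.id_le (i + 1))) (hall i)
    rw [hempty] at this
    exact this
  -- the points of `B (k p)` that are visited before `τ p` typically belong to the group `p`
  let g : X → ℕ := fun y => Nat.find (hex y)
  have hg : Measurable g := measurable_find hex fun q => (hB (k (q + 1))).compl
  have hgp : ∀ p y, y ∈ B (k p) → y ∉ B (k (p + 1)) → g y = p := fun p y h1 h2 => by
    refine (Nat.find_eq_iff (hex y)).2 ⟨h2, fun q hq h3 => h3 ?_⟩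
    exact hanti (hk.monotone (by omega : q + 1 ≤ p)) h1
  let e : ℕ → A := Infinite.natEmbedding A
  have he : Function.Injective e := (Infinite.natEmbedding A).injective
  let w : ℕ → ℕ → A → Reward := fun _ v a => if v ≠ 0 ∧ a = e v then 1 else 0
  have hw : ∀ t v a, (w t v a : ℝ) = if v ≠ 0 ∧ a = e v then 1 else 0 := fun t v a => by
    simp only [w]; split_ifs <;> simp
  have hρ := measurable_labelReward (X := X) (A := A) (ι := ℕ) (w := w)
    (fun t v => measurable_of_countable _) (g := fun _ => g) fun _ => hg
  have hπ : Measurable fun p : (ℕ → ℕ) × X => e (p.1 (g p.2)) :=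
    (measurable_of_countable e).comp (measurable_label hg)
  have hzero : ∀ᵐ x ∂(μ : Measure (ℕ → X)), ⨅ i, upperFreq (B i) x = 0 := by
    filter_upwards [hscale, h.ae_eventually_integral_detRegret_le
      -- with `2 * τ p + 1` candidates the label of group `p` is found before `τ p` with probability
      -- at most one half
      (τ := Measure.infinitePi fun p => uniformLaw (2 * τ p))
      (π := fun θ y => e (θ (g y))) hρ hπ] with x hx1 hx2
    by_contra hne
    set F := ⨅ i, upperFreq (B i) x with hF
    have hpos : 0 < F := pos_iff_ne_zero.2 hne
    have htop : F ≠ ⊤ := ne_top_of_le_ne_top ENNReal.one_ne_top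
      ((iInf_le _ 0).trans (upperFreq_le_one _ _))
    have hη : 0 < (F / 2).toReal := ENNReal.toReal_pos (ENNReal.half_pos hne).ne'
      (ENNReal.div_ne_top htop (by simp))
    set η := (F / 2).toReal with hηdef
    obtain ⟨T₀, hT₀⟩ := eventually_atTop.1 (hx2 (η / 4) (by positivity))
    obtain ⟨p, hp1, hp2⟩ := (hx1.and (eventually_ge_atTop (max T₀ 1))).exists
    obtain ⟨T, hT1, hT2, hT3⟩ := hp1.1 hpos
    have hT : 1 ≤ T := (le_max_right _ _).trans (hp2.trans hT1)
    have hup := hT₀ T ((le_max_left _ _).trans (hp2.trans hT1))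
    have hlow := le_integral_detRegret_of_hidden_label (f := f) he hg (fun p => 2 * τ p) x p T hw
    have hT0 : (0 : ℝ) < T := by exact_mod_cast hT
    have hcount : η * T ≤
        ∑ t ∈ Finset.range T, {y | g y = p}.indicator (fun _ => (1 : ℝ)) (x t) := by
      have hsub : ∑ t ∈ Finset.range T, (B (k p)).indicator (fun _ => (1 : ENNReal)) (x t) ≤
          ENNReal.ofReal
            (∑ t ∈ Finset.range T, {y | g y = p}.indicator (fun _ => (1 : ℝ)) (x t)) := by
        rw [ENNReal.ofReal_sum_of_nonneg fun t _ => Set.indicator_nonneg (fun _ _ => zero_le_one) _]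
        refine Finset.sum_le_sum fun t ht => ?_
        by_cases hxt : x t ∈ B (k p)
        · have := hgp p (x t) hxt (hp1.2 t ((Finset.mem_range.1 ht).trans_le hT2))
          rw [Set.indicator_of_mem hxt, Set.indicator_of_mem (show x t ∈ {y | g y = p} from this)]
          simp
        · rw [Set.indicator_of_notMem hxt]; exact zero_le
      rw [freq, ENNReal.lt_div_iff_mul_lt (Or.inl (by simp; omega)) (Or.inl (by simp))] at hT3
      have h3 := hT3.le.trans hsub
      rw [← ENNReal.ofReal_toReal (ENNReal.div_ne_top htop (by simp) : F / 2 ≠ ⊤), ← hηdef,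
        ← ENNReal.ofReal_natCast, ← ENNReal.ofReal_mul hη.le] at h3
      exact (ENNReal.ofReal_le_ofReal_iff (Finset.sum_nonneg fun t _ =>
        Set.indicator_nonneg (fun _ _ => zero_le_one) _)).1 h3
    have hfrac : (T : ℝ) / ((2 * τ p + 1 : ℕ) : ℝ) ≤ 1 / 2 := by
      have : (T : ℝ) ≤ τ p := by exact_mod_cast hT2
      rw [div_le_div_iff₀ (by positivity) (by norm_num)]
      push_cast
      linarith
    have h4 : η * T * (1 / 2) ≤
        (∑ t ∈ Finset.range T, {y | g y = p}.indicator (fun _ => (1 : ℝ)) (x t)) *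
        (1 - T / (2 * τ p + 1 : ℕ)) :=
      mul_le_mul hcount (by linarith) (by norm_num) ((by positivity : 0 ≤ η * T).trans hcount)
    have := mul_pos hη hT0
    linarith [h4.trans (hlow.trans hup)]
  have hanti' : Antitone fun i x => upperFreq (B i) x := fun i j hij x =>
    upperFreq_mono (hanti hij) x
  have hlim : Tendsto (fun i => ∫⁻ x, upperFreq (B i) x ∂(μ : Measure (ℕ → X))) atTop
      (𝓝 (⨅ i, ∫⁻ x, upperFreq (B i) x ∂(μ : Measure (ℕ → X)))) :=
    tendsto_atTop_iInf fun i j hij => lintegral_mono fun x => hanti' hij x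
  rw [← lintegral_iInf (fun i => measurable_upperFreq (hB i)) hanti', lintegral_congr_ae hzero,
    lintegral_zero] at hlim
  · exact hlim
  · refine ne_top_of_le_ne_top (b := 1) ENNReal.one_ne_top
      ((lintegral_mono fun x => upperFreq_le_one _ x).trans (by simp))

end InfiniteActions

/-! ### Processes that cycle through a few points in blocks of factorial length -/

section Blocks

/-- The number `j ≥ 1` of the block `[j!, (j + 1)!)` that contains `t ≥ 1`; as `t = 0` lies in no
block, `blockIndex 0 = 0`. -/
def blockIndex (t : ℕ) : ℕ := Nat.findGreatest (fun j => j.factorial ≤ t) t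

theorem blockIndex_eq {j t : ℕ} (h1 : j.factorial ≤ t) (h2 : t < (j + 1).factorial) :
    blockIndex t = j :=
  Nat.findGreatest_eq_iff.2 ⟨(Nat.self_le_factorial j).trans h1, fun _ => h1, fun _ hn _ =>
    not_le.2 (h2.trans_le (Nat.factorial_le hn))⟩

theorem blockIndex_ne_zero {t : ℕ} (ht : t ≠ 0) : blockIndex t ≠ 0 :=
  (Nat.findGreatest_pos.2 ⟨1, one_pos, Nat.one_le_iff_ne_zero.2 ht, by
    simpa using Nat.one_le_iff_ne_zero.2 ht⟩).ne'

theorem factorial_blockIndex_le {t : ℕ} (ht : t ≠ 0) : (blockIndex t).factorial ≤ t :=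
  (Nat.findGreatest_eq_iff.1 rfl).2.1 (blockIndex_ne_zero ht)

theorem lt_factorial_blockIndex_succ (t : ℕ) : t < (blockIndex t + 1).factorial := by
  by_contra! h
  exact Nat.findGreatest_is_greatest (P := fun j => j.factorial ≤ t)
    (Nat.lt_succ_self (blockIndex t)) ((Nat.self_le_factorial _).trans h) h

theorem le_blockIndex {j t : ℕ} (h : j.factorial ≤ t) : j ≤ blockIndex t :=
  Nat.le_findGreatest ((Nat.self_le_factorial j).trans h) h

theorem tendsto_blockIndex : Tendsto blockIndex atTop atTop :=
  tendsto_atTop.2 fun j => (eventually_ge_atTop j.factorial).mono fun _ h => le_blockIndex h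

theorem two_mul_factorial_le {j : ℕ} (hj : j ≠ 0) : 2 * j.factorial ≤ (j + 1).factorial := by
  rw [Nat.factorial_succ]
  exact Nat.mul_le_mul_right _ (by omega)

theorem blockIndex_add {j s : ℕ} (hj : j ≠ 0) (hs : s < j.factorial) :
    blockIndex (j.factorial + s) = j :=
  blockIndex_eq (Nat.le_add_right _ _) (by have := two_mul_factorial_le hj; omega)

theorem blockIndex_of_lt {j t : ℕ} (hj : 2 ≤ j) (h1 : 2 * (j - 1).factorial ≤ t)
    (h2 : t < j.factorial) : blockIndex t = j - 1 :=
  blockIndex_eq (by omega) (by rwa [Nat.sub_add_cancel (by omega)])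

theorem factorial_pred_eq {j : ℕ} (hj : j ≠ 0) : ((j - 1).factorial : ℝ) = j.factorial / j := by
  have h : (j : ℝ) ≠ 0 := Nat.cast_ne_zero.2 hj
  rw [eq_div_iff h, mul_comm]
  exact_mod_cast Nat.mul_factorial_pred hj

variable {X : Type u}

/-- In the initial part `[j!, 2 * j!)` of block `j`, the process cycles `p` times through `j! / p`
points of the sequence `y`, where `c j = (y, p)`; otherwise it stays at `x₀`. -/
def blockProcess (x₀ : X) (c : ℕ → (ℕ → X) × ℕ) (t : ℕ) : X :=
  if t < 2 * (blockIndex t).factorial then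
    (c (blockIndex t)).1 ((t - (blockIndex t).factorial) %
      ((blockIndex t).factorial / (c (blockIndex t)).2))
  else x₀

theorem blockProcess_add (x₀ : X) (c : ℕ → (ℕ → X) × ℕ) {j s : ℕ} (hj : j ≠ 0)
    (hs : s < j.factorial) : blockProcess x₀ c (j.factorial + s) =
      (c j).1 (s % (j.factorial / (c j).2)) := by
  rw [blockProcess, blockIndex_add hj hs, if_pos (by omega), Nat.add_sub_cancel_left]

theorem blockProcess_of_lt (x₀ : X) (c : ℕ → (ℕ → X) × ℕ) {j t : ℕ} (hj : 2 ≤ j)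
    (h1 : 2 * (j - 1).factorial ≤ t) (h2 : t < j.factorial) : blockProcess x₀ c t = x₀ := by
  rw [blockProcess, blockIndex_of_lt hj h1 h2, if_neg (by omega)]

theorem blockProcess_of_ge (x₀ : X) (c : ℕ → (ℕ → X) × ℕ) {j t : ℕ}
    (h1 : 2 * j.factorial ≤ t) (h2 : t < (j + 1).factorial) : blockProcess x₀ c t = x₀ := by
  rw [blockProcess, blockIndex_eq (by omega) h2, if_neg (by omega)]

theorem blockProcess_congr (x₀ : X) {c c' : ℕ → (ℕ → X) × ℕ} {j t : ℕ} (h : ∀ i ≤ j, c i = c' i)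
    (ht : t < (j + 1).factorial) : blockProcess x₀ c t = blockProcess x₀ c' t := by
  have : blockIndex t ≤ j := by
    by_contra! hlt
    rcases eq_or_ne t 0 with rfl | h0
    · simp [blockIndex] at hlt
    · exact absurd ((Nat.factorial_le hlt).trans (factorial_blockIndex_le h0)) (not_le.2 ht)
  rw [blockProcess, blockProcess, h _ this]

open Classical in
/-- If the number of cycles per block tends to infinity then few distinct points are visited. -/
theorem sublinearDistinct_blockProcess (x₀ : X) {c : ℕ → (ℕ → X) × ℕ}
    (h1 : ∀ᶠ j in atTop, (c j).2 ≤ j) (h2 : Tendsto (fun j => (c j).2) atTop atTop) :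
    SublinearDistinct (blockProcess x₀ c) := by
  intro ε hε
  obtain ⟨N, hN⟩ := exists_nat_gt (4 / ε)
  have hN0 : (0 : ℝ) < N := lt_of_le_of_lt (by positivity) hN
  have hNε : 4 / N < ε := by rw [div_lt_iff₀ hN0]; rwa [div_lt_iff₀ hε, mul_comm] at hN
  filter_upwards [tendsto_blockIndex.eventually ((h1.and (h2.eventually_ge_atTop N)).and
    (eventually_ge_atTop (max N 2))), eventually_ge_atTop 1] with T hT hT1
  have hT0 : T ≠ 0 := by omega
  set j := blockIndex T with hj
  obtain ⟨⟨hpj, hNp⟩, hjN⟩ := hT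
  have hj2 : 2 ≤ j := (le_max_right _ _).trans hjN
  set p := (c j).2 with hp
  have hNpos : 0 < N := by exact_mod_cast hN0
  have hp0 : 0 < p := hNpos.trans_le hNp
  have hjT : j.factorial ≤ T := factorial_blockIndex_le hT0
  have hn0 : 0 < j.factorial / p := Nat.div_pos (hpj.trans (Nat.self_le_factorial j)) hp0
  -- new points come from the blocks before `j`, which are short, and from the points of block `j`
  have hsub : (Finset.range T).image (blockProcess x₀ c) ⊆
      (Finset.range (2 * (j - 1).factorial)).image (blockProcess x₀ c) ∪
        insert x₀ ((Finset.range (j.factorial / p)).image (c j).1) := by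
    intro y hy
    obtain ⟨t, ht, rfl⟩ := Finset.mem_image.1 hy
    have htT := Finset.mem_range.1 ht
    rw [Finset.mem_union, Finset.mem_insert]
    by_cases ha : t < 2 * (j - 1).factorial
    · exact Or.inl (Finset.mem_image_of_mem _ (Finset.mem_range.2 ha))
    by_cases hb : t < j.factorial
    · exact Or.inr (Or.inl (blockProcess_of_lt x₀ c hj2 (by omega) hb))
    by_cases hc : t < 2 * j.factorial
    · obtain ⟨s, rfl⟩ := Nat.exists_eq_add_of_le (not_lt.1 hb)
      rw [blockProcess_add x₀ c (by omega) (by omega)]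
      exact Or.inr (Or.inr (Finset.mem_image_of_mem _ (Finset.mem_range.2 (Nat.mod_lt _ hn0))))
    · exact Or.inr (Or.inl (blockProcess_of_ge x₀ c (not_lt.1 hc)
        (htT.trans (lt_factorial_blockIndex_succ T))))
  have hcard : ((Finset.range T).image (blockProcess x₀ c)).card ≤
      2 * (j - 1).factorial + (j.factorial / p + 1) := by
    refine (Finset.card_le_card hsub).trans ((Finset.card_union_le _ _).trans (add_le_add ?_ ?_))
    · exact Finset.card_image_le.trans (by simp)
    · exact (Finset.card_insert_le _ _).trans
        (Nat.add_le_add_right (Finset.card_image_le.trans (by simp)) 1)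
  have hfac : (0 : ℝ) < j.factorial := by exact_mod_cast j.factorial_pos
  have hj0 : (0 : ℝ) < j := by exact_mod_cast (by omega : 0 < j)
  have hNj : (N : ℝ) ≤ j := by exact_mod_cast (le_max_left _ _).trans hjN
  calc (((Finset.range T).image (blockProcess x₀ c)).card : ℝ)
      ≤ 2 * (j - 1).factorial + ((j.factorial / p : ℕ) + 1) := by exact_mod_cast hcard
    _ ≤ 2 * (j.factorial / N) + (j.factorial / N + j.factorial / N) := by
        have e1 : ((j - 1).factorial : ℝ) ≤ j.factorial / N := by
          rw [factorial_pred_eq (by omega)]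
          gcongr
        have e2 : ((j.factorial / p : ℕ) : ℝ) ≤ j.factorial / N :=
          Nat.cast_div_le.trans (by gcongr)
        have e3 : (1 : ℝ) ≤ j.factorial / N := by
          rw [le_div_iff₀ hN0, one_mul]
          exact hNj.trans (by exact_mod_cast Nat.self_le_factorial j)
        gcongr
    _ = 4 / N * j.factorial := by ring
    _ ≤ ε * T := by
        gcongr

/-- The block data `c`, with `e` in place of all entries from `J` on. -/
def extendBlocks (c : ℕ → (ℕ → X) × ℕ) (J : ℕ) (e : (ℕ → X) × ℕ) (j : ℕ) : (ℕ → X) × ℕ :=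
  if j < J then c j else e

theorem measurable_blockProcess_extendBlocks [MeasurableSpace X] (x₀ : X)
    (c : ℕ → (ℕ → X) × ℕ) (J p : ℕ) :
    Measurable fun ξ : ℕ → X => blockProcess x₀ (extendBlocks c J (ξ, p)) := by
  refine measurable_pi_lambda _ fun t => ?_
  unfold blockProcess extendBlocks
  by_cases h : t < 2 * (blockIndex t).factorial
  · by_cases h' : blockIndex t < J
    · simp only [h, h', if_true]
      exact measurable_const
    · simp only [h, h', if_true, if_false]
      exact measurable_pi_apply _
  · simp only [h, if_false]
    exact measurable_const

/-- A sum over `L` steps of a nonnegative sequence of period `n` runs through at most `L / n + 1`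
periods. -/
theorem sum_range_mod_le {n : ℕ} (hn : 0 < n) {φ : ℕ → ℝ} (hφ : ∀ i, 0 ≤ φ i) (L : ℕ) :
    ∑ s ∈ Finset.range L, φ (s % n) ≤ (L + n) / n * ∑ i ∈ Finset.range n, φ i := by
  have hmul : ∀ m, ∑ s ∈ Finset.range (n * m), φ (s % n) = m * ∑ i ∈ Finset.range n, φ i := by
    intro m
    induction m with
    | zero => simp
    | succ m ih =>
      rw [Nat.mul_succ, Finset.sum_range_add, ih]
      have : ∑ i ∈ Finset.range n, φ ((n * m + i) % n) = ∑ i ∈ Finset.range n, φ i :=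
        Finset.sum_congr rfl fun i hi => by
          rw [Nat.mul_add_mod, Nat.mod_eq_of_lt (Finset.mem_range.1 hi)]
      rw [this]
      push_cast
      ring
  have hsum : 0 ≤ ∑ i ∈ Finset.range n, φ i := Finset.sum_nonneg fun i _ => hφ i
  have hn' : (0 : ℝ) < n := by exact_mod_cast hn
  calc ∑ s ∈ Finset.range L, φ (s % n) ≤ ∑ s ∈ Finset.range (n * (L / n + 1)), φ (s % n) :=
        Finset.sum_le_sum_of_subset_of_nonneg
          (Finset.range_mono (Nat.lt_mul_div_succ L hn).le) fun _ _ _ => hφ _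
    _ = (L / n + 1 : ℕ) * ∑ i ∈ Finset.range n, φ i := hmul _
    _ ≤ _ := by
        refine mul_le_mul_of_nonneg_right ?_ hsum
        rw [add_div, div_self hn'.ne']
        push_cast
        exact add_le_add_left Nat.cast_div_le _

/-- At every time in block `j`, the frequency of a set `B ∌ x₀` is at most its frequency among the
points of the block, up to the share `2 / j` of the earlier blocks. This covers the beginning of the
block as well, because the active part of block `j - 1` is short compared with `j!`. -/
theorem sum_indicator_blockProcess_le {x₀ : X} {B : Set X} (hx₀ : x₀ ∉ B) {c : ℕ → (ℕ → X) × ℕ}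
    {T : ℕ} (hT : T ≠ 0) (hj : 2 ≤ blockIndex T)
    (hn : 0 < (blockIndex T).factorial / (c (blockIndex T)).2) :
    ((∑ t ∈ Finset.range T, B.indicator (fun _ => (1 : ℝ)) (blockProcess x₀ c t)) / T) ≤
      2 / blockIndex T + (∑ i ∈ Finset.range ((blockIndex T).factorial / (c (blockIndex T)).2),
        B.indicator (fun _ => (1 : ℝ)) ((c (blockIndex T)).1 i)) /
          ((blockIndex T).factorial / (c (blockIndex T)).2 : ℕ) := by
  set j := blockIndex T with hjdef
  set n := j.factorial / (c j).2 with hndef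
  have hjT : j.factorial ≤ T := factorial_blockIndex_le hT
  have hind : ∀ y : X, 0 ≤ B.indicator (fun _ => (1 : ℝ)) y := fun y =>
    Set.indicator_nonneg (fun _ _ => zero_le_one) _
  have hind1 : ∀ y : X, B.indicator (fun _ => (1 : ℝ)) y ≤ 1 := fun y =>
    Set.indicator_le_self' (fun _ _ => zero_le_one) _
  obtain ⟨L, hL⟩ := Nat.exists_eq_add_of_le hjT
  have hT0 : (0 : ℝ) < T := by exact_mod_cast Nat.pos_of_ne_zero hT
  have hn0 : (0 : ℝ) < n := by exact_mod_cast hn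
  have hj0 : (0 : ℝ) < j := by exact_mod_cast (by omega : 0 < j)
  set N := ∑ i ∈ Finset.range n, B.indicator (fun _ => (1 : ℝ)) ((c j).1 i) with hN
  have hN0 : 0 ≤ N := Finset.sum_nonneg fun i _ => hind _
  have hfirst : ∑ t ∈ Finset.range j.factorial,
      B.indicator (fun _ => (1 : ℝ)) (blockProcess x₀ c t) ≤ 2 * (j - 1).factorial := by
    have hle : 2 * (j - 1).factorial ≤ j.factorial := by
      have := two_mul_factorial_le (j := j - 1) (by omega)
      rwa [Nat.sub_add_cancel (by omega)] at this
    rw [← Nat.add_sub_cancel' hle, Finset.sum_range_add]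
    have h0 : ∑ s ∈ Finset.range (j.factorial - 2 * (j - 1).factorial),
        B.indicator (fun _ => (1 : ℝ)) (blockProcess x₀ c (2 * (j - 1).factorial + s)) = 0 :=
      Finset.sum_eq_zero fun s hs => by
        have := Finset.mem_range.1 hs
        rw [blockProcess_of_lt x₀ c hj (by omega) (by omega), Set.indicator_of_notMem hx₀]
    rw [h0, add_zero]
    exact (Finset.sum_le_sum fun t _ => hind1 _).trans (by simp)
  have hsecond : ∑ s ∈ Finset.range L,
      B.indicator (fun _ => (1 : ℝ)) (blockProcess x₀ c (j.factorial + s)) ≤ T / n * N := by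
    have hle : ∀ s ∈ Finset.range L,
        B.indicator (fun _ => (1 : ℝ)) (blockProcess x₀ c (j.factorial + s)) ≤
          (fun i => B.indicator (fun _ => (1 : ℝ)) ((c j).1 i)) (s % n) := fun s hs => by
      by_cases hs' : s < j.factorial
      · rw [blockProcess_add x₀ c (by omega) hs']
      · have := Finset.mem_range.1 hs
        rw [blockProcess_of_ge x₀ c (j := j) (by omega)
          ((by omega : j.factorial + s < T).trans (lt_factorial_blockIndex_succ T)),
          Set.indicator_of_notMem hx₀]
        exact hind _
    refine (Finset.sum_le_sum hle).trans ((sum_range_mod_le hn (fun i => hind _) L).trans ?_)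
    gcongr
    have : n ≤ j.factorial := Nat.div_le_self _ _
    exact_mod_cast (by omega : L + n ≤ T)
  rw [hL, Finset.sum_range_add, ← hL]
  calc _ ≤ (2 * ((j - 1).factorial : ℝ) + T / n * N) / T := by gcongr
    _ = 2 * (j - 1).factorial / T + N / n := by field_simp
    _ ≤ 2 / j + N / n := by
        refine add_le_add ?_ le_rfl
        rw [factorial_pred_eq (by omega), div_le_div_iff₀ hT0 hj0]
        have : (j.factorial : ℝ) ≤ T := by exact_mod_cast hjT
        field_simp
        linarith

end Blocks

/-! ### Independent samples of a non-atomic law -/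

section Sampling

variable {X : Type u} [MeasurableSpace X] (ν : Measure X) [IsProbabilityMeasure ν]

theorem map_infinitePi_pair {i k : ℕ} (hik : i ≠ k) :
    (Measure.infinitePi fun _ : ℕ => ν).map (fun ξ => (ξ i, ξ k)) = ν.prod ν := by
  have h : IndepFun (fun ξ : ℕ → X => ξ i) (fun ξ => ξ k) (Measure.infinitePi fun _ : ℕ => ν) :=
    (iIndepFun_infinitePi (P := fun _ : ℕ => ν) (X := fun _ y => y)
      fun _ => measurable_id).indepFun hik
  rw [(indepFun_iff_map_prod_eq_prod_map_map (measurable_pi_apply i).aemeasurable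
    (measurable_pi_apply k).aemeasurable).1 h,
    Measure.infinitePi_map_eval (fun _ : ℕ => ν) i, Measure.infinitePi_map_eval (fun _ : ℕ => ν) k]

/-- The law of large numbers for visits to a measurable set. -/
theorem ae_tendsto_frequency {B : Set X} (hB : MeasurableSet B) :
    ∀ᵐ ξ ∂(Measure.infinitePi fun _ : ℕ => ν), Tendsto (fun n : ℕ =>
      (∑ i ∈ Finset.range n, B.indicator (fun _ => (1 : ℝ)) (ξ i)) / n) atTop (𝓝 (ν B).toReal) := by
  have hm : Measurable (B.indicator fun _ => (1 : ℝ)) := measurable_const.indicator hB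
  have hmap : ∀ i, (Measure.infinitePi fun _ : ℕ => ν).map (fun ξ => ξ i) = ν := fun i =>
    Measure.infinitePi_map_eval (fun _ : ℕ => ν) i
  have hid : ∀ i, IdentDistrib (fun ξ : ℕ → X => ξ i) (fun ξ => ξ 0)
      (Measure.infinitePi fun _ : ℕ => ν) (Measure.infinitePi fun _ : ℕ => ν) := fun i =>
    ⟨(measurable_pi_apply i).aemeasurable, (measurable_pi_apply 0).aemeasurable, by rw [hmap, hmap]⟩
  have h := strong_law_ae_real (μ := Measure.infinitePi fun _ : ℕ => ν)
    (fun i ξ => B.indicator (fun _ => (1 : ℝ)) (ξ i))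
    (integrable_of_abs_le (C := 1) (hm.comp (measurable_pi_apply 0)) fun ξ => by
      by_cases h : ξ 0 ∈ B <;> simp [h])
    (fun i k hik => (iIndepFun_infinitePi (P := fun _ : ℕ => ν)
      (X := fun _ => B.indicator fun _ => (1 : ℝ)) fun _ => hm).indepFun hik)
    (fun i => (hid i).comp hm)
  have hint : ∫ ξ, B.indicator (fun _ => (1 : ℝ)) (ξ 0) ∂(Measure.infinitePi fun _ : ℕ => ν) =
      (ν B).toReal := by
    rw [← integral_map (φ := fun ξ : ℕ → X => ξ 0) (measurable_pi_apply 0).aemeasurable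
      hm.aestronglyMeasurable, hmap, integral_indicator_const _ hB]
    simp [Measure.real]
  rwa [hint] at h

/-- The law of the process that, from block `J` on, cycles `p` times through independent samples
of `ν` belongs to `classC1`: the frequency of a set `B ∌ x₀` is at most `ν B`. -/
theorem map_blockProcess_mem_classC1 (x₀ : X) (c : ℕ → (ℕ → X) × ℕ) (J : ℕ) {p : ℕ} (hp : 0 < p)
    {μ : ProbabilityMeasure (ℕ → X)}
    (hμ : (μ : Measure (ℕ → X)) = (Measure.infinitePi fun _ : ℕ => ν).map
      fun ξ => blockProcess x₀ (extendBlocks c J (ξ, p))) : μ ∈ classC1 X := by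
  intro B hB hanti hempty
  have hle : ∀ᶠ k in atTop, ∫⁻ x, upperFreq (B k) x ∂(μ : Measure (ℕ → X)) ≤ ν (B k) := by
    have hx₀ : ∃ k, x₀ ∉ B k := by
      by_contra! hall
      have : x₀ ∈ ⋂ k, B k := Set.mem_iInter.2 hall
      rw [hempty] at this
      exact this
    obtain ⟨k₀, hk₀⟩ := hx₀
    filter_upwards [eventually_ge_atTop k₀] with k hk
    have hxk : x₀ ∉ B k := fun h => hk₀ (hanti hk h)
    rw [hμ, lintegral_map (measurable_upperFreq (hB k))
      (measurable_blockProcess_extendBlocks x₀ c J p)]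
    calc _ ≤ ∫⁻ _, ν (B k) ∂(Measure.infinitePi fun _ : ℕ => ν) := by
          refine lintegral_mono_ae ?_
          filter_upwards [ae_tendsto_frequency ν (hB k)] with ξ hξ
          have hfac : Tendsto (fun T => (blockIndex T).factorial / p) atTop atTop :=
            (Nat.tendsto_div_const_atTop hp.ne').comp
              ((tendsto_atTop_mono Nat.self_le_factorial tendsto_id).comp tendsto_blockIndex)
          have h1 : Tendsto (fun T => 2 / (blockIndex T : ℝ) +
              (∑ i ∈ Finset.range ((blockIndex T).factorial / p),
                (B k).indicator (fun _ => (1 : ℝ)) (ξ i)) / ((blockIndex T).factorial / p : ℕ))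
              atTop (𝓝 (0 + (ν (B k)).toReal)) := by
            refine Tendsto.add ?_ (hξ.comp hfac)
            exact (tendsto_const_nhds.div_atTop tendsto_natCast_atTop_atTop).comp tendsto_blockIndex
          rw [zero_add] at h1
          have h2 := ENNReal.tendsto_ofReal h1
          rw [ENNReal.ofReal_toReal (measure_ne_top _ _)] at h2
          rw [upperFreq, ← h2.limsup_eq]
          refine limsup_le_limsup ?_
          filter_upwards [eventually_gt_atTop 0, tendsto_blockIndex.eventually_ge_atTop (max J 2),
            hfac.eventually_gt_atTop 0] with T hT hj hn
          have hc : extendBlocks c J (ξ, p) (blockIndex T) = (ξ, p) :=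
            if_neg (not_lt.2 ((le_max_left _ _).trans hj))
          have h3 := sum_indicator_blockProcess_le (c := extendBlocks c J (ξ, p)) hxk hT.ne'
            ((le_max_right _ _).trans hj) (by rw [hc]; exact hn)
          rw [hc] at h3
          refine le_trans (le_of_eq ?_) (ENNReal.ofReal_le_ofReal h3)
          rw [ENNReal.ofReal_div_of_pos (by exact_mod_cast hT), ENNReal.ofReal_natCast,
            ENNReal.ofReal_sum_of_nonneg fun t _ => Set.indicator_nonneg
              (fun _ _ => zero_le_one) _]
          congr 1
          refine Finset.sum_congr rfl fun t _ => ?_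
          by_cases h : blockProcess x₀ (extendBlocks c J (ξ, p)) t ∈ B k <;> simp [h]
      _ = ν (B k) := by simp
  have hν : Tendsto (fun k => ν (B k)) atTop (𝓝 0) := by
    have := tendsto_measure_iInter_atTop (μ := ν) (fun n => (hB n).nullMeasurableSet) hanti
      ⟨0, measure_ne_top _ _⟩
    rwa [hempty, measure_empty] at this
  exact tendsto_of_tendsto_of_tendsto_of_le_of_le' tendsto_const_nhds hν
    (Eventually.of_forall fun _ => zero_le) hle

/-- Samples of a non-atomic law almost surely avoid a given countable set. -/
theorem ae_forall_notMem_of_countable (hν : ∀ y, ν {y} = 0) {D : Set X} (hD : D.Countable) :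
    ∀ᵐ ξ ∂(Measure.infinitePi fun _ : ℕ => ν), ∀ i, ξ i ∉ D := by
  rw [ae_all_iff]
  intro i
  have h : ∀ᵐ y ∂ν, y ∉ D := by
    rw [ae_iff]
    simp only [not_not]
    rw [← Set.biUnion_of_singleton D]
    exact (measure_biUnion_null_iff hD).2 fun y _ => hν y
  rw [← Measure.infinitePi_map_eval (fun _ : ℕ => ν) i] at h
  exact ae_of_ae_map (f := fun ξ : ℕ → X => ξ i) (measurable_pi_apply i).aemeasurable h

/-- Fine enough countable partitions separate the first `j!` samples of a non-atomic law. -/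
theorem exists_separating_partitions [MeasurableSpace.CountablySeparated X]
    (hν : ∀ y, ν {y} = 0) : ∃ κ : ℕ → X → ℕ, (∀ j, Measurable (κ j)) ∧
      ∀ᵐ ξ ∂(Measure.infinitePi fun _ : ℕ => ν), ∀ᶠ j in atTop,
        Set.InjOn (fun i => κ j (ξ i)) (Set.Iio j.factorial) := by
  obtain ⟨φ, hφ, hinj⟩ := MeasurableSpace.measurable_injection_nat_bool_of_countablySeparated X
  let K : ℕ → X → ℕ := fun m y => Encodable.encode fun i : Fin m => φ y i
  have hK : ∀ m, Measurable (K m) := fun m =>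
    (measurable_of_countable (Encodable.encode : (Fin m → Bool) → ℕ)).comp
      (measurable_pi_lambda _ fun i => (measurable_pi_apply (i : ℕ)).comp hφ)
  have hKeq : ∀ m y y', K m y = K m y' ↔ ∀ i < m, φ y i = φ y' i := fun m y y' => by
    simp only [K, Encodable.encode_inj, funext_iff, Fin.forall_iff]
  -- `C m` decreases to the diagonal, which is a null set since `ν` is non-atomic
  let C : ℕ → Set (X × X) := fun m => {q | K m q.1 = K m q.2}
  have hC : ∀ m, MeasurableSet (C m) := fun m =>
    measurableSet_eq_fun ((hK m).comp measurable_fst) ((hK m).comp measurable_snd)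
  have hanti : Antitone C := fun m m' h q hq =>
    (hKeq m _ _).2 fun i hi => (hKeq m' _ _).1 hq i (hi.trans_le h)
  have hzero : (ν.prod ν) (⋂ m, C m) = 0 := by
    rw [Measure.measure_prod_null (MeasurableSet.iInter hC)]
    refine ae_of_all _ fun y => ?_
    refine measure_mono_null (fun z hz => ?_) (hν y)
    have : φ y = φ z := funext fun i =>
      (hKeq (i + 1) y z).1 (Set.mem_iInter.1 hz (i + 1)) i (Nat.lt_succ_self i)
    exact (hinj this).symm
  have hlim := tendsto_measure_iInter_atTop (μ := ν.prod ν) (fun n => (hC n).nullMeasurableSet)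
    hanti ⟨0, measure_ne_top _ _⟩
  rw [hzero] at hlim
  -- union bound over the pairs of samples, with a summable bound for Borel–Cantelli
  have hex : ∀ j : ℕ, ∃ m, (j.factorial * j.factorial : ℕ) * (ν.prod ν) (C m) ≤ 2⁻¹ ^ j := by
    intro j
    have h1 : Tendsto (fun m => ((j.factorial * j.factorial : ℕ) : ENNReal) * (ν.prod ν) (C m))
        atTop (𝓝 (((j.factorial * j.factorial : ℕ) : ENNReal) * 0)) :=
      ENNReal.Tendsto.const_mul hlim (Or.inr (ENNReal.natCast_ne_top _))
    rw [mul_zero] at h1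
    exact (h1.eventually (ge_mem_nhds (ENNReal.pow_pos (by simp) j))).exists
  choose m hm using hex
  refine ⟨fun j => K (m j), fun j => hK (m j), ?_⟩
  have hbad : ∀ j, (Measure.infinitePi fun _ : ℕ => ν)
      {ξ | ¬ Set.InjOn (fun i => K (m j) (ξ i)) (Set.Iio j.factorial)} ≤ 2⁻¹ ^ j := by
    intro j
    refine le_trans ?_ (hm j)
    have hsub : {ξ : ℕ → X | ¬ Set.InjOn (fun i => K (m j) (ξ i)) (Set.Iio j.factorial)} ⊆
        ⋃ q ∈ (Finset.range j.factorial ×ˢ Finset.range j.factorial).filter (fun q => q.1 ≠ q.2),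
          (fun ξ : ℕ → X => (ξ q.1, ξ q.2)) ⁻¹' C (m j) := by
      intro ξ hξ
      simp only [Set.mem_ofPred_eq, Set.InjOn, not_forall] at hξ
      obtain ⟨i, hi, k, hk, h, hne⟩ := hξ
      refine Set.mem_biUnion (x := (i, k)) ?_ h
      simpa [hne] using And.intro hi hk
    refine (measure_mono hsub).trans ((measure_biUnion_finset_le _ _).trans ?_)
    calc _ ≤ ∑ q ∈ (Finset.range j.factorial ×ˢ Finset.range j.factorial).filter
            (fun q => q.1 ≠ q.2), (ν.prod ν) (C (m j)) := Finset.sum_le_sum fun q hq => by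
          rw [← map_infinitePi_pair ν (Finset.mem_filter.1 hq).2,
            Measure.map_apply (by fun_prop) (hC _)]
      _ ≤ _ := by
          rw [Finset.sum_const, nsmul_eq_mul]
          gcongr
          exact (Finset.card_filter_le _ _).trans (by simp)
  have hsum : ∑' p : ℕ, (2⁻¹ : ENNReal) ^ p ≠ ⊤ := by
    rw [ENNReal.tsum_geometric]; simp
  filter_upwards [ae_eventually_notMem (ne_top_of_le_ne_top hsum (ENNReal.tsum_le_tsum hbad))]
    with ξ hξ
  filter_upwards [hξ] with j hj
  simpa using hj

end Sampling

/-! ### A safe action and an action of unknown value -/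

section Exploration

variable {X : Type u} {A : Type v} {x z : ℕ → X} {j n p q i : ℕ} {a₁ a₂ : A}

open Classical in
/-- In the active part `[j!, 2 * j!)` of each block the safe action `a₁` brings `3 / 4` and the
action `a₂` brings `1` or `0`, depending on a label; all other rewards vanish. -/
noncomputable def probeReward (a₁ a₂ : A) (t : ℕ) (v : Bool) (a : A) : Reward :=
  if t < 2 * (blockIndex t).factorial then
    if a = a₁ then ⟨3 / 4, by norm_num, by norm_num⟩ else if a = a₂ ∧ v = true then 1 else 0
  else 0

theorem probeReward_block (hj : j ≠ 0) {s : ℕ} (hs : s < j.factorial) (v : Bool) (a : A) :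
    (probeReward a₁ a₂ (j.factorial + s) v a : ℝ) =
      open Classical in if a = a₁ then 3 / 4 else if a = a₂ ∧ v = true then 1 else 0 := by
  rw [probeReward, blockIndex_add hj hs, if_pos (by omega)]
  split_ifs <;> rfl

theorem probeReward_of_lt (hj : 2 ≤ j) {t : ℕ} (h1 : 2 * (j - 1).factorial ≤ t)
    (h2 : t < j.factorial) (v : Bool) (a : A) : probeReward a₁ a₂ t v a = 0 := by
  rw [probeReward, blockIndex_of_lt hj h1 h2, if_neg (by omega)]

/-- Position `i` of cycle `q` is step `q * n + i` of the block, where `p` cycles of length `n` fill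
the active part. -/
theorem cycle_lt (hpn : p * n = j.factorial) (hq : q < p) (hi : i < n) :
    q * n + i < j.factorial := by
  have h1 : (q + 1) * n ≤ p * n := Nat.mul_le_mul_right _ hq
  rw [Nat.succ_mul] at h1
  omega

theorem context_cycle (hpn : p * n = j.factorial)
    (hx : ∀ s < j.factorial, x (j.factorial + s) = z (s % n)) (hq : q < p) (hi : i < n) :
    x (j.factorial + (q * n + i)) = z i := by
  rw [hx _ (cycle_lt hpn hq hi), mul_comm, Nat.mul_add_mod, Nat.mod_eq_of_lt hi]

/-- The labels are attached to the cells of a partition `κ j` that depends on the block `j`. -/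
def probeGroup (κ : ℕ → X → ℕ) (t : ℕ) (y : X) : ℕ × ℕ := (blockIndex t, κ (blockIndex t) y)

variable [MeasurableSpace X] [MeasurableSpace A] (f : LearningRule X A) (κ : ℕ → X → ℕ) (a₁ a₂ : A)

/-- The joint law of independent fair labels and of the seed of `f`. -/
noncomputable def probeLaw : Measure ((ℕ × ℕ → Bool) × f.Seed) :=
  (Measure.infinitePi fun _ : ℕ × ℕ => fairCoin).prod f.seedLaw

instance : IsProbabilityMeasure (probeLaw f) := by unfold probeLaw; infer_instance

/-- The action of `f` at time `t` in the contexts `x`. -/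
noncomputable def probeAct (x : ℕ → X) (t : ℕ) (ω : (ℕ × ℕ → Bool) × f.Seed) : A :=
  detAct f (labelReward (probeReward a₁ a₂) (probeGroup κ) ω.1) ω.2 x t

/-- `f` plays `a₂` at the `i`-th point of block `j` in one of the first `q` cycles of length `n`. -/
def Tried (x : ℕ → X) (j n q i : ℕ) (ω : (ℕ × ℕ → Bool) × f.Seed) : Prop :=
  ∃ q' < q, probeAct f κ a₁ a₂ x (j.factorial + (q' * n + i)) ω = a₂

open Classical in
/-- The expected number of points of block `j` at which `a₂` is tried in the first `q` cycles. -/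
noncomputable def expectedTried (x : ℕ → X) (j n q : ℕ) : ℝ :=
  ∑ i ∈ Finset.range n, ∫ ω, (if Tried f κ a₁ a₂ x j n q i ω then 1 else 0) ∂(probeLaw f)

variable {f κ a₁ a₂}

theorem measurable_probeReward [MeasurableSingletonClass A] (t : ℕ) (v : Bool) :
    Measurable (probeReward a₁ a₂ t v) := by
  unfold probeReward
  split_ifs
  · exact Measurable.ite (measurableSet_singleton a₁) measurable_const
      (Measurable.ite (p := fun a => a = a₂ ∧ v = true)
        ((measurableSet_singleton a₂).inter (MeasurableSet.const (v = true)))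
        measurable_const measurable_const)
  · exact measurable_const

theorem measurable_probeGroup (hκ : ∀ j, Measurable (κ j)) (t : ℕ) : Measurable (probeGroup κ t) :=
  measurable_const.prodMk (hκ _)

theorem measurable_probe [MeasurableSingletonClass A] (hκ : ∀ j, Measurable (κ j)) (t : ℕ) :
    Measurable fun p : (ℕ × ℕ → Bool) × A × X =>
      labelReward (probeReward a₁ a₂) (probeGroup κ) p.1 t p.2 :=
  measurable_labelReward measurable_probeReward (measurable_probeGroup hκ) t

theorem measurable_probeAct [MeasurableSingletonClass A] (hκ : ∀ j, Measurable (κ j)) (x : ℕ → X)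
    (t : ℕ) : Measurable (probeAct f κ a₁ a₂ x t) :=
  (measurable_detAct (f := f) (measurable_probe hκ) t).comp (measurable_const.prodMk measurable_id)

theorem measurableSet_tried [MeasurableSingletonClass A] (hκ : ∀ j, Measurable (κ j)) (x : ℕ → X)
    (j n q i : ℕ) : MeasurableSet {ω | Tried f κ a₁ a₂ x j n q i ω} := by
  have : {ω | Tried f κ a₁ a₂ x j n q i ω} = ⋃ q' ∈ Finset.range q,
      probeAct f κ a₁ a₂ x (j.factorial + (q' * n + i)) ⁻¹' {a₂} := by
    ext ω; simp [Tried]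
  rw [this]
  exact Finset.measurableSet_biUnion _ fun q' _ =>
    measurable_probeAct hκ x _ (measurableSet_singleton a₂)

theorem tried_succ_iff {ω : (ℕ × ℕ → Bool) × f.Seed} :
    Tried f κ a₁ a₂ x j n (q + 1) i ω ↔ Tried f κ a₁ a₂ x j n q i ω ∨
      probeAct f κ a₁ a₂ x (j.factorial + (q * n + i)) ω = a₂ := by
  simp only [Tried, Nat.lt_succ_iff_lt_or_eq, or_and_right, exists_or, exists_eq_left]

theorem expectedTried_zero (x : ℕ → X) (j n : ℕ) : expectedTried f κ a₁ a₂ x j n 0 = 0 := by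
  simp [expectedTried, Tried]

theorem expectedTried_congr {x' : ℕ → X} (hqn : q * n ≤ j.factorial)
    (h : ∀ t < 2 * j.factorial, x t = x' t) :
    expectedTried f κ a₁ a₂ x j n q = expectedTried f κ a₁ a₂ x' j n q := by
  unfold expectedTried
  refine Finset.sum_congr rfl fun i hi => ?_
  have : ∀ ω, Tried f κ a₁ a₂ x j n q i ω ↔ Tried f κ a₁ a₂ x' j n q i ω := fun ω => by
    unfold Tried probeAct
    refine exists_congr fun q' => and_congr_right fun hq' => ?_
    rw [detAct_congr_context fun k hk => h k (lt_of_le_of_lt hk ?_)]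
    have h1 : (q' + 1) * n ≤ q * n := Nat.mul_le_mul_right _ hq'
    have h2 := Finset.mem_range.1 hi
    rw [Nat.succ_mul] at h1
    omega
  refine integral_congr_ae (ae_of_all _ fun ω => ?_)
  by_cases hT : Tried f κ a₁ a₂ x j n q i ω
  · simp only [hT, (this ω).1 hT, if_true]
  · simp only [hT, mt (this ω).2 hT, if_false]

/-- As long as `a₂` has not been tried at the `i`-th point, its label is unknown to `f`. -/
theorem probeAct_update (hj : j ≠ 0) (hpn : p * n = j.factorial)
    (hx : ∀ s < j.factorial, x (j.factorial + s) = z (s % n))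
    (hinj : Set.InjOn (fun i => κ j (z i)) (Set.Iio n)) (hq : q < p) (hi : i < n)
    {ω : (ℕ × ℕ → Bool) × f.Seed} (h : ¬ Tried f κ a₁ a₂ x j n q i ω) (v : Bool) {t : ℕ}
    (ht : t ≤ j.factorial + (q * n + i)) :
    probeAct f κ a₁ a₂ x t (Function.update ω.1 (j, κ j (z i)) v, ω.2) =
      probeAct f κ a₁ a₂ x t ω := by
  refine detAct_labelReward_update f fun k hk hg => ?_
  have hcyc := cycle_lt hpn hq hi
  have hne : probeAct f κ a₁ a₂ x k ω ≠ a₂ := by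
    intro hact
    simp only [probeGroup, Prod.mk.injEq] at hg
    obtain ⟨hkj, hkκ⟩ := hg
    rw [hkj] at hkκ
    have hk0 : k ≠ 0 := by
      rintro rfl
      exact hj (by rw [← hkj]; simp [blockIndex])
    have hjk : j.factorial ≤ k := by
      have := factorial_blockIndex_le hk0
      rwa [hkj] at this
    obtain ⟨s, rfl⟩ := Nat.exists_eq_add_of_le hjk
    have hs : s < q * n + i := by omega
    have hn : 0 < n := by omega
    rw [hx s (by omega)] at hkκ
    have hmod : s % n = i := hinj (Nat.mod_lt _ hn) hi hkκ
    have hdiv := Nat.div_add_mod s n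
    rw [hmod, mul_comm] at hdiv
    refine h ⟨s / n, ?_, by rw [hdiv]; exact hact⟩
    by_contra! hge
    have := Nat.mul_le_mul_right n hge
    omega
  change probeReward a₁ a₂ k (ω.1 (j, κ j (z i))) (probeAct f κ a₁ a₂ x k ω) =
    probeReward a₁ a₂ k v (probeAct f κ a₁ a₂ x k ω)
  simp [probeReward, hne]

open Classical in
/-- The first time `a₂` is tried at a point, its mean reward is `1 / 2`. -/
theorem integral_first_try_eq_zero [MeasurableSingletonClass A] (hκ : ∀ j, Measurable (κ j))
    (hj : j ≠ 0) (hpn : p * n = j.factorial)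
    (hx : ∀ s < j.factorial, x (j.factorial + s) = z (s % n))
    (hinj : Set.InjOn (fun i => κ j (z i)) (Set.Iio n)) (hq : q < p) (hi : i < n) :
    ∫ ω, (if Tried f κ a₁ a₂ x j n (q + 1) i ω ∧ ¬ Tried f κ a₁ a₂ x j n q i ω then
      (if ω.1 (j, κ j (z i)) = true then (1 / 2 : ℝ) else -(1 / 2)) else 0) ∂(probeLaw f) = 0 := by
  set l : ℕ × ℕ := (j, κ j (z i)) with hl
  set New : (ℕ × ℕ → Bool) × f.Seed → Prop := fun ω =>
    Tried f κ a₁ a₂ x j n (q + 1) i ω ∧ ¬ Tried f κ a₁ a₂ x j n q i ω with hNew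
  have hmNew : MeasurableSet {ω | New ω} :=
    (measurableSet_tried hκ x j n (q + 1) i).inter (measurableSet_tried hκ x j n q i).compl
  have hcoord : Measurable fun ω : (ℕ × ℕ → Bool) × f.Seed => ω.1 l :=
    (measurable_pi_apply l).comp measurable_fst
  have hm : Measurable fun ω : (ℕ × ℕ → Bool) × f.Seed => if New ω then
      (if ω.1 l = true then (1 / 2 : ℝ) else -(1 / 2)) else 0 :=
    Measurable.ite hmNew (Measurable.ite (hcoord (measurableSet_singleton true)) measurable_const
      measurable_const) measurable_const
  -- whether this is a first try does not depend on the label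
  have hone : ∀ ω v, New ω → New (Function.update ω.1 l v, ω.2) := by
    intro ω v hω
    have hact : ∀ t ≤ j.factorial + (q * n + i),
        probeAct f κ a₁ a₂ x t (Function.update ω.1 l v, ω.2) = probeAct f κ a₁ a₂ x t ω :=
      fun t ht => probeAct_update hj hpn hx hinj hq hi hω.2 v ht
    have hT : ∀ q' ≤ q + 1, Tried f κ a₁ a₂ x j n q' i (Function.update ω.1 l v, ω.2) ↔
        Tried f κ a₁ a₂ x j n q' i ω := fun q' hq' => by
      unfold Tried
      refine exists_congr fun k => and_congr_right fun hk => ?_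
      rw [hact]
      have := Nat.mul_le_mul_right n (by omega : k ≤ q)
      omega
    exact ⟨(hT _ le_rfl).2 hω.1, fun h => hω.2 ((hT _ (Nat.le_succ q)).1 h)⟩
  have hiff : ∀ ω v, New (Function.update ω.1 l v, ω.2) ↔ New ω := fun ω v =>
    ⟨fun h => by simpa using hone (Function.update ω.1 l v, ω.2) (ω.1 l) h, hone ω v⟩
  rw [probeLaw, ← integral_update_prod (fun _ : ℕ × ℕ => fairCoin) f.seedLaw l hm (C := 1)
    fun ω => by split_ifs <;> norm_num [abs_le]]
  have hzero : ∀ ω : (ℕ × ℕ → Bool) × f.Seed, ∫ v, (if New (Function.update ω.1 l v, ω.2) then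
      (if Function.update ω.1 l v l = true then (1 / 2 : ℝ) else -(1 / 2)) else 0)
        ∂fairCoin = 0 := by
    intro ω
    rw [integral_fairCoin]
    simp only [hiff, Function.update_self]
    by_cases h : New ω <;> simp [h]
  simp only [hzero, integral_zero]

theorem integral_label (l : ℕ × ℕ) :
    ∫ ω, (if ω.1 l = true then (1 : ℝ) else 0) ∂(probeLaw f) = 1 / 2 := by
  have hcoord : Measurable fun ω : (ℕ × ℕ → Bool) × f.Seed => ω.1 l :=
    (measurable_pi_apply l).comp measurable_fst
  have hm : Measurable fun ω : (ℕ × ℕ → Bool) × f.Seed =>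
      if ω.1 l = true then (1 : ℝ) else 0 :=
    Measurable.ite (hcoord (measurableSet_singleton true)) measurable_const measurable_const
  rw [probeLaw, ← integral_update_prod (fun _ : ℕ × ℕ => fairCoin) f.seedLaw l hm (C := 1)
    fun ω => by split_ifs <;> norm_num]
  simp only [Function.update_self, integral_fairCoin]
  simp

/-- The regret of the rule at time `t` against the policy `π`. -/
noncomputable def probeLoss (f : LearningRule X A) (κ : ℕ → X → ℕ) (a₁ a₂ : A)
    (π : (ℕ × ℕ → Bool) → X → A) (x : ℕ → X) (t : ℕ) (ω : (ℕ × ℕ → Bool) × f.Seed) : ℝ :=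
  (labelReward (probeReward a₁ a₂) (probeGroup κ) ω.1 t (π ω.1 (x t), x t) : ℝ) -
    labelReward (probeReward a₁ a₂) (probeGroup κ) ω.1 t (probeAct f κ a₁ a₂ x t ω, x t)

variable {π : (ℕ × ℕ → Bool) → X → A}

theorem abs_probeLoss_le (t : ℕ) (ω : (ℕ × ℕ → Bool) × f.Seed) :
    |probeLoss f κ a₁ a₂ π x t ω| ≤ 1 := abs_reward_sub_le _ _

theorem integrable_probeLoss [MeasurableSingletonClass A] (hκ : ∀ j, Measurable (κ j))
    (hπ : Measurable fun p : (ℕ × ℕ → Bool) × X => π p.1 p.2) (x : ℕ → X) (t : ℕ) :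
    Integrable (probeLoss f κ a₁ a₂ π x t) (probeLaw f) := by
  refine integrable_of_abs_le (Measurable.sub ?_ ?_) (C := 1) fun ω => abs_probeLoss_le t ω
  · exact ((measurable_probe hκ t).comp (measurable_fst.prodMk
      ((hπ.comp (measurable_fst.prodMk measurable_const)).prodMk measurable_const))).subtype_val
  · exact ((measurable_probe hκ t).comp (measurable_fst.prodMk
      ((measurable_probeAct hκ x t).prodMk measurable_const))).subtype_val

/-- The expected regret in the first `q` cycles of block `j` is controlled by the expected regret up
to the end of these cycles, since the earlier active parts are short. -/
theorem sum_integral_probeLoss_le [MeasurableSingletonClass A] (hκ : ∀ j, Measurable (κ j))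
    (hπ : Measurable fun p : (ℕ × ℕ → Bool) × X => π p.1 p.2) (hj : 2 ≤ j) (q n : ℕ) :
    ∑ q' ∈ Finset.range q, ∑ i ∈ Finset.range n,
        ∫ ω, probeLoss f κ a₁ a₂ π x (j.factorial + (q' * n + i)) ω ∂(probeLaw f) ≤
      ∫ ω, detRegret f (labelReward (probeReward a₁ a₂) (probeGroup κ) ω.1) (π ω.1) ω.2 x
        (j.factorial + q * n) ∂(probeLaw f) + 2 * (j - 1).factorial := by
  have hsum : ∫ ω, detRegret f (labelReward (probeReward a₁ a₂) (probeGroup κ) ω.1) (π ω.1) ω.2 x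
      (j.factorial + q * n) ∂(probeLaw f) = ∑ t ∈ Finset.range (j.factorial + q * n),
        ∫ ω, probeLoss f κ a₁ a₂ π x t ω ∂(probeLaw f) :=
    integral_finsetSum _ fun t _ => integrable_probeLoss hκ hπ x t
  have hcyc : ∀ q : ℕ, ∑ s ∈ Finset.range (q * n),
      ∫ ω, probeLoss f κ a₁ a₂ π x (j.factorial + s) ω ∂(probeLaw f) =
      ∑ q' ∈ Finset.range q, ∑ i ∈ Finset.range n,
        ∫ ω, probeLoss f κ a₁ a₂ π x (j.factorial + (q' * n + i)) ω ∂(probeLaw f) := by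
    intro q
    induction q with
    | zero => simp
    | succ q ih => rw [Nat.succ_mul, Finset.sum_range_add, ih, Finset.sum_range_succ]
  have hle : 2 * (j - 1).factorial ≤ j.factorial := by
    have := two_mul_factorial_le (j := j - 1) (by omega)
    rwa [Nat.sub_add_cancel (by omega)] at this
  have hprior : -(2 * (j - 1).factorial : ℝ) ≤ ∑ t ∈ Finset.range j.factorial,
      ∫ ω, probeLoss f κ a₁ a₂ π x t ω ∂(probeLaw f) := by
    rw [← Nat.add_sub_cancel' hle, Finset.sum_range_add]
    have h0 : ∑ s ∈ Finset.range (j.factorial - 2 * (j - 1).factorial),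
        ∫ ω, probeLoss f κ a₁ a₂ π x (2 * (j - 1).factorial + s) ω ∂(probeLaw f) = 0 :=
      Finset.sum_eq_zero fun s hs => by
        have := Finset.mem_range.1 hs
        simp [probeLoss, labelReward, probeReward_of_lt hj (by omega :
          2 * (j - 1).factorial ≤ 2 * (j - 1).factorial + s) (by omega)]
    rw [h0, add_zero]
    calc -(2 * (j - 1).factorial : ℝ)
        = ∑ t ∈ Finset.range (2 * (j - 1).factorial), ∫ _, (-1 : ℝ) ∂(probeLaw f) := by simp
      _ ≤ _ := Finset.sum_le_sum fun t _ => integral_mono (integrable_const _)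
          (integrable_probeLoss hκ hπ x t) fun ω => (abs_le.1 (abs_probeLoss_le t ω)).1
  rw [hsum, Finset.sum_range_add, hcyc]
  linarith

open Classical in
theorem integrable_tried [MeasurableSingletonClass A] (hκ : ∀ j, Measurable (κ j)) (x : ℕ → X)
    (j n q i : ℕ) : Integrable (fun ω => if Tried f κ a₁ a₂ x j n q i ω then (1 : ℝ) else 0)
      (probeLaw f) :=
  integrable_of_abs_le (Measurable.ite (measurableSet_tried hκ x j n q i) measurable_const
    measurable_const) (C := 1) fun ω => by split_ifs <;> norm_num

/-- Against the safe action, a first try costs `1 / 4` on average and a repeated try gains at most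
`1 / 4`. -/
theorem expectedTried_succ_le [MeasurableSingletonClass A] (hκ : ∀ j, Measurable (κ j))
    (ha : a₁ ≠ a₂) (hj : j ≠ 0)
    (hpn : p * n = j.factorial) (hx : ∀ s < j.factorial, x (j.factorial + s) = z (s % n))
    (hinj : Set.InjOn (fun i => κ j (z i)) (Set.Iio n)) (hq : q < p) :
    expectedTried f κ a₁ a₂ x j n (q + 1) - 2 * expectedTried f κ a₁ a₂ x j n q ≤
      4 * ∑ i ∈ Finset.range n,
        ∫ ω, probeLoss f κ a₁ a₂ (fun _ _ => a₁) x (j.factorial + (q * n + i)) ω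
          ∂(probeLaw f) := by
  classical
  unfold expectedTried
  rw [Finset.mul_sum, Finset.mul_sum, ← Finset.sum_sub_distrib]
  refine Finset.sum_le_sum fun i hi => ?_
  have hi := Finset.mem_range.1 hi
  have hz := context_cycle hpn hx hq hi
  have hs := cycle_lt hpn hq hi
  have hfirst := integral_first_try_eq_zero (f := f) (a₁ := a₁) (a₂ := a₂) hκ hj hpn hx hinj hq hi
  have hcoord : Measurable fun ω : (ℕ × ℕ → Bool) × f.Seed => ω.1 (j, κ j (z i)) :=
    (measurable_pi_apply _).comp measurable_fst
  have hint : Integrable (fun ω => if Tried f κ a₁ a₂ x j n (q + 1) i ω ∧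
      ¬ Tried f κ a₁ a₂ x j n q i ω then
      (if ω.1 (j, κ j (z i)) = true then (1 / 2 : ℝ) else -(1 / 2)) else 0) (probeLaw f) :=
    integrable_of_abs_le (Measurable.ite ((measurableSet_tried hκ x j n (q + 1) i).inter
      (measurableSet_tried hκ x j n q i).compl) (Measurable.ite
      (hcoord (measurableSet_singleton true)) measurable_const measurable_const) measurable_const)
      (C := 1) fun ω => by split_ifs <;> norm_num [abs_le]
  have h1 := integrable_tried (f := f) (a₁ := a₁) (a₂ := a₂) hκ x j n (q + 1) i
  have h2 := integrable_tried (f := f) (a₁ := a₁) (a₂ := a₂) hκ x j n q i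
  have hloss := integrable_probeLoss (f := f) (a₁ := a₁) (a₂ := a₂) hκ
    (π := fun _ _ => a₁) measurable_const x (j.factorial + (q * n + i))
  have h12 : Integrable (fun ω => (if Tried f κ a₁ a₂ x j n (q + 1) i ω then (1 : ℝ) else 0) -
      2 * if Tried f κ a₁ a₂ x j n q i ω then 1 else 0) (probeLaw f) := h1.sub (h2.const_mul 2)
  -- a first try costs `3 / 4 - v = 1 / 4 + (1 / 2 - v)` for the label value `v`, and the mean of the
  -- bracket vanishes by `hfirst`; at tried points at most `1 / 4` is gained, elsewhere nothing
  have hmono := integral_mono (h12.sub (hint.const_mul 4)) (hloss.const_mul 4)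
    (fun ω => by
      simp only [probeLoss, labelReward, hz, probeGroup, blockIndex_add hj hs, Pi.sub_apply,
        probeReward_block hj hs, tried_succ_iff, if_true]
      by_cases hW : Tried f κ a₁ a₂ x j n q i ω
      · simp only [hW, true_or, not_true, and_false, if_true, if_false]
        split_ifs <;> norm_num
      · by_cases hact : probeAct f κ a₁ a₂ x (j.factorial + (q * n + i)) ω = a₂
        · simp only [hW, hact, or_true, not_false_eq_true, and_self, if_true, if_false, ha.symm,
            true_and]
          split_ifs <;> norm_num
        · simp only [hW, hact, or_self, false_and, if_false]
          split_ifs <;> norm_num)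
  rw [integral_sub' h12 (hint.const_mul 4), integral_const_mul 4, hfirst,
    integral_const_mul 4, integral_sub h1 (h2.const_mul 2), integral_const_mul] at hmono
  linarith

/-- If the regret against the safe action is small at the end of each cycle then `a₂` is tried at
few points only. -/
theorem expectedTried_le [MeasurableSingletonClass A] (hκ : ∀ j, Measurable (κ j))
    (ha : a₁ ≠ a₂) (hj : 2 ≤ j)
    (hpn : p * n = j.factorial) (hx : ∀ s < j.factorial, x (j.factorial + s) = z (s % n))
    (hinj : Set.InjOn (fun i => κ j (z i)) (Set.Iio n)) {δ : ℝ} (hδ : 0 ≤ δ)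
    (hreg : ∀ q ≤ p, ∫ ω, detRegret f (labelReward (probeReward a₁ a₂) (probeGroup κ) ω.1)
      (fun _ => a₁) ω.2 x (j.factorial + q * n) ∂(probeLaw f) + 2 * (j - 1).factorial ≤ δ) :
    ∀ q ≤ p, expectedTried f κ a₁ a₂ x j n q ≤ 2 ^ q * (4 * δ) := by
  -- each cycle at most doubles the number of tried points, up to the regret that is allowed
  have hsum : ∀ q < p, expectedTried f κ a₁ a₂ x j n (q + 1) ≤
      ∑ q' ∈ Finset.range (q + 1), expectedTried f κ a₁ a₂ x j n q' + 4 * δ := by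
    intro q hq
    have h1 := (sum_integral_probeLoss_le (f := f) (x := x) (a₁ := a₁) (a₂ := a₂) hκ
      (π := fun _ _ => a₁) measurable_const hj (q + 1) n).trans (hreg (q + 1) hq)
    have h2 : ∑ q' ∈ Finset.range (q + 1), (expectedTried f κ a₁ a₂ x j n (q' + 1) -
        2 * expectedTried f κ a₁ a₂ x j n q') ≤ 4 * δ := by
      calc _ ≤ ∑ q' ∈ Finset.range (q + 1), 4 * ∑ i ∈ Finset.range n,
            ∫ ω, probeLoss f κ a₁ a₂ (fun _ _ => a₁) x (j.factorial + (q' * n + i)) ω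
              ∂(probeLaw f) := Finset.sum_le_sum fun q' hq' =>
              expectedTried_succ_le hκ ha (by omega) hpn hx hinj
                (by have := Finset.mem_range.1 hq'; omega)
        _ ≤ _ := by rw [← Finset.mul_sum]; linarith
    have h3 := Finset.sum_range_sub (expectedTried f κ a₁ a₂ x j n) (q + 1)
    rw [expectedTried_zero, sub_zero] at h3
    have h4 : ∑ q' ∈ Finset.range (q + 1), (expectedTried f κ a₁ a₂ x j n (q' + 1) -
        2 * expectedTried f κ a₁ a₂ x j n q') = expectedTried f κ a₁ a₂ x j n (q + 1) -
        ∑ q' ∈ Finset.range (q + 1), expectedTried f κ a₁ a₂ x j n q' := by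
      rw [← h3, ← Finset.sum_sub_distrib]
      exact Finset.sum_congr rfl fun _ _ => by ring
    linarith
  intro q
  induction q using Nat.strong_induction_on with
  | _ q ih =>
    intro hqp
    cases q with
    | zero => rw [expectedTried_zero]; positivity
    | succ q =>
      refine (hsum q hqp).trans ?_
      have h1 : ∑ q' ∈ Finset.range (q + 1), expectedTried f κ a₁ a₂ x j n q' ≤
          ∑ q' ∈ Finset.range (q + 1), 2 ^ q' * (4 * δ) := Finset.sum_le_sum fun q' hq' => by
        have := Finset.mem_range.1 hq'
        exact ih q' this (by omega)
      have h2 : ∑ q' ∈ Finset.range (q + 1), (2 : ℝ) ^ q' = 2 ^ (q + 1) - 1 := by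
        rw [geom_sum_eq (by norm_num)]; norm_num
      rw [← Finset.sum_mul, h2] at h1
      linarith

/-- Against a policy that knows the labels, the regret in a block is large if `a₂` is tried at few
points only: each visit to an untried point with label `true` costs at least `1 / 4`. -/
theorem le_sum_integral_probeLoss [MeasurableSingletonClass A] (hκ : ∀ j, Measurable (κ j))
    (ha : a₁ ≠ a₂) (hj : j ≠ 0) (hpn : p * n = j.factorial)
    (hx : ∀ s < j.factorial, x (j.factorial + s) = z (s % n))
    (hπ : Measurable fun p : (ℕ × ℕ → Bool) × X => π p.1 p.2)
    (hπz : ∀ θ, ∀ i < n, π θ (z i) = if θ (j, κ j (z i)) = true then a₂ else a₁) :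
    p * ((n : ℝ) / 2 - expectedTried f κ a₁ a₂ x j n p) ≤
      4 * ∑ q ∈ Finset.range p, ∑ i ∈ Finset.range n,
        ∫ ω, probeLoss f κ a₁ a₂ π x (j.factorial + (q * n + i)) ω ∂(probeLaw f) := by
  classical
  have hterm : ∀ q ∈ Finset.range p, ((n : ℝ) / 2 - expectedTried f κ a₁ a₂ x j n p) ≤
      ∑ i ∈ Finset.range n,
        4 * ∫ ω, probeLoss f κ a₁ a₂ π x (j.factorial + (q * n + i)) ω ∂(probeLaw f) := by
    intro q hq
    have hq := Finset.mem_range.1 hq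
    have hn2 : (n : ℝ) / 2 = ∑ i ∈ Finset.range n, (1 / 2 : ℝ) := by simp; ring
    rw [hn2, expectedTried, ← Finset.sum_sub_distrib]
    refine Finset.sum_le_sum fun i hi => ?_
    have hi := Finset.mem_range.1 hi
    have hz := context_cycle hpn hx hq hi
    have hs := cycle_lt hpn hq hi
    have hcoord : Measurable fun ω : (ℕ × ℕ → Bool) × f.Seed => ω.1 (j, κ j (z i)) :=
      (measurable_pi_apply _).comp measurable_fst
    have hint : Integrable (fun ω : (ℕ × ℕ → Bool) × f.Seed =>
        if ω.1 (j, κ j (z i)) = true then (1 : ℝ) else 0) (probeLaw f) :=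
      integrable_of_abs_le (Measurable.ite (hcoord (measurableSet_singleton true)) measurable_const
        measurable_const) (C := 1) fun ω => by split_ifs <;> norm_num
    have h1 := integrable_tried (f := f) (a₁ := a₁) (a₂ := a₂) hκ x j n p i
    rw [← integral_label (f := f) (j, κ j (z i)), ← integral_sub hint h1, ← integral_const_mul]
    refine integral_mono (hint.sub h1) ((integrable_probeLoss hκ hπ x _).const_mul 4) fun ω => ?_
    have htried : probeAct f κ a₁ a₂ x (j.factorial + (q * n + i)) ω = a₂ →
        Tried f κ a₁ a₂ x j n p i ω := fun h => ⟨q, hq, h⟩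
    simp only [probeLoss, labelReward, hz, probeGroup, blockIndex_add hj hs, hπz ω.1 i hi,
      probeReward_block hj hs]
    by_cases hW : Tried f κ a₁ a₂ x j n p i ω
    · by_cases hlab : ω.1 (j, κ j (z i)) = true
      · simp only [hW, hlab, if_true, ha.symm, if_false, and_self]
        split_ifs <;> norm_num
      · simp only [hW, hlab, if_true, if_false, and_false, Bool.false_eq_true]
        split_ifs <;> norm_num
    · have hact := mt htried hW
      by_cases hlab : ω.1 (j, κ j (z i)) = true
      · simp only [hW, hlab, if_true, ha.symm, if_false, and_self, hact, false_and]
        split_ifs <;> norm_num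
      · simp only [hW, hlab, if_false, hact, false_and, Bool.false_eq_true]
        split_ifs <;> norm_num
  calc _ = ∑ q ∈ Finset.range p, ((n : ℝ) / 2 - expectedTried f κ a₁ a₂ x j n p) := by
        rw [Finset.sum_const, Finset.card_range, nsmul_eq_mul]
    _ ≤ ∑ q ∈ Finset.range p, ∑ i ∈ Finset.range n,
        4 * ∫ ω, probeLoss f κ a₁ a₂ π x (j.factorial + (q * n + i)) ω ∂(probeLaw f) :=
        Finset.sum_le_sum hterm
    _ = _ := by simp only [Finset.mul_sum]

end Exploration

/-! ### Deterministic processes in `classC2` -/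

section Deterministic

variable {X : Type u} [MeasurableSpace X] [MeasurableSingletonClass X] {x : ℕ → X}
  {μ : ProbabilityMeasure (ℕ → X)}

theorem mem_classC2_of_sublinearDistinct (hμ : (μ : Measure (ℕ → X)) = Measure.dirac x)
    (hx : SublinearDistinct x) : μ ∈ classC2 X := by
  classical
  intro B _ hdisj
  rw [hμ, ae_dirac_eq]
  refine Asymptotics.isLittleO_iff.2 fun ε hε => ?_
  filter_upwards [hx ε hε] with T hT
  rw [Real.norm_of_nonneg (Nat.cast_nonneg _), Real.norm_of_nonneg (Nat.cast_nonneg _)]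
  refine le_trans ?_ hT
  let φ : X → ℕ := fun y => if h : ∃ k, y ∈ B k then h.choose else 0
  have hφ : ∀ y k, y ∈ B k → φ y = k := fun y k hk => by
    have h : ∃ k, y ∈ B k := ⟨k, hk⟩
    simp only [φ, h, dif_pos]
    by_contra hne
    exact Set.disjoint_left.1 (hdisj hne) h.choose_spec hk
  have hsub : {k | ∃ t < T, x t ∈ B k} ⊆ (((Finset.range T).image x).image φ : Finset ℕ) := by
    rintro k ⟨t, ht, hk⟩
    simp only [Finset.coe_image, Finset.coe_range]
    exact ⟨x t, ⟨t, ht, rfl⟩, hφ _ _ hk⟩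
  have h1 := Set.ncard_le_ncard hsub (Finset.finite_toSet _)
  rw [Set.ncard_coe_finset] at h1
  exact_mod_cast h1.trans Finset.card_image_le

theorem sublinearDistinct_of_mem_classC2 (hμ : (μ : Measure (ℕ → X)) = Measure.dirac x)
    (h : μ ∈ classC2 X) : SublinearDistinct x := by
  classical
  -- each visited point gets the index of its first visit
  let B : ℕ → Set X := fun k => if ∀ j < k, x j ≠ x k then {x k} else ∅
  have hB : ∀ k y, y ∈ B k ↔ (∀ j < k, x j ≠ x k) ∧ y = x k := fun k y => by
    by_cases hk : ∀ j < k, x j ≠ x k <;> simp [B, hk]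
  have hm : ∀ k, MeasurableSet (B k) := fun k => by
    simp only [B]
    split_ifs
    · exact measurableSet_singleton _
    · exact MeasurableSet.empty
  have hdisj : Pairwise (Function.onFun Disjoint B) := fun k l hkl =>
    Set.disjoint_left.2 fun y hk hl => by
      obtain ⟨hk1, hk2⟩ := (hB k y).1 hk
      obtain ⟨hl1, hl2⟩ := (hB l y).1 hl
      rcases lt_or_gt_of_ne hkl with hlt | hlt
      · exact hl1 k hlt (hk2.symm.trans hl2)
      · exact hk1 l hlt (hl2.symm.trans hk2)
  have h1 := h B hm hdisj
  rw [hμ, ae_dirac_eq] at h1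
  have h1 : (fun T : ℕ => (({k | ∃ t < T, x t ∈ B k} : Set ℕ).ncard : ℝ)) =o[atTop]
    (fun T : ℕ => (T : ℝ)) := h1
  intro ε hε
  filter_upwards [Asymptotics.isLittleO_iff.1 h1 hε] with T hT
  rw [Real.norm_of_nonneg (Nat.cast_nonneg _), Real.norm_of_nonneg (Nat.cast_nonneg _)] at hT
  refine le_trans ?_ hT
  have hfin : ({k | ∃ t < T, x t ∈ B k} : Set ℕ).Finite := by
    refine (Set.finite_Iio T).subset ?_
    rintro k ⟨t, ht, hk⟩
    obtain ⟨hk1, hk2⟩ := (hB k _).1 hk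
    by_contra hkT
    exact hk1 t (ht.trans_le (not_lt.1 hkT)) hk2
  have hsub : ((Finset.range T).image x) ⊆ hfin.toFinset.image x := by
    intro y hy
    obtain ⟨t, ht, rfl⟩ := Finset.mem_image.1 hy
    have hex : ∃ j, x j = x t := ⟨t, rfl⟩
    refine Finset.mem_image.2 ⟨Nat.find hex, hfin.mem_toFinset.2 ⟨t, Finset.mem_range.1 ht,
      (hB _ _).2 ⟨fun j hj => ?_, (Nat.find_spec hex).symm⟩⟩, Nat.find_spec hex⟩
    rw [Nat.find_spec hex]
    exact Nat.find_min hex hj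
  rw [Set.ncard_eq_toFinset_card _ hfin]
  exact_mod_cast (Finset.card_le_card hsub).trans Finset.card_image_le

end Deterministic

/-! ### The diagonal construction -/

section Diagonal

variable {X : Type u}

/-- If any initial segment of blocks can be extended, with `n + 1` cycles per block, to one that has
the property `P n` at some block, then there is a single sequence of blocks that has the properties
`P n` for all `n`, and the number of cycles per block tends to infinity. -/
theorem exists_diagonal_blocks [Nonempty X] {P : ℕ → ℕ → (ℕ → (ℕ → X) × ℕ) → Prop}
    (hP : ∀ n j c c', (∀ i ≤ j, c i = c' i) → P n j c → P n j c')
    (step : ∀ n c J, ∃ ξ, ∃ j ≥ J, P n j (extendBlocks c J (ξ, n + 1))) :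
    ∃ c : ℕ → (ℕ → X) × ℕ, (∀ᶠ j in atTop, (c j).2 ≤ j) ∧
      Tendsto (fun j => (c j).2) atTop atTop ∧ ∀ n, ∃ j, n ≤ j ∧ P n j c := by
  choose ξ jn hjn hstep using step
  -- after `n` stages: block data, and the number of the first block that is not yet frozen
  let s : ℕ → (ℕ → (ℕ → X) × ℕ) × ℕ := fun n =>
    Nat.rec (fun _ => (fun _ => Classical.arbitrary X, 1), 1)
      (fun n s => (extendBlocks s.1 s.2 (ξ n s.1 s.2, n + 1), jn n s.1 s.2 + 1)) n
  have hs : ∀ n, s (n + 1) = (extendBlocks (s n).1 (s n).2 (ξ n (s n).1 (s n).2, n + 1),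
    jn n (s n).1 (s n).2 + 1) := fun n => rfl
  have hmono : StrictMono fun n => (s n).2 := strictMono_nat_of_lt_succ fun n => by
    rw [hs]; exact Nat.lt_succ_of_le (hjn _ _ _)
  have hge : ∀ n, n + 1 ≤ (s n).2 := fun n => by
    induction n with
    | zero => exact le_rfl
    | succ n ih => exact Nat.succ_le_of_lt (ih.trans_lt (hmono (Nat.lt_succ_self n)))
  have hagree : ∀ n m i, n ≤ m → i < (s n).2 → (s m).1 i = (s n).1 i := by
    intro n m i hnm hi
    induction m, hnm using Nat.le_induction with
    | base => rfl
    | succ m hnm ih =>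
      rw [hs, ← ih]
      exact if_pos (hi.trans_le (hmono.monotone hnm))
  let c : ℕ → (ℕ → X) × ℕ := fun i => (s i).1 i
  have hc : ∀ n i, i < (s n).2 → c i = (s n).1 i := fun n i hi => by
    rcases le_total n i with h | h
    · exact hagree n i i h hi
    · exact (hagree i n i h (hge i)).symm
  have hcyc : ∀ n i, (s n).2 ≤ i → i < (s (n + 1)).2 → (c i).2 = n + 1 := fun n i h1 h2 => by
    rw [hc (n + 1) i h2, hs]
    simp [extendBlocks, not_lt.2 h1]
  have hstage : ∀ i, 1 ≤ i → ∃ n, (s n).2 ≤ i ∧ i < (s (n + 1)).2 := fun i hi => by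
    have hex : ∃ n, i < (s (n + 1)).2 := ⟨i, (Nat.lt_succ_self i).trans_le
      ((hge i).trans (hmono (Nat.lt_succ_self i)).le)⟩
    refine ⟨Nat.find hex, ?_, Nat.find_spec hex⟩
    rcases Nat.eq_zero_or_pos (Nat.find hex) with h0 | h0
    · rw [h0]; exact hi
    · have hmin := Nat.find_min hex (m := Nat.find hex - 1) (by omega)
      have hcancel : Nat.find hex - 1 + 1 = Nat.find hex := by omega
      rwa [hcancel, not_lt] at hmin
  refine ⟨c, ?_, tendsto_atTop.2 fun m => ?_, fun n => ?_⟩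
  · filter_upwards [eventually_ge_atTop 1] with i hi
    obtain ⟨n, h1, h2⟩ := hstage i hi
    rw [hcyc n i h1 h2]
    exact (hge n).trans h1
  · filter_upwards [eventually_ge_atTop (s m).2] with i hi
    obtain ⟨n, h1, h2⟩ := hstage i (((Nat.le_add_left 1 m).trans (hge m)).trans hi)
    rw [hcyc n i h1 h2]
    exact (hmono.lt_iff_lt.1 (hi.trans_lt h2)).le
  · have hj : n ≤ jn n (s n).1 (s n).2 := ((Nat.le_succ n).trans (hge n)).trans (hjn _ _ _)
    refine ⟨jn n (s n).1 (s n).2, hj, hP n _ _ c (fun i hi => ?_) (hstep n (s n).1 (s n).2)⟩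
    rw [hc (n + 1) i (by rw [hs]; exact Nat.lt_succ_of_le hi), hs]

end Diagonal

/-! ### No rule learns both `classC1` and the deterministic processes in `classC2` -/

section Impossibility

variable {X : Type u} {A : Type v} [MeasurableSpace X] [MeasurableSpace A]

/-- Block `j` is decisive if it has `n + 1` cycles, if its points do not occur in earlier blocks
with another number of cycles and are separated by the partition `κ j`, and if `f` is expected to
try `a₂` at no more than a quarter of them. -/
def Decisive (f : LearningRule X A) (κ : ℕ → X → ℕ) (a₁ a₂ : A) (x₀ : X) (n j : ℕ)
    (c : ℕ → (ℕ → X) × ℕ) : Prop :=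
  2 ≤ j ∧ (c j).2 = n + 1 ∧ n + 1 ≤ j ∧
    (∀ j' < j, (c j').2 ≠ n + 1 → ∀ i i', (c j').1 i' ≠ (c j).1 i) ∧
    Set.InjOn (fun i => κ j ((c j).1 i)) (Set.Iio j.factorial) ∧
    expectedTried f κ a₁ a₂ (blockProcess x₀ c) j (j.factorial / (n + 1)) (n + 1) ≤
      (j.factorial / (n + 1) : ℕ) / 4

variable {f : LearningRule X A} {κ : ℕ → X → ℕ} {a₁ a₂ : A}

theorem Decisive.congr {x₀ : X} {n j : ℕ} {c c' : ℕ → (ℕ → X) × ℕ} (h : ∀ i ≤ j, c i = c' i)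
    (hc : Decisive f κ a₁ a₂ x₀ n j c) : Decisive f κ a₁ a₂ x₀ n j c' := by
  obtain ⟨h1, h2, h3, h4, h5, h6⟩ := hc
  refine ⟨h1, by rw [← h j le_rfl]; exact h2, h3, fun j' hj' hne => ?_, ?_, ?_⟩
  · rw [← h j' hj'.le] at hne ⊢
    rw [← h j le_rfl]
    exact h4 j' hj' hne
  · rw [← h j le_rfl]
    exact h5
  · rw [← expectedTried_congr (x := blockProcess x₀ c) (Nat.mul_div_le _ _) fun t ht =>
      blockProcess_congr x₀ h (ht.trans_le (two_mul_factorial_le (by omega)))]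
    exact h6

theorem div_mul_factorial {n j : ℕ} (h : n + 1 ≤ j) :
    (n + 1) * (j.factorial / (n + 1)) = j.factorial :=
  Nat.mul_div_cancel' (Nat.dvd_factorial (Nat.succ_pos n) h)

/-- A rule that learns all of `classC1` compares well with the safe action if the process cycles
through random points, so that it can afford to try `a₂` at few points only. -/
theorem exists_decisive_extension [MeasurableSingletonClass A] {ν : Measure X}
    [IsProbabilityMeasure ν] (hν : ∀ y, ν {y} = 0) (hκ : ∀ j, Measurable (κ j))
    (hsep : ∀ᵐ ξ ∂(Measure.infinitePi fun _ : ℕ => ν), ∀ᶠ j in atTop,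
      Set.InjOn (fun i => κ j (ξ i)) (Set.Iio j.factorial)) (ha : a₁ ≠ a₂)
    (hf : ∀ μ ∈ classC1 X, UniversallyConsistent .oblivious f μ) (x₀ : X) (n : ℕ)
    (c : ℕ → (ℕ → X) × ℕ) (J : ℕ) :
    ∃ ξ, ∃ j ≥ J, Decisive f κ a₁ a₂ x₀ n j (extendBlocks c J (ξ, n + 1)) := by
  have hmeas := measurable_blockProcess_extendBlocks x₀ c J (n + 1)
  let μ : ProbabilityMeasure (ℕ → X) := ⟨(Measure.infinitePi fun _ : ℕ => ν).map
    fun ξ => blockProcess x₀ (extendBlocks c J (ξ, n + 1)),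
    Measure.isProbabilityMeasure_map hmeas.aemeasurable⟩
  have hμ := hf μ (map_blockProcess_mem_classC1 ν x₀ c J (Nat.succ_pos n) rfl)
  have hreg := ae_of_ae_map hmeas.aemeasurable
    (hμ.ae_eventually_integral_detRegret_le (τ := Measure.infinitePi fun _ : ℕ × ℕ => fairCoin)
      (ρ := fun θ => labelReward (probeReward a₁ a₂) (probeGroup κ) θ) (π := fun _ _ => a₁)
      (measurable_probe hκ) measurable_const)
  have hD : (⋃ j' ∈ Set.Iio J, Set.range (c j').1).Countable :=
    (Set.to_countable _).biUnion fun j' _ => Set.countable_range _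
  obtain ⟨ξ, hξ1, hξ2, hξ3⟩ := (hreg.and (hsep.and (ae_forall_notMem_of_countable ν hν hD))).exists
  set x := blockProcess x₀ (extendBlocks c J (ξ, n + 1)) with hx
  -- with `p = n + 1` and `δ = 4 * j! / M`, the bound `2 ^ p * (4 * δ)` of `expectedTried_le` is a
  -- quarter of the number `j! / p` of points
  set M : ℕ := 64 * (n + 1) * 2 ^ (n + 1) with hM
  have hM0 : (0 : ℝ) < M := by rw [hM]; positivity
  obtain ⟨T₀, hT₀⟩ := eventually_atTop.1 (hξ1 (1 / M) (by positivity))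
  obtain ⟨j, hj1, hj2⟩ :=
    (hξ2.and (eventually_ge_atTop (max (max J 2) (max (n + 1) (max M T₀))))).exists
  simp only [max_le_iff] at hj2
  obtain ⟨⟨hjJ, hj2⟩, hjn, hjM, hjT⟩ := hj2
  have hcj : extendBlocks c J (ξ, n + 1) j = (ξ, n + 1) := if_neg (not_lt.2 hjJ)
  have hpn := div_mul_factorial hjn
  set N := j.factorial / (n + 1) with hN
  refine ⟨ξ, j, hjJ, hj2, by rw [hcj], hjn, fun j' hj' hne i i' => ?_, by rw [hcj]; exact hj1, ?_⟩
  · by_cases hj'J : j' < J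
    · intro heq
      rw [hcj, extendBlocks, if_pos hj'J] at heq
      exact hξ3 i (Set.mem_biUnion (x := j') hj'J ⟨i', heq⟩)
    · exact absurd (by rw [extendBlocks, if_neg hj'J]) hne
  have hfac : (0 : ℝ) < j.factorial := by exact_mod_cast j.factorial_pos
  have hNle : N ≤ j.factorial := Nat.div_le_self _ _
  have hxs : ∀ s < j.factorial, x (j.factorial + s) = ξ (s % N) := fun s hs => by
    rw [hx, blockProcess_add _ _ (by omega) hs, hcj]
  have hδ : ∀ q ≤ n + 1, ∫ ω, detRegret f (labelReward (probeReward a₁ a₂) (probeGroup κ) ω.1)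
      (fun _ => a₁) ω.2 x (j.factorial + q * N) ∂(probeLaw f) + 2 * (j - 1).factorial ≤
      4 * (j.factorial / M) := by
    intro q hq
    have hqN : q * N ≤ j.factorial := hpn ▸ Nat.mul_le_mul_right N hq
    have h1 := hT₀ (j.factorial + q * N)
      (hjT.trans ((Nat.self_le_factorial j).trans (Nat.le_add_right _ _)))
    have h2 : (1 / M : ℝ) * (j.factorial + q * N : ℕ) ≤ 1 / M * (2 * j.factorial) := by
      gcongr
      exact_mod_cast (by omega : j.factorial + q * N ≤ 2 * j.factorial)
    have h3 : ((j - 1).factorial : ℝ) ≤ j.factorial / M := by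
      rw [factorial_pred_eq (by omega)]
      gcongr
    have h4 : (1 / M : ℝ) * (2 * j.factorial) = 2 * (j.factorial / M) := by ring
    have h5 := h1.trans (h2.trans_eq h4)
    change ∫ ω, _ ∂(probeLaw f) ≤ _ at h5
    linarith
  have h := expectedTried_le hκ ha hj2 hpn hxs
    (hj1.mono fun i hi => lt_of_lt_of_le hi hNle) (by positivity) hδ (n + 1) le_rfl
  refine h.trans (le_of_eq ?_)
  change _ = (N : ℝ) / 4
  have hfacN : (j.factorial : ℝ) = (n + 1) * N := by exact_mod_cast hpn.symm
  rw [hfacN, hM]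
  push_cast
  field_simp
  ring

/-- If `X` carries a non-atomic law then no rule learns under all of `classC1` and under all
deterministic processes in `classC2`. -/
theorem not_universallyConsistent_classC1_classC2 [MeasurableSingletonClass X]
    [MeasurableSingletonClass A] [MeasurableSpace.CountablySeparated X]
    (hX : AdmitsNonatomicProbability X) (ha : a₁ ≠ a₂)
    (h1 : ∀ μ ∈ classC1 X, UniversallyConsistent .oblivious f μ)
    (h2 : ∀ μ ∈ classC2 X ∩ deterministicProcesses X, UniversallyConsistent .oblivious f μ) :
    False := by
  classical
  obtain ⟨ν, hνp, hν⟩ := hX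
  obtain ⟨x₀⟩ : Nonempty X := nonempty_of_isProbabilityMeasure ν
  have : Nonempty X := ⟨x₀⟩
  obtain ⟨κ, hκ, hsep⟩ := exists_separating_partitions ν hν
  obtain ⟨c, hc1, hc2, hdec⟩ := exists_diagonal_blocks (P := Decisive f κ a₁ a₂ x₀)
    (fun n j c c' => Decisive.congr) (exists_decisive_extension hν hκ hsep ha h1 x₀)
  choose jn hjn hdec using hdec
  set x := blockProcess x₀ c with hx
  let μ : ProbabilityMeasure (ℕ → X) := ⟨Measure.dirac x, inferInstance⟩
  have hμ := h2 μ ⟨mem_classC2_of_sublinearDistinct rfl (sublinearDistinct_blockProcess x₀ hc1 hc2),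
    x, rfl⟩
  -- the policy that knows the labels of the points of all decisive blocks
  let good : (ℕ × ℕ → Bool) → X → Prop := fun θ y =>
    ∃ n, y ∈ Set.range (c (jn n)).1 ∧ θ (jn n, κ (jn n) y) = true
  let π : (ℕ × ℕ → Bool) → X → A := fun θ y => if good θ y then a₂ else a₁
  have hπ : Measurable fun p : (ℕ × ℕ → Bool) × X => π p.1 p.2 := by
    refine Measurable.ite ?_ measurable_const measurable_const
    have : {p : (ℕ × ℕ → Bool) × X | good p.1 p.2} = ⋃ n, (Prod.snd ⁻¹' Set.range (c (jn n)).1) ∩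
        {p : (ℕ × ℕ → Bool) × X | p.1 (jn n, κ (jn n) p.2) = true} := by
      ext p; simp [good]
    rw [this]
    refine MeasurableSet.iUnion fun n => MeasurableSet.inter
      (measurable_snd (Set.countable_range _).measurableSet) ?_
    exact measurable_label (g := fun y => (jn n, κ (jn n) y))
      (measurable_const.prodMk (hκ (jn n))) (measurableSet_singleton true)
  -- points of different decisive blocks are distinct, so there is no conflict between their labels
  have hgood : ∀ n θ i, good θ ((c (jn n)).1 i) ↔ θ (jn n, κ (jn n) ((c (jn n)).1 i)) = true := by
    refine fun n θ i => ⟨?_, fun h => ⟨n, ⟨i, rfl⟩, h⟩⟩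
    rintro ⟨m, ⟨i', hi'⟩, h⟩
    obtain rfl | hmn := eq_or_ne m n
    · exact h
    · exfalso
      have hm := (hdec m).2.1
      have hn := (hdec n).2.1
      rcases lt_trichotomy (jn m) (jn n) with hlt | heq | hlt
      · exact (hdec n).2.2.2.1 _ hlt (by rw [hm]; omega) i i' hi'
      · rw [heq, hn] at hm
        omega
      · exact (hdec m).2.2.2.1 _ hlt (by rw [hn]; omega) i' i hi'.symm
  have hreg := hμ.ae_eventually_integral_detRegret_le
    (τ := Measure.infinitePi fun _ : ℕ × ℕ => fairCoin)
    (ρ := fun θ => labelReward (probeReward a₁ a₂) (probeGroup κ) θ) (π := π)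
    (measurable_probe hκ) hπ
  change ∀ᵐ x ∂(Measure.dirac x), _ at hreg
  rw [ae_dirac_eq] at hreg
  obtain ⟨T₀, hT₀⟩ := eventually_atTop.1 (hreg (1 / 128) (by norm_num))
  obtain ⟨n, hn⟩ := exists_nat_ge (max T₀ 128)
  have hnj := hjn n
  obtain ⟨hj2, hcn, hnj', -, -, htried⟩ := hdec n
  set j := jn n with hj
  have hjT : max T₀ 128 ≤ j := hn.trans hnj
  have hpn := div_mul_factorial hnj'
  set N := j.factorial / (n + 1) with hN
  have hxs : ∀ s < j.factorial, x (j.factorial + s) = (c j).1 (s % N) := fun s hs => by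
    rw [hx, blockProcess_add _ _ (by omega) hs, hcn]
  -- the regret in the block is at least `j! / 16`, but at most `j! / 64` up to its end, and the
  -- earlier active parts account for at most `j! / 64`
  have hlow := le_sum_integral_probeLoss (f := f) hκ ha (by omega) hpn hxs hπ fun θ i _ => by
    by_cases h : θ (j, κ j ((c j).1 i)) = true
    · rw [if_pos h]
      exact if_pos ((hgood n θ i).2 h)
    · rw [if_neg h]
      exact if_neg (mt (hgood n θ i).1 h)
  have hup := sum_integral_probeLoss_le (f := f) (x := x) (a₁ := a₁) (a₂ := a₂) hκ hπ hj2 (n + 1) N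
  have hlim : ∫ ω, detRegret f (labelReward (probeReward a₁ a₂) (probeGroup κ) ω.1) (π ω.1) ω.2 x
      (j.factorial + (n + 1) * N) ∂(probeLaw f) ≤
        1 / 128 * (j.factorial + (n + 1) * N : ℕ) := hT₀ _
    (((le_max_left _ _).trans hjT).trans ((Nat.self_le_factorial j).trans (Nat.le_add_right _ _)))
  have hfac : (0 : ℝ) < j.factorial := by exact_mod_cast j.factorial_pos
  have hfacN : ((n : ℝ) + 1) * N = j.factorial := by exact_mod_cast hpn
  have hpred : ((j - 1).factorial : ℝ) ≤ j.factorial / 128 := by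
    rw [factorial_pred_eq (by omega)]
    gcongr
    exact_mod_cast (le_max_right _ _).trans hjT
  have hquarter : (j.factorial : ℝ) / 4 ≤ (n + 1 : ℕ) * ((N : ℝ) / 2 -
      expectedTried f κ a₁ a₂ x j N (n + 1)) := by
    rw [← hfacN]
    push_cast
    rw [mul_div_assoc]
    refine mul_le_mul_of_nonneg_left ?_ (by positivity)
    linarith
  push_cast at hlim
  rw [hfacN] at hlim
  linarith

end Impossibility

end ContextualBandit

theorem theorem1 {X : Type*} {A : Type*}
    [TopologicalSpace X] [TopologicalSpace.MetrizableSpace X] [TopologicalSpace.SeparableSpace X]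
    [MeasurableSpace X] [BorelSpace X]
    [TopologicalSpace A] [TopologicalSpace.MetrizableSpace A] [TopologicalSpace.SeparableSpace A]
    [MeasurableSpace A] [BorelSpace A] :
    (Finite A → 2 ≤ Nat.card A → ∀ m : ContextualBandit.RewardModel,
      ((∃ f : ContextualBandit.LearningRule X A, ContextualBandit.OptimisticallyUniversal m f) ↔
        ¬ ContextualBandit.AdmitsNonatomicProbability X)) ∧
    (Infinite A → ∀ m : ContextualBandit.RewardModel,
      ∃ f : ContextualBandit.LearningRule X A, ContextualBandit.OptimisticallyUniversal m f) ∧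
    (Finite A → 2 ≤ Nat.card A → ContextualBandit.AdmitsNonatomicProbability X →
      ∀ m : ContextualBandit.RewardModel, ¬ ∃ f : ContextualBandit.LearningRule X A,
        (∀ μ ∈ ContextualBandit.classC1 X, ContextualBandit.UniversallyConsistent m f μ) ∧
        (∀ μ ∈ ContextualBandit.classC2 X ∩ ContextualBandit.deterministicProcesses X,
          ContextualBandit.UniversallyConsistent m f μ)) := by
  have : SecondCountableTopology X := by
    let _ := TopologicalSpace.metrizableSpaceMetric X
    exact UniformSpace.secondCountable_of_separable X
  have hdiag : MeasurableSet {p : X × X | p.1 = p.2} :=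
    measurableSet_eq_fun measurable_fst measurable_snd
  have htwo : 2 ≤ Nat.card A → ∃ a₀ a₁ : A, a₀ ≠ a₁ := fun h => by
    have hfin : Finite A := Nat.finite_of_card_ne_zero (by omega)
    have := Finite.one_lt_card_iff_nontrivial.1 (show 1 < Nat.card A from h)
    exact exists_pair_ne A
  have himpossible : 2 ≤ Nat.card A → ContextualBandit.AdmitsNonatomicProbability X →
      ∀ m : ContextualBandit.RewardModel, ¬ ∃ f : ContextualBandit.LearningRule X A,
        (∀ μ ∈ ContextualBandit.classC1 X, ContextualBandit.UniversallyConsistent m f μ) ∧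
        (∀ μ ∈ ContextualBandit.classC2 X ∩ ContextualBandit.deterministicProcesses X,
          ContextualBandit.UniversallyConsistent m f μ) := by
    rintro hA hX m ⟨f, h1, h2⟩
    obtain ⟨a₀, a₁, ha⟩ := htwo hA
    exact ContextualBandit.not_universallyConsistent_classC1_classC2 hX ha
      (fun μ hμ => (h1 μ hμ).oblivious) fun μ hμ => (h2 μ hμ).oblivious
  refine ⟨fun hfin hA m => ?_, fun hinf m => ?_, fun _ => himpossible⟩
  · obtain ⟨a₀, a₁, ha⟩ := htwo hA
    have : Nonempty A := ⟨a₀⟩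
    obtain ⟨g, hg⟩ := ContextualBandit.exists_rule_sublinearDistinct (A := A) hdiag
    constructor
    · rintro ⟨f, hf⟩ hX
      obtain ⟨g', hg'⟩ := ContextualBandit.exists_rule_classC1 (X := X) (A := A)
      refine himpossible hA hX m ⟨f, fun μ hμ => hf μ ⟨g', hg' μ hμ m⟩, ?_⟩
      rintro μ ⟨hμ, x, hx⟩
      refine hf μ ⟨g, hg μ ?_ m⟩
      have hsub := ContextualBandit.sublinearDistinct_of_mem_classC2 hx hμ
      rw [hx, MeasureTheory.ae_dirac_eq]
      exact hsub
    · rintro hX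
      refine ⟨g, fun μ hμ => ?_⟩
      obtain ⟨f, hf⟩ := hμ
      exact hg μ (hf.oblivious.ae_sublinearDistinct hX ha) m
  · by_cases hA : Countable A
    · obtain ⟨g, hg⟩ := ContextualBandit.exists_rule_classC1 (X := X) (A := A)
      refine ⟨g, fun μ hμ => ?_⟩
      obtain ⟨f, hf⟩ := hμ
      exact hg μ hf.oblivious.mem_classC1 m
    · have : Uncountable A := not_countable_iff.1 hA
      -- no process is learnable, so any rule will do
      refine ⟨{ Seed := Unit
                seedLaw := MeasureTheory.Measure.dirac ()
                act := fun _ _ => Classical.arbitrary A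
                measurable_act := fun _ => measurable_const }, fun μ hμ => ?_⟩
      obtain ⟨f, hf⟩ := hμ
      exact absurd hf.oblivious (ContextualBandit.not_universallyConsistent_of_uncountable f μ)
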